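/- **Setting.** Let $R=\begin{pmatrix}1&1\\0&1\end{pmatrix}$, $L=\begin{pmatrix}1&0\\1&1\end{pmatrix}$. Let $\varphi\in SL(2,\mathbb Z)$ be Anosov (two distinct real eigenvalues), conjugate in $SL(2,\mathbb Z)$ to $\varepsilon W$, where $\varepsilon=\pm1$ and $W=w_0w_1\cdots w_{N-1}$ is a word in $R$ and $L$. Let $M$ be the punctured torus bundle over the circle with monodromy $\varphi$, and let $\mathcal T=\{\mathcal T_0,\dots,\mathcal T_{N-1}\}$ be its monodromy triangulation: with $W_k=w_0\cdots w_{k-1}$, the ideal tetrahedron $\mathcal T_k$ projects to the $W_k$-image of the unit square in $\mathbb R^2/\mathbb Z^2$, with bottom edge the diagonal in direction $W_k(-1,1)$ and top edge the diagonal in direction $W_k(1,1)$; the top faces of $\mathcal T_k$ are glued to the bottom faces of $\mathcal T_{k+1}$, and those of $\mathcal T_{N-1}$ to the bottom faces of $\mathcal T_0$ by the monodromy. Let $\mathcal B$ be $\mathbb R$, $\mathbb C$ or $\mathbb R+\mathbb R\tau$ ($\tau^2=1$), with square-norm $|z|^2=z\bar z$. Let $\mathbb X$ be the set of lines of Hermitian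 $2\times2$ matrices over $\mathcal B$ with positive determinant; it is $\mathbb H^2$, $\mathbb H^3$, $\mathrm{AdS}^3$ respectively. The group $PGL^+(2,\mathcal B)=\{A:|\det A|^2>0\}/\!\sim$ acts on $\mathbb X$ and on its ideal boundary, the lines of nonzero Hermitian matrices of determinant $0$, by $X\mapsto AXA^*$. Four ideal points span an ideal tetrahedron if representatives $Z_1,\dots,Z_4$ can be chosen so that $\sum s_iZ_i\in\mathbb X$ whenever $0\le s_i<1$, $\sum s_i=1$. Its shape parameter $z\in\mathcal B$ at the edge $Z_1Z_2$ is the image of $Z_4$ under the element of $PGL^+(2,\mathcal B)$ taking $Z_1,Z_2,Z_3$ to $\infty,0,1$; the shape parameters at the other edges are $z$, $\frac1{1-z}$, $\frac{z-1}z$. A *triangulated $\mathbb X$-structure on $(M,\mathcal T)$* is a realization of the tetrahedra of $\mathcal T$ as ideal tetrahedra in $\mathbb X$ and of the face gluings by elements of $PGL^+(2,\mathcal B)$, such that around every edge the gluing isometries compose to the identity and the total dihedral angle (the angle swept out in the plane $\mathcal B$ by the tetrahedra developed around the edge $0\infty$) is $2\pi$. For $\mathcal B=\mathbb R$, where the tetrahedra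 are collapsed, it is called a *transversely hyperbolic foliation on $(M,\mathcal T)$*, and a negative (positive) shape parameter has dihedral angle $\pi$ ($0$). A *hyperbolic* (resp. *AdS*) *structure on $(M,\mathcal T)$* is one for $\mathcal B=\mathbb C$ (resp. $\mathbb R+\mathbb R\tau$) whose tetrahedra are all positively oriented. Let $z_j$ be the shape parameter of $\mathcal T_j$ at its top and bottom edges. The real deformation variety $\mathscr D_{\mathbb R}$ is the set of $(z_j)\in(\mathbb R\setminus\{0,1\})^N$ such that around every edge of $\mathcal T$ the shape parameters have product $1$ and the total dihedral angle is $2\pi$. Let $\mathcal V^\pm\subset\mathscr D_{\mathbb R}$ be the union of its two canonical components, namely the set of $(z_j)\in\mathscr D_{\mathbb R}$ with $z_j>0$ for all $j$. Structures $S_t$ ($t>0$) *collapse* to a foliation $\mathcal F$ as $t\to0$ if, along every path of tetrahedra, the ideal vertices of the tetrahedra developed by $S_t$ converge in real projective space to those developed by $\mathcal F$, the holonomy of $S_t$ converges to that of $\mathcal F$ in $PGL(2,\mathcal B)$, and the shape parameters of $S_t$ converge to those of $\mathcal F$. **Theorem.** Every point of $\mathcal V^\pm$ is the shape parameter vector of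 some transversely hyperbolic foliation on $(M,\mathcal T)$. For every such foliation $\mathcal F$ there are hyperbolic structures $\mathscr H_t$ and AdS structures $\mathscr A_t$ on $(M,\mathcal T)$, defined for all $t>0$ and with shape parameters depending continuously on $t$, such that both $\mathscr H_t$ and $\mathscr A_t$ collapse to $\mathcal F$ as $t\to0$. -/

import Mathlib

open Matrix Filter Topology

noncomputable section

namespace Regen

/-! ### Shape parameter algebras -/

/-- Linear coordinates `a + b κ ↦ a + b i` on the algebra `B = ℝ + ℝ κ` (or `B = ℝ`), used only to
speak of orientations, angles and limits in the real plane underlying `B`. -/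
class HasPlane (B : Type) where
  /-- the point of the oriented real plane with the coordinates of an element of `B` -/
  plane : B → ℂ

/-- The pseudo-complex numbers `ℝ + ℝ τ` with `τ² = 1`, with conjugation `star (a + b τ) = a - b τ`. -/
abbrev PseudoComplex : Type := QuadraticAlgebra ℝ 1 0

instance : HasPlane ℝ := ⟨fun x => (x : ℂ)⟩
instance : HasPlane ℂ := ⟨fun z => z⟩
instance : HasPlane PseudoComplex := ⟨fun z => ⟨z.re, z.im⟩⟩

section Model

variable {B : Type} [CommRing B] [StarRing B] [Algebra ℝ B]

/-- `b` is a positive real number. -/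
def IsPosReal (b : B) : Prop := ∃ r : ℝ, 0 < r ∧ b = algebraMap ℝ B r

/-- A matrix that represents a point of the projective model space `𝕏`: the lines in the space of
Hermitian matrices on which the form `⟨X, X⟩ = - det X` is negative. The space `𝕏` is the hyperbolic
plane for `B = ℝ`, hyperbolic three-space for `B = ℂ`, anti de Sitter space for `B = ℝ + ℝ τ`. -/
def InModel (X : Matrix (Fin 2) (Fin 2) B) : Prop := Xᴴ = X ∧ IsPosReal X.det

/-- A matrix that represents a point of the ideal boundary of `𝕏`. -/
def IsIdealPoint (X : Matrix (Fin 2) (Fin 2) B) : Prop := Xᴴ = X ∧ X ≠ 0 ∧ X.det = 0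

/-- Equality of points of the real projective space of Hermitian matrices. -/
def SamePoint (X Y : Matrix (Fin 2) (Fin 2) B) : Prop := ∃ r : ℝ, r ≠ 0 ∧ X = r • Y

/-- A matrix that represents an element of `PGL⁺(2, B)`: the condition is `|det A|² > 0`. -/
def IsIsometry (A : Matrix (Fin 2) (Fin 2) B) : Prop := IsPosReal (A.det * star A.det)

/-- The action of `PGL⁺(2, B)` on Hermitian matrices. -/
def act (A X : Matrix (Fin 2) (Fin 2) B) : Matrix (Fin 2) (Fin 2) B := A * X * Aᴴ

/-- `Z₀, …, Z₃` span an ideal tetrahedron: the map `s ↦ [∑ sᵥ Zᵥ]` sends the standard simplex with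
its vertices removed into `𝕏`. (It may be collapsed, and it always is for `B = ℝ`, where this
map is the projection of the simplex onto an ideal quadrilateral of the hyperbolic plane.) -/
def IsIdealTetrahedron (Z : Fin 4 → Matrix (Fin 2) (Fin 2) B) : Prop :=
  (∀ v, IsIdealPoint (Z v)) ∧
    ∀ s : Fin 4 → ℝ, (∀ v, 0 ≤ s v ∧ s v < 1) → ∑ v, s v = 1 → InModel (∑ v, s v • Z v)

/-- The ideal points `∞, 0, 1, z` as rank one Hermitian matrices `u u*`, for
`u = (1, 0), (0, 1), (1, 1), (z, 1)`. -/
def standardPosition (z : B) : Fin 4 → Matrix (Fin 2) (Fin 2) B :=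
  ![!![1, 0; 0, 0], !![0, 0; 0, 1], !![1, 1; 1, 1], !![z * star z, z; star z, 1]]

/-- The generalized cross ratio `(Z₀, Z₁; Z₂, Z₃)` is `z`: an element of `PGL⁺(2, B)` takes the
four ideal points to `∞, 0, 1, z`. -/
def HasShape (Z : Fin 4 → Matrix (Fin 2) (Fin 2) B) (z : B) : Prop :=
  ∃ A, IsIsometry A ∧ ∀ v, SamePoint (act A (Z v)) (standardPosition z v)

/-- The coordinates `x₁, …, x₄` of the Hermitian matrix
`[x₁ + x₂, x₃ - x₄ κ; x₃ + x₄ κ, x₁ - x₂]`. -/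
def hermCoord [HasPlane B] (X : Matrix (Fin 2) (Fin 2) B) : Fin 4 → ℝ :=
  ![((HasPlane.plane (X 0 0)).re + (HasPlane.plane (X 1 1)).re) / 2,
    ((HasPlane.plane (X 0 0)).re - (HasPlane.plane (X 1 1)).re) / 2,
    (HasPlane.plane (X 1 0)).re, (HasPlane.plane (X 1 0)).im]

/-- The map `s ↦ [∑ sᵥ Zᵥ]` preserves orientation, for the orientation of projective space given by
the coordinates `x₁, …, x₄`. -/
def IsPositivelyOriented [HasPlane B] (Z : Fin 4 → Matrix (Fin 2) (Fin 2) B) : Prop :=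
  0 < (Matrix.of fun v => hermCoord (Z v)).det

end Model

/-! ### Ideal triangulations -/

/-- An oriented ideal triangulation with `n` tetrahedra, each with vertices `0, 1, 2, 3`. The face
opposite to the vertex `f` of the tetrahedron `j` is glued to a face of `nbr j f`, a vertex `v ≠ f`
of `j` being identified with the vertex `perm j f v`; by convention `perm j f f` is the vertex
opposite to the face of `nbr j f`. The manifold is the union of the tetrahedra, vertices removed. -/
structure IdealTriangulation (n : ℕ) where
  nbr : Fin n → Fin 4 → Fin n
  perm : Fin n → Fin 4 → Equiv.Perm (Fin 4)
  nbr_nbr : ∀ j f, nbr (nbr j f) (perm j f f) = j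
  perm_perm : ∀ j f, perm (nbr j f) (perm j f f) = (perm j f)⁻¹
  sign_perm : ∀ j f, Equiv.Perm.sign (perm j f) = -1
  not_self : ∀ j f, (nbr j f, perm j f f) ≠ (j, f)

namespace IdealTriangulation

variable {n : ℕ} (T : IdealTriangulation n)

/-- A tetrahedron with an ordering of its vertices. The flag `(j, π)` singles out the oriented edge
from `π 0` to `π 1`. -/
abbrev Flag (n : ℕ) : Type := Fin n × Equiv.Perm (Fin 4)

/-- Turning around the edge `π 0, π 1`: pass from `(j, π)` through the face `π 0, π 1, π 3` to the
next tetrahedron, in which the vertices of this face take the places `0, 1, 2`. -/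
def turn (x : Flag n) : Flag n :=
  (T.nbr x.1 (x.2 2), T.perm x.1 (x.2 2) * x.2 * Equiv.swap 2 3)

/-- The number of tetrahedra around the edge of a flag. -/
def valence (x : Flag n) : ℕ := Function.minimalPeriod T.turn x

/-- The last tetrahedron of the path that starts in `j` and crosses the faces in the list. -/
def endpoint : Fin n → List (Fin 4) → Fin n
  | j, [] => j
  | j, f :: l => endpoint (T.nbr j f) l

end IdealTriangulation

/-! ### Shape parameters and Thurston's equations -/

section Equations

variable {B : Type} [CommRing B]

/-- The shape parameter of the edge `a b` of a tetrahedron whose edge `0 1` has shape parameter `z`: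
it is `z` at `01, 23`, it is `1 / (1 - z)` at `02, 13`, and `(z - 1) / z` at `03, 12`. -/
def edgeShape (z : B) (a b : Fin 4) : B :=
  if ({a, b} : Finset (Fin 4)) = {0, 1} ∨ ({a, b} : Finset (Fin 4)) = {2, 3} then z
  else if ({a, b} : Finset (Fin 4)) = {0, 2} ∨ ({a, b} : Finset (Fin 4)) = {1, 3} then
    Ring.inverse (1 - z)
  else (z - 1) * Ring.inverse z

variable {n : ℕ} (T : IdealTriangulation n)

/-- The product of the shape parameters at the first `k` tetrahedra around the edge of a flag. -/
def partialHolonomy (z : Fin n → B) (x : IdealTriangulation.Flag n) (k : ℕ) : B :=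
  ∏ i ∈ Finset.range k,
    edgeShape (z (T.turn^[i] x).1) ((T.turn^[i] x).2 0) ((T.turn^[i] x).2 1)

/-- The total dihedral angle around the edge of a flag. Put the edge at `0, ∞`; then the `k`-th
tetrahedron around it develops to the ideal vertices `∞, 0, w k, w (k + 1)`, where `w` is the
partial holonomy, and the total dihedral angle is the angle swept out at `0` by the segments from
`w k` to `w (k + 1)`. Over `ℂ` it is the sum of the arguments of the shape parameters. Over `ℝ` a
negative shape parameter contributes `π` and a positive one contributes `0`. -/
def totalAngle [HasPlane B] (z : Fin n → B) (x : IdealTriangulation.Flag n) : ℝ :=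
  ∑ k ∈ Finset.range (T.valence x),
    (HasPlane.plane (partialHolonomy T z x (k + 1)) / HasPlane.plane (partialHolonomy T z x k)).arg

/-- Thurston's equations at every edge: the shape parameters around the edge have product one, and
the total dihedral angle is `2π`. (The orientation of the triangulation is the one in which the
order `0, 1, 2, 3` of the vertices of each tetrahedron is positive.) -/
def ThurstonEquations [HasPlane B] (z : Fin n → B) : Prop :=
  ∀ x : IdealTriangulation.Flag n, Equiv.Perm.sign x.2 = 1 →
    partialHolonomy T z x (T.valence x) = 1 ∧ totalAngle T z x = 2 * Real.pi

/-- The real deformation variety. -/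
def realDeformationVariety : Set (Fin n → ℝ) :=
  {z | (∀ j, z j ≠ 0 ∧ z j ≠ 1) ∧ ThurstonEquations T z}

end Equations

/-! ### Triangulated geometric structures -/

/-- A triangulated `𝕏`-structure: every tetrahedron is realized as an ideal tetrahedron in `𝕏`, every
face gluing is realized by an isometry, and the structure extends over every edge: the composition
of the gluing isometries around the edge is trivial in `PGL⁺(2, B)`, and the total dihedral angle is
`2π`. -/
structure TriangulatedStructure {n : ℕ} (T : IdealTriangulation n) (B : Type) [CommRing B]
    [StarRing B] [Algebra ℝ B] [HasPlane B] where
  /-- the ideal vertices of the tetrahedra -/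
  vertex : Fin n → Fin 4 → Matrix (Fin 2) (Fin 2) B
  /-- the isometry that attaches the neighbour of `j` at the face opposite to `f` to `j` -/
  glue : Fin n → Fin 4 → Matrix (Fin 2) (Fin 2) B
  /-- the shape parameters at the edges `01` -/
  shape : Fin n → B
  ideal : ∀ j, IsIdealTetrahedron (vertex j)
  hasShape : ∀ j, HasShape (vertex j) (shape j)
  isometry : ∀ j f, IsIsometry (glue j f)
  glue_vertex : ∀ j f v, v ≠ f →
    SamePoint (act (glue j f) (vertex (T.nbr j f) (T.perm j f v))) (vertex j v)
  edge_holonomy : ∀ x : IdealTriangulation.Flag n, Equiv.Perm.sign x.2 = 1 →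
    ∃ c : B, ((List.range (T.valence x)).map fun k =>
      glue (T.turn^[k] x).1 ((T.turn^[k] x).2 2)).prod = c • (1 : Matrix (Fin 2) (Fin 2) B)
  edge_angle : ∀ x : IdealTriangulation.Flag n, Equiv.Perm.sign x.2 = 1 →
    totalAngle T shape x = 2 * Real.pi

namespace TriangulatedStructure

variable {n : ℕ} {T : IdealTriangulation n} {B : Type} [CommRing B] [StarRing B] [Algebra ℝ B]
  [HasPlane B]

/-- The holonomy along the path that starts in the tetrahedron `j` and crosses the given faces. -/
def holonomy (S : TriangulatedStructure T B) : Fin n → List (Fin 4) → Matrix (Fin 2) (Fin 2) B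
  | _, [] => 1
  | j, f :: l => S.glue j f * S.holonomy (T.nbr j f) l

/-- The developing map: the ideal vertices of the last tetrahedron of a path, developed along the
path into the frame of its first tetrahedron `j`. (The paths are the tetrahedra of the universal
cover of the complement of the edges; they give the same tetrahedron of the universal
cover of the manifold if they differ by turns around edges.) -/
def develop (S : TriangulatedStructure T B) (j : Fin n) (l : List (Fin 4)) (v : Fin 4) :
    Matrix (Fin 2) (Fin 2) B :=
  act (S.holonomy j l) (S.vertex (T.endpoint j l) v)

end TriangulatedStructure

/-- A transversely hyperbolic foliation on `(M, T)`: the tetrahedra are collapsed to the hyperbolic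
plane. -/
abbrev Foliation {n : ℕ} (T : IdealTriangulation n) : Type := TriangulatedStructure T ℝ

/-- A hyperbolic structure on `(M, T)`, made of positively oriented ideal tetrahedra. -/
abbrev HyperbolicStructure {n : ℕ} (T : IdealTriangulation n) : Type :=
  {S : TriangulatedStructure T ℂ // ∀ j, IsPositivelyOriented (S.vertex j)}

/-- An anti de Sitter structure on `(M, T)`, made of positively oriented ideal tetrahedra. -/
abbrev AdSStructure {n : ℕ} (T : IdealTriangulation n) : Type :=
  {S : TriangulatedStructure T PseudoComplex // ∀ j, IsPositivelyOriented (S.vertex j)}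

section Collapse

variable {n : ℕ} {T : IdealTriangulation n} {B : Type} [CommRing B] [StarRing B] [Algebra ℝ B]
  [HasPlane B]

/-- The limit `t → 0` for `t > 0`. -/
def toZero : Filter (Set.Ioi (0 : ℝ)) := comap Subtype.val (𝓝 0)

/-- Entrywise convergence, as `t → 0`, of matrices over `B` to a real matrix. -/
def TendsToReal (X : Set.Ioi (0 : ℝ) → Matrix (Fin 2) (Fin 2) B) (Y : Matrix (Fin 2) (Fin 2) ℝ) :
    Prop :=
  ∀ a b, Tendsto (fun t => HasPlane.plane (X t a b)) toZero (𝓝 (Y a b : ℂ))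

/-- The structures `S t` collapse to the foliation `F` as `t → 0`: along every path of tetrahedra,
the ideal vertices of the developed tetrahedra converge in real projective space to those of the
collapsed tetrahedra of `F`, the holonomy converges in `PGL(2, B)` to that of `F`, and
the shape parameters converge to those of `F`. -/
def CollapsesTo (S : Set.Ioi (0 : ℝ) → TriangulatedStructure T B) (F : Foliation T) : Prop :=
  (∀ j l v, ∃ r : Set.Ioi (0 : ℝ) → ℝ, (∀ t, r t ≠ 0) ∧
    TendsToReal (fun t => r t • (S t).develop j l v) (F.develop j l v)) ∧
  (∀ j l, ∃ c : Set.Ioi (0 : ℝ) → B, (∀ t, IsUnit (c t)) ∧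
    TendsToReal (fun t => c t • (S t).holonomy j l) (F.holonomy j l)) ∧
  ∀ j, Tendsto (fun t => HasPlane.plane ((S t).shape j)) toZero (𝓝 (F.shape j : ℂ))

/-- The structures `S t` form a path: their shape parameters depend continuously on `t`. -/
def IsPath (S : Set.Ioi (0 : ℝ) → TriangulatedStructure T B) : Prop :=
  ∀ j, Continuous fun t => HasPlane.plane ((S t).shape j)

end Collapse

/-! ### Punctured torus bundles and the monodromy triangulation -/

/-- An element of `SL(2, ℤ)` is Anosov if it has two distinct real eigenvalues. -/
def IsAnosov (φ : Matrix.SpecialLinearGroup (Fin 2) ℤ) : Prop :=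
  ∃ a b : ℝ, a ≠ b ∧
    Module.End.HasEigenvalue (Matrix.toLin' (φ.1.map (Int.cast : ℤ → ℝ))) a ∧
    Module.End.HasEigenvalue (Matrix.toLin' (φ.1.map (Int.cast : ℤ → ℝ))) b

/-- The letters `R` and `L`. -/
inductive Letter where
  | R : Letter
  | L : Letter

/-- The transvections `R` and `L`. -/
def Letter.mat : Letter → Matrix (Fin 2) (Fin 2) ℤ
  | .R => !![1, 1; 0, 1]
  | .L => !![1, 0; 1, 1]

/-- The product of the letters of a word. -/
def wordMat (w : List Letter) : Matrix (Fin 2) (Fin 2) ℤ := (w.map Letter.mat).prod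

/-- The vertices of a tetrahedron of the monodromy triangulation, seen from above: the vertices
`0, 1, 2, 3` are these corners of the unit square. The top edge is the diagonal `01`, the
bottom edge is the diagonal `23`, the top faces are those opposite to `2, 3`, and the bottom faces
are those opposite to `0, 1`. -/
def corner : Fin 4 → Fin 2 → ℤ := ![![0, 0], ![1, 1], ![0, 1], ![1, 0]]

/-- The rotation of the unit square by `π`. -/
def halfTurn : Equiv.Perm (Fin 4) := Equiv.swap 0 1 * Equiv.swap 2 3

/-- The top and bottom faces, named by their opposite vertices, that coincide when the unit square
is stacked below its image under a letter. -/
def Letter.mate : Letter → Equiv.Perm (Fin 4)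
  | .R => Equiv.swap 0 3 * Equiv.swap 1 2
  | .L => Equiv.swap 0 2 * Equiv.swap 1 3

/-- Gluing of the top face `f` of a tetrahedron to a bottom face of the next one. -/
def upPerm (a : Letter) (h : Equiv.Perm (Fin 4)) (f : Fin 4) : Equiv.Perm (Fin 4) :=
  h * Equiv.swap f (a.mate f)

/-- Gluing of the bottom face `f` of a tetrahedron to a top face of the previous one. -/
def downPerm (a : Letter) (h : Equiv.Perm (Fin 4)) (f : Fin 4) : Equiv.Perm (Fin 4) :=
  Equiv.swap (h f) (a.mate (h f)) * h

/-- Check of `upPerm`: if the previous tetrahedron is the unit square and the next one is its image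
under the letter `a`, then the identified vertices agree up to a lattice translation. -/
theorem upPerm_corner (a : Letter) (f : Fin 4) (hf : 2 ≤ f) :
    ∃ u : Fin 2 → ℤ, ∀ v, v ≠ f → a.mat *ᵥ corner (upPerm a 1 f v) = corner v + u := by
  have hf' : f = 2 ∨ f = 3 := by revert f; decide
  rcases hf' with rfl | rfl <;> cases a
  · exact ⟨![0, 0], by decide⟩
  · exact ⟨![0, 1], by decide⟩
  · exact ⟨![1, 0], by decide⟩
  · exact ⟨![0, 0], by decide⟩

/-- The same check for the image of the unit square under minus the letter `a`. -/
theorem upPerm_halfTurn_corner (a : Letter) (f : Fin 4) (hf : 2 ≤ f) :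
    ∃ u : Fin 2 → ℤ, ∀ v, v ≠ f → -a.mat *ᵥ corner (upPerm a halfTurn f v) = corner v + u := by
  have hf' : f = 2 ∨ f = 3 := by revert f; decide
  rcases hf' with rfl | rfl <;> cases a
  · exact ⟨![-2, -1], by decide⟩
  · exact ⟨![-1, -1], by decide⟩
  · exact ⟨![-1, -1], by decide⟩
  · exact ⟨![-1, -2], by decide⟩

/-- The half turn enters at the closing layer of the bundle, and only for monodromy `-W`. -/
def layerTurn (w : List Letter) (ε : ℤˣ) (k : Fin w.length) : Equiv.Perm (Fin 4) :=
  if ε = -1 ∧ (k : ℕ) + 1 = w.length then halfTurn else 1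

theorem layerTurn_cases (w : List Letter) (ε : ℤˣ) (k : Fin w.length) :
    layerTurn w ε k = 1 ∨ layerTurn w ε k = halfTurn := by
  unfold layerTurn; split_ifs <;> simp

theorem up_down (a : Letter) (h : Equiv.Perm (Fin 4)) (hh : h = 1 ∨ h = halfTurn) (f : Fin 4) :
    Equiv.Perm.sign (upPerm a h f) = -1 ∧ Equiv.Perm.sign (downPerm a h f) = -1 ∧
    downPerm a h (upPerm a h f f) = (upPerm a h f)⁻¹ ∧
    upPerm a h (downPerm a h f f) = (downPerm a h f)⁻¹ ∧
    (2 ≤ f → ¬ 2 ≤ upPerm a h f f) ∧ (¬ 2 ≤ f → 2 ≤ downPerm a h f f) := by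
  rcases hh with rfl | rfl <;> cases a <;> revert f <;> decide

/-- The monodromy triangulation of the mapping torus of `ε W`, where `W = w₀ w₁ ⋯ w_{N-1}` is a word
in `R` and `L`. With `W_k = w₀ ⋯ w_{k-1}`, the tetrahedron `k` projects to the image of the unit
square under `W_k`; it realizes the diagonal exchange from the triangulation `W_k τ₀` of the
punctured torus, with slopes `W_k (1,0), W_k (0,1), W_k (-1,1)`, to the triangulation `W_{k+1} τ₀`.
Its top faces are glued to the bottom faces of the tetrahedron `k + 1`; the top faces of the last
tetrahedron are glued to the bottom faces of the first one by the monodromy. -/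
def monodromyTriangulation (w : List Letter) (ε : ℤˣ) : IdealTriangulation w.length where
  nbr k f := if 2 ≤ f then finRotate _ k else (finRotate _).symm k
  perm k f :=
    if 2 ≤ f then upPerm w[k] (layerTurn w ε k) f
    else downPerm w[(finRotate _).symm k] (layerTurn w ε ((finRotate _).symm k)) f
  nbr_nbr k f := by
    by_cases hf : 2 ≤ f
    · have := (up_down w[k] _ (layerTurn_cases w ε k) f).2.2.2.2.1 hf
      simp only [if_pos hf, if_neg this, Equiv.symm_apply_apply]
    · have := (up_down w[(finRotate _).symm k] _
        (layerTurn_cases w ε ((finRotate _).symm k)) f).2.2.2.2.2 hf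
      simp only [if_neg hf, if_pos this, Equiv.apply_symm_apply]
  perm_perm k f := by
    by_cases hf : 2 ≤ f
    · have h := up_down w[k] _ (layerTurn_cases w ε k) f
      simp only [if_pos hf, if_neg (h.2.2.2.2.1 hf), Equiv.symm_apply_apply]
      exact h.2.2.1
    · have h := up_down w[(finRotate _).symm k] _
        (layerTurn_cases w ε ((finRotate _).symm k)) f
      simp only [if_neg hf, if_pos (h.2.2.2.2.2 hf)]
      exact h.2.2.2.1
  sign_perm k f := by
    split_ifs with hf
    · exact (up_down w[k] _ (layerTurn_cases w ε k) f).1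
    · exact (up_down w[(finRotate _).symm k] _
        (layerTurn_cases w ε ((finRotate _).symm k)) f).2.1
  not_self k f := by
    intro h
    have h2 := (Prod.ext_iff.1 h).2
    by_cases hf : 2 ≤ f
    · have := (up_down w[k] _ (layerTurn_cases w ε k) f).2.2.2.2.1 hf
      simp only [if_pos hf] at h2
      rw [h2] at this
      exact this hf
    · have := (up_down w[(finRotate _).symm k] _
        (layerTurn_cases w ε ((finRotate _).symm k)) f).2.2.2.2.2 hf
      simp only [if_neg hf] at h2
      rw [h2] at this
      exact hf this

/-- The union `V⁺ ∪ V⁻` of the two canonical components of the real deformation variety of the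
monodromy triangulation: the solutions with all `z_j > 0`, where `z_j` is the shape
parameter at the two edges `01, 23` exchanged by the `j`-th diagonal exchange. -/
def canonicalComponents (w : List Letter) (ε : ℤˣ) : Set (Fin w.length → ℝ) :=
  {z | z ∈ realDeformationVariety (monodromyTriangulation w ε) ∧ ∀ j, 0 < z j}

end Regen

end

noncomputable section

namespace Regen

/-!
A point of the canonical components makes every tetrahedron have exactly one pair of opposite edges
with negative shape parameter, and the angle condition puts exactly two negative corners around
each edge of the triangulation. Since the word of an Anosov element contains both letters, these
two corners belong to one tetrahedron. Hence the Jacobian of the logarithms of the edge equations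
is, in the shape parameters at the diagonals, nonnegative off the diagonal; as the product of the
three shape parameters of a tetrahedron is `-1`, its columns have weighted sum zero, so that it is
an irreducible Markov generator. Its kernel is one-dimensional and spanned by a positive vector
(Perron–Frobenius), and by the implicit function theorem the solutions of the edge equations over
`ℝ` and over `ℂ` near the given point form a smooth curve `Z` whose derivative at `0` is positive.

The values `Z (i s)` are complex solutions with positive imaginary parts for small `s > 0`.
Splitting `ℝ + ℝ τ` into two copies of `ℝ`, the pair `Z s`, `Z (-s)` likewise is a pseudo-complex
solution `Z (τ s)`. The total angle around an edge is a multiple of `2 π` that tends to `2 π`, so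
these solutions give structures, which collapse to the foliation when their tetrahedra and gluing
maps are normalized by the frames of the foliation.
-/

/-! ### Planar algebras -/

/-- The algebras `ℝ`, `ℂ` and `ℝ + ℝ τ` at once: `plane` gives linear coordinates `a + b κ` in which
the square of `κ` is the real number `genSq` and `star` is the conjugation. -/
class PlanarAlgebra (B : Type) [CommRing B] [StarRing B] [Algebra ℝ B] [HasPlane B] where
  /-- the real number `κ²`; for `B = ℝ`, where `κ` is missing, its value is immaterial -/
  genSq : ℝ
  plane_injective : Function.Injective (HasPlane.plane : B → ℂ)
  plane_add : ∀ x y : B, HasPlane.plane (x + y) = HasPlane.plane x + HasPlane.plane y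
  plane_algebraMap : ∀ r : ℝ, HasPlane.plane (algebraMap ℝ B r) = r
  re_mul : ∀ x y : B, (HasPlane.plane (x * y)).re =
    (HasPlane.plane x).re * (HasPlane.plane y).re +
      genSq * ((HasPlane.plane x).im * (HasPlane.plane y).im)
  im_mul : ∀ x y : B, (HasPlane.plane (x * y)).im =
    (HasPlane.plane x).re * (HasPlane.plane y).im + (HasPlane.plane x).im * (HasPlane.plane y).re
  re_star : ∀ x : B, (HasPlane.plane (star x)).re = (HasPlane.plane x).re
  im_star : ∀ x : B, (HasPlane.plane (star x)).im = -(HasPlane.plane x).im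

instance : PlanarAlgebra ℝ where
  genSq := 0
  plane_injective := Complex.ofReal_injective
  plane_add := Complex.ofReal_add
  plane_algebraMap _ := rfl
  re_mul x y := by simp [HasPlane.plane]
  im_mul x y := by simp [HasPlane.plane]
  re_star x := by simp [HasPlane.plane]
  im_star x := by simp [HasPlane.plane]

instance : PlanarAlgebra ℂ where
  genSq := -1
  plane_injective := fun _ _ h => h
  plane_add _ _ := rfl
  plane_algebraMap _ := rfl
  re_mul x y := by simp [HasPlane.plane, sub_eq_add_neg]
  im_mul x y := by simp [HasPlane.plane]
  re_star x := by simp [HasPlane.plane]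
  im_star x := by simp [HasPlane.plane]

instance : PlanarAlgebra PseudoComplex where
  genSq := 1
  plane_injective x y h := by
    simp only [HasPlane.plane, Complex.mk.injEq] at h
    exact QuadraticAlgebra.ext h.1 h.2
  plane_add x y := by apply Complex.ext <;> simp [HasPlane.plane]
  plane_algebraMap r := by apply Complex.ext <;> simp [HasPlane.plane]
  re_mul x y := by simp [HasPlane.plane]
  im_mul x y := by simp [HasPlane.plane]
  re_star x := by simp [HasPlane.plane]
  im_star x := by simp [HasPlane.plane]

section Coordinates

variable {B : Type} [HasPlane B] {ι : Type*} {l : Filter ι}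

/-- The coordinate `a` of `a + b κ`. -/
def rePart (x : B) : ℝ := (HasPlane.plane x).re

/-- The coordinate `b` of `a + b κ`. -/
def imPart (x : B) : ℝ := (HasPlane.plane x).im

/-- The curve `x` in `B` converges to the real number `a` along the filter `l`. -/
def ConvergesTo (l : Filter ι) (x : ι → B) (a : ℝ) : Prop :=
  Tendsto (fun t => HasPlane.plane (x t)) l (𝓝 (a : ℂ))

theorem convergesTo_iff {x : ι → B} {a : ℝ} :
    ConvergesTo l x a ↔
      Tendsto (fun t => rePart (x t)) l (𝓝 a) ∧ Tendsto (fun t => imPart (x t)) l (𝓝 0) := by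
  rw [ConvergesTo, Complex.equivRealProdCLM.toHomeomorph.isInducing.tendsto_nhds_iff]
  exact Prod.tendsto_iff _ _

end Coordinates

section Planar

variable {B : Type} [CommRing B] [StarRing B] [Algebra ℝ B] [HasPlane B] [PlanarAlgebra B]

/-- The square-norm `x * star x` as a real number. -/
def sqNorm (x : B) : ℝ := rePart x ^ 2 - PlanarAlgebra.genSq B * imPart x ^ 2

theorem planarAlgebra_ext {x y : B} (h₁ : rePart x = rePart y) (h₂ : imPart x = imPart y) : x = y :=
  PlanarAlgebra.plane_injective (Complex.ext h₁ h₂)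

@[simp] theorem rePart_add (x y : B) : rePart (x + y) = rePart x + rePart y := by
  simp [rePart, PlanarAlgebra.plane_add]

@[simp] theorem imPart_add (x y : B) : imPart (x + y) = imPart x + imPart y := by
  simp [imPart, PlanarAlgebra.plane_add]

@[simp] theorem rePart_algebraMap (r : ℝ) : rePart (algebraMap ℝ B r) = r := by
  simp [rePart, PlanarAlgebra.plane_algebraMap]

@[simp] theorem imPart_algebraMap (r : ℝ) : imPart (algebraMap ℝ B r) = 0 := by
  simp [imPart, PlanarAlgebra.plane_algebraMap]

@[simp] theorem rePart_mul (x y : B) :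
    rePart (x * y) = rePart x * rePart y + PlanarAlgebra.genSq B * (imPart x * imPart y) :=
  PlanarAlgebra.re_mul x y

@[simp] theorem imPart_mul (x y : B) :
    imPart (x * y) = rePart x * imPart y + imPart x * rePart y :=
  PlanarAlgebra.im_mul x y

@[simp] theorem rePart_star (x : B) : rePart (star x) = rePart x := PlanarAlgebra.re_star x

@[simp] theorem imPart_star (x : B) : imPart (star x) = -imPart x := PlanarAlgebra.im_star x

@[simp] theorem rePart_one : rePart (1 : B) = 1 := by
  simpa using rePart_algebraMap (B := B) 1

@[simp] theorem imPart_one : imPart (1 : B) = 0 := by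
  simpa using imPart_algebraMap (B := B) 1

@[simp] theorem rePart_zero : rePart (0 : B) = 0 := by
  simpa using rePart_algebraMap (B := B) 0

@[simp] theorem imPart_zero : imPart (0 : B) = 0 := by
  simpa using imPart_algebraMap (B := B) 0

@[simp] theorem rePart_neg (x : B) : rePart (-x) = -rePart x := by
  rw [eq_neg_iff_add_eq_zero, ← rePart_add, neg_add_cancel, rePart_zero]

@[simp] theorem imPart_neg (x : B) : imPart (-x) = -imPart x := by
  rw [eq_neg_iff_add_eq_zero, ← imPart_add, neg_add_cancel, imPart_zero]

@[simp] theorem imPart_sub (x y : B) : imPart (x - y) = imPart x - imPart y := by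
  simp [sub_eq_add_neg]

@[simp] theorem rePart_smul (r : ℝ) (x : B) : rePart (r • x) = r * rePart x := by
  simp [Algebra.smul_def]

@[simp] theorem imPart_smul (r : ℝ) (x : B) : imPart (r • x) = r * imPart x := by
  simp [Algebra.smul_def]

@[simp] theorem star_algebraMap (r : ℝ) : star (algebraMap ℝ B r) = algebraMap ℝ B r :=
  planarAlgebra_ext (by simp) (by simp)

theorem star_real_smul (r : ℝ) (x : B) : star (r • x) = r • star x := by
  simp [Algebra.smul_def]

theorem mul_star_self (x : B) : x * star x = algebraMap ℝ B (sqNorm x) :=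
  planarAlgebra_ext (by rw [rePart_mul, rePart_star, imPart_star, rePart_algebraMap, sqNorm]; ring)
    (by rw [imPart_mul, rePart_star, imPart_star, imPart_algebraMap]; ring)

theorem sqNorm_mul (x y : B) : sqNorm (x * y) = sqNorm x * sqNorm y := by
  simp only [sqNorm, rePart_mul, imPart_mul]
  ring

@[simp] theorem sqNorm_neg (x : B) : sqNorm (-x) = sqNorm x := by
  simp [sqNorm]

@[simp] theorem sqNorm_algebraMap (r : ℝ) : sqNorm (algebraMap ℝ B r) = r ^ 2 := by
  simp [sqNorm]

@[simp] theorem sqNorm_one : sqNorm (1 : B) = 1 := by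
  simp [sqNorm]

theorem isPosReal_mul_star {x : B} (h : 0 < sqNorm x) : IsPosReal (x * star x) :=
  ⟨_, h, mul_star_self x⟩

theorem isUnit_of_sqNorm_pos {x : B} (h : 0 < sqNorm x) : IsUnit x := by
  refine IsUnit.of_mul_eq_one (algebraMap ℝ B (sqNorm x)⁻¹ * star x) ?_
  rw [mul_left_comm, mul_star_self, ← map_mul, inv_mul_cancel₀ h.ne', map_one]

theorem ringInverse_eq {x : B} (h : 0 < sqNorm x) :
    Ring.inverse x = algebraMap ℝ B (sqNorm x)⁻¹ * star x := by
  refine (isUnit_of_sqNorm_pos h).mul_left_cancel ?_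
  rw [Ring.mul_inverse_cancel _ (isUnit_of_sqNorm_pos h), mul_left_comm, mul_star_self, ← map_mul,
    inv_mul_cancel₀ h.ne', map_one]

variable {ι : Type*} {l : Filter ι}

theorem ConvergesTo.add {x y : ι → B} {a b : ℝ} (hx : ConvergesTo l x a) (hy : ConvergesTo l y b) :
    ConvergesTo l (fun t => x t + y t) (a + b) := by
  rw [convergesTo_iff] at *
  exact ⟨by simpa using hx.1.add hy.1, by simpa using hx.2.add hy.2⟩

theorem ConvergesTo.mul {x y : ι → B} {a b : ℝ} (hx : ConvergesTo l x a) (hy : ConvergesTo l y b) :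
    ConvergesTo l (fun t => x t * y t) (a * b) := by
  rw [convergesTo_iff] at *
  exact ⟨by simpa using (hx.1.mul hy.1).add ((hx.2.mul hy.2).const_mul (PlanarAlgebra.genSq B)),
    by simpa using (hx.1.mul hy.2).add (hx.2.mul hy.1)⟩

theorem ConvergesTo.star {x : ι → B} {a : ℝ} (hx : ConvergesTo l x a) :
    ConvergesTo l (fun t => star (x t)) a := by
  rw [convergesTo_iff] at *
  exact ⟨by simpa using hx.1, by simpa using hx.2.neg⟩

theorem ConvergesTo.const (a : ℝ) : ConvergesTo l (fun _ => algebraMap ℝ B a) a := by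
  rw [convergesTo_iff]
  simp [tendsto_const_nhds]

theorem ConvergesTo.one : ConvergesTo l (fun _ => (1 : B)) 1 := by
  simpa using ConvergesTo.const (l := l) (B := B) 1

theorem ConvergesTo.zero : ConvergesTo l (fun _ => (0 : B)) 0 := by
  simpa using ConvergesTo.const (l := l) (B := B) 0

theorem ConvergesTo.neg {x : ι → B} {a : ℝ} (hx : ConvergesTo l x a) :
    ConvergesTo l (fun t => -x t) (-a) := by
  rw [convergesTo_iff] at *
  exact ⟨by simpa using hx.1.neg, by simpa using hx.2.neg⟩

theorem ConvergesTo.sub {x y : ι → B} {a b : ℝ} (hx : ConvergesTo l x a) (hy : ConvergesTo l y b) :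
    ConvergesTo l (fun t => x t - y t) (a - b) := by
  simpa [sub_eq_add_neg] using hx.add hy.neg

theorem ConvergesTo.smul {x : ι → B} {a : ℝ} (r : ℝ) (hx : ConvergesTo l x a) :
    ConvergesTo l (fun t => r • x t) (r * a) := by
  simpa only [Algebra.smul_def] using (ConvergesTo.const r).mul hx

theorem ConvergesTo.sqNorm {x : ι → B} {a : ℝ} (hx : ConvergesTo l x a) :
    Tendsto (fun t => sqNorm (x t)) l (𝓝 (a ^ 2)) := by
  rw [convergesTo_iff] at hx
  simpa [Regen.sqNorm] using (hx.1.pow 2).sub ((hx.2.pow 2).const_mul (PlanarAlgebra.genSq B))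

theorem ConvergesTo.eventually_sqNorm_pos {x : ι → B} {a : ℝ} (hx : ConvergesTo l x a)
    (ha : a ≠ 0) : ∀ᶠ t in l, 0 < Regen.sqNorm (x t) :=
  hx.sqNorm.eventually (lt_mem_nhds (by positivity))

theorem ConvergesTo.ringInverse {x : ι → B} {a : ℝ} (hx : ConvergesTo l x a) (ha : a ≠ 0) :
    ConvergesTo l (fun t => Ring.inverse (x t)) a⁻¹ := by
  have h_norm : ConvergesTo l (fun t => (algebraMap ℝ B (Regen.sqNorm (x t))⁻¹)) (a ^ 2)⁻¹ := by
    rw [convergesTo_iff]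
    simpa [tendsto_const_nhds] using hx.sqNorm.inv₀ (by positivity)
  have h_inv : (a ^ 2)⁻¹ * a = a⁻¹ := by field_simp
  refine Tendsto.congr' ?_ (h_inv ▸ h_norm.mul hx.star)
  filter_upwards [hx.eventually_sqNorm_pos ha] with t ht
  rw [ringInverse_eq ht]

theorem ConvergesTo.sum {α : Type*} (s : Finset α) {x : α → ι → B} {a : α → ℝ}
    (h : ∀ i ∈ s, ConvergesTo l (x i) (a i)) :
    ConvergesTo l (fun t => ∑ i ∈ s, x i t) (∑ i ∈ s, a i) := by
  classical
  induction s using Finset.induction_on with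
  | empty => simpa using ConvergesTo.zero
  | insert i s hi ih =>
    simp only [Finset.sum_insert hi]
    exact (h i (by simp)).add (ih fun j hj => h j (by simp [hj]))

theorem ConvergesTo.prod {α : Type*} (s : Finset α) {x : α → ι → B} {a : α → ℝ}
    (h : ∀ i ∈ s, ConvergesTo l (x i) (a i)) :
    ConvergesTo l (fun t => ∏ i ∈ s, x i t) (∏ i ∈ s, a i) := by
  classical
  induction s using Finset.induction_on with
  | empty => simpa using ConvergesTo.one
  | insert i s hi ih =>
    simp only [Finset.prod_insert hi]
    exact (h i (by simp)).mul (ih fun j hj => h j (by simp [hj]))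

/-- Entrywise convergence of matrices over `B` to a real matrix along the filter `l`. -/
def MatrixConvergesTo {m n : Type*} (l : Filter ι) (X : ι → Matrix m n B) (Y : Matrix m n ℝ) :
    Prop :=
  ∀ a b, ConvergesTo l (fun t => X t a b) (Y a b)

theorem MatrixConvergesTo.mul {m n o : Type*} [Fintype n] {X : ι → Matrix m n B}
    {X' : ι → Matrix n o B} {Y : Matrix m n ℝ} {Y' : Matrix n o ℝ} (h : MatrixConvergesTo l X Y)
    (h' : MatrixConvergesTo l X' Y') : MatrixConvergesTo l (fun t => X t * X' t) (Y * Y') := by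
  intro a b
  simp only [Matrix.mul_apply]
  exact ConvergesTo.sum _ fun i _ => (h a i).mul (h' i b)

theorem MatrixConvergesTo.conjTranspose {m n : Type*} {X : ι → Matrix m n B}
    {Y : Matrix m n ℝ} (h : MatrixConvergesTo l X Y) :
    MatrixConvergesTo l (fun t => (X t)ᴴ) Yᴴ := by
  intro a b
  simpa [Matrix.conjTranspose_apply] using (h b a).star

theorem MatrixConvergesTo.smul {m n : Type*} (r : ℝ) {X : ι → Matrix m n B}
    {Y : Matrix m n ℝ} (h : MatrixConvergesTo l X Y) :
    MatrixConvergesTo l (fun t => r • X t) (r • Y) := by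
  intro a b
  simpa using (h a b).smul r

theorem MatrixConvergesTo.const {m n : Type*} (Y : Matrix m n ℝ) :
    MatrixConvergesTo l (fun _ => Y.map (algebraMap ℝ B)) Y := by
  intro a b
  simpa using ConvergesTo.const (Y a b)

theorem MatrixConvergesTo.one {m : Type*} [DecidableEq m] :
    MatrixConvergesTo l (fun _ => (1 : Matrix m m B)) 1 := by
  intro a b
  by_cases h : a = b
  · subst h
    simpa using ConvergesTo.one
  · simpa [Matrix.one_apply_ne h] using ConvergesTo.zero

theorem MatrixConvergesTo.act {X Z : ι → Matrix (Fin 2) (Fin 2) B}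
    {Y W : Matrix (Fin 2) (Fin 2) ℝ} (h : MatrixConvergesTo l X Y) (h' : MatrixConvergesTo l Z W) :
    MatrixConvergesTo l (fun t => act (X t) (Z t)) (act Y W) :=
  (h.mul h').mul h.conjTranspose

end Planar
/-! ### Frames of the projective line -/

section Frames

/-- Equality up to a unit factor: equality of points of the projective line over `B` when `x`, `y`
are vectors, equality in `PGL(2, B)` when they are matrices. -/
def ProjEq (B : Type) [CommRing B] {M : Type*} [AddCommGroup M] [Module B M] (x y : M) : Prop :=
  ∃ k : Bˣ, x = (k : B) • y

variable {B : Type} [CommRing B]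

theorem ProjEq.of_isUnit {M : Type*} [AddCommGroup M] [Module B M] {x y : M} {k : B}
    (hk : IsUnit k) (h : x = k • y) : ProjEq B x y :=
  ⟨hk.unit, h⟩

theorem ProjEq.symm {M : Type*} [AddCommGroup M] [Module B M] {x y : M} (h : ProjEq B x y) :
    ProjEq B y x := by
  obtain ⟨k, rfl⟩ := h
  exact ⟨k⁻¹, by rw [smul_smul, Units.inv_mul, one_smul]⟩

theorem ProjEq.trans {M : Type*} [AddCommGroup M] [Module B M] {x y z : M} (hxy : ProjEq B x y)
    (hyz : ProjEq B y z) : ProjEq B x z := by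
  obtain ⟨k, rfl⟩ := hxy
  obtain ⟨l, rfl⟩ := hyz
  exact ⟨k * l, by rw [smul_smul, Units.val_mul]⟩

theorem ProjEq.mulVec (A : Matrix (Fin 2) (Fin 2) B) {x y : Fin 2 → B} (h : ProjEq B x y) :
    ProjEq B (A *ᵥ x) (A *ᵥ y) := by
  obtain ⟨k, rfl⟩ := h
  exact ⟨k, Matrix.mulVec_smul _ _ _⟩

theorem ProjEq.matrix_mul {A A' C C' : Matrix (Fin 2) (Fin 2) B} (hA : ProjEq B A A')
    (hC : ProjEq B C C') : ProjEq B (A * C) (A' * C') := by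
  obtain ⟨k, rfl⟩ := hA
  obtain ⟨l, rfl⟩ := hC
  exact ⟨k * l, by rw [Matrix.smul_mul, Matrix.mul_smul, smul_smul, Units.val_mul]⟩

theorem ProjEq.refl {M : Type*} [AddCommGroup M] [Module B M] (x : M) : ProjEq B x x :=
  ⟨1, (one_smul B x).symm⟩

/-- The determinant of two vectors of the plane. -/
def bracket (x y : Fin 2 → B) : B := x 0 * y 1 - x 1 * y 0

theorem bracket_self (x : Fin 2 → B) : bracket x x = 0 := by
  simp only [bracket]
  ring

theorem bracket_smul_eq_add (x y w : Fin 2 → B) :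
    bracket x y • w = bracket w y • x + bracket x w • y := by
  ext i
  fin_cases i <;> simp [bracket] <;> ring

theorem eq_zero_of_smul_add_smul_eq_zero {p q : Fin 2 → B} (hpq : IsUnit (bracket p q)) {a b : B}
    (h : a • p + b • q = 0) : a = 0 ∧ b = 0 := by
  have h₀ : a * p 0 + b * q 0 = 0 := congrFun h 0
  have h₁ : a * p 1 + b * q 1 = 0 := congrFun h 1
  constructor <;> refine hpq.mul_left_eq_zero.1 ?_ <;> rw [bracket]
  · linear_combination q 1 * h₀ - q 0 * h₁
  · linear_combination p 0 * h₁ - p 1 * h₀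

theorem matrix_eq_of_mulVec_eq {A A' : Matrix (Fin 2) (Fin 2) B} {p q : Fin 2 → B}
    (hpq : IsUnit (bracket p q)) (hp : A' *ᵥ p = A *ᵥ p) (hq : A' *ᵥ q = A *ᵥ q) : A' = A := by
  refine Matrix.ext_of_mulVec_single fun i => hpq.smul_left_cancel.1 ?_
  simp only [← Matrix.mulVec_smul, bracket_smul_eq_add p q (Pi.single i 1), Matrix.mulVec_add]
  simp only [Matrix.mulVec_smul, hp, hq]

theorem projEq_of_mulVec_three {A A' : Matrix (Fin 2) (Fin 2) B} {p q r : Fin 2 → B}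
    (hpq : IsUnit (bracket p q)) (hpr : IsUnit (bracket p r)) (hrq : IsUnit (bracket r q))
    (hA : IsUnit A.det) (hp : ProjEq B (A' *ᵥ p) (A *ᵥ p)) (hq : ProjEq B (A' *ᵥ q) (A *ᵥ q))
    (hr : ProjEq B (A' *ᵥ r) (A *ᵥ r)) : ProjEq B A' A := by
  obtain ⟨k, hp⟩ := hp
  obtain ⟨l, hq⟩ := hq
  obtain ⟨m, hr⟩ := hr
  have h_relation : (bracket r q * (k - m)) • p + (bracket p r * (l - m)) • q = 0 := by
    have hA_inj := Matrix.mulVec_injective_of_isUnit ((Matrix.isUnit_iff_isUnit_det A).2 hA)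
    refine hA_inj ?_
    have h := congrArg (A' *ᵥ ·) (bracket_smul_eq_add p q r)
    have h' := congrArg (A *ᵥ ·) (bracket_smul_eq_add p q r)
    simp only [Matrix.mulVec_add, Matrix.mulVec_smul, hp, hq, hr, Matrix.mulVec_zero] at h h' ⊢
    linear_combination (norm := module) (m : B) • h' - h
  obtain ⟨hkm, hlm⟩ := eq_zero_of_smul_add_smul_eq_zero hpq h_relation
  have hk : (k : B) = m := sub_eq_zero.1 (hrq.mul_right_eq_zero.1 hkm)
  have hl : (l : B) = m := sub_eq_zero.1 (hpr.mul_right_eq_zero.1 hlm)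
  exact ⟨m, matrix_eq_of_mulVec_eq hpq (by rw [hp, hk, Matrix.smul_mulVec])
    (by rw [hq, hl, Matrix.smul_mulVec])⟩

/-- The matrix that takes the points `a, b, c` of the projective line to `∞, 0, 1`. -/
def frameMatrix (a b c : Fin 2 → B) : Matrix (Fin 2) (Fin 2) B :=
  !![bracket c a * b 1, -(bracket c a * b 0); bracket c b * a 1, -(bracket c b * a 0)]

theorem frameMatrix_mulVec (a b c x : Fin 2 → B) :
    frameMatrix a b c *ᵥ x = ![bracket c a * bracket x b, bracket c b * bracket x a] := by
  ext i
  fin_cases i <;> simp [frameMatrix, bracket, Matrix.mulVec, dotProduct] <;> ring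

theorem det_frameMatrix (a b c : Fin 2 → B) :
    (frameMatrix a b c).det = bracket c a * bracket c b * bracket b a := by
  simp only [frameMatrix, Matrix.det_fin_two_of, bracket]
  ring

end Frames

/-! ### The tetrahedron `∞, 0, 1, z` -/

section StandardTetrahedron

variable {B : Type} [CommRing B]

/-- The vectors `u` for which the ideal points `∞, 0, 1, z` are the Hermitian matrices `u u*`. -/
def idealVector (z : B) : Fin 4 → Fin 2 → B := ![![1, 0], ![0, 1], ![1, 1], ![z, 1]]

theorem bracket_idealVector_mem (S : Submonoid B) (hS : -1 ∈ S) {z : B} (h0 : z ∈ S)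
    (h1 : 1 - z ∈ S) {v w : Fin 4} (h : v ≠ w) :
    bracket (idealVector z v) (idealVector z w) ∈ S := by
  have neg_mem {b : B} (hb : b ∈ S) : -b ∈ S := by simpa using S.mul_mem hS hb
  have h1' : z - 1 ∈ S := by simpa using neg_mem h1
  fin_cases v <;> fin_cases w <;> simp [bracket, idealVector, *] at h ⊢

theorem isUnit_bracket_idealVector {z : B} (h0 : IsUnit z) (h1 : IsUnit (1 - z)) {v w : Fin 4}
    (h : v ≠ w) : IsUnit (bracket (idealVector z v) (idealVector z w)) :=
  bracket_idealVector_mem (IsUnit.submonoid B) isUnit_one.neg h0 h1 h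

theorem projEq_of_mulVec_idealVector {z : B} (h0 : IsUnit z) (h1 : IsUnit (1 - z)) (f : Fin 4)
    {A A' : Matrix (Fin 2) (Fin 2) B} (hA : IsUnit A.det)
    (h : ∀ v, v ≠ f → ProjEq B (A' *ᵥ idealVector z v) (A *ᵥ idealVector z v)) :
    ProjEq B A' A := by
  obtain ⟨p, q, r, hp, hq, hr, hpq, hpr, hrq⟩ : ∃ p q r : Fin 4,
      p ≠ f ∧ q ≠ f ∧ r ≠ f ∧ p ≠ q ∧ p ≠ r ∧ r ≠ q := by
    clear h
    revert f
    decide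
  have isUnit_bracket {v w : Fin 4} (h : v ≠ w) := isUnit_bracket_idealVector h0 h1 h
  exact projEq_of_mulVec_three (isUnit_bracket hpq) (isUnit_bracket hpr) (isUnit_bracket hrq) hA
    (h p hp) (h q hq) (h r hr)

theorem even_perm_cases {π : Equiv.Perm (Fin 4)} (h : Equiv.Perm.sign π = 1) :
    (π 0, π 1, π 2, π 3) ∈ ([(0, 1, 2, 3), (1, 0, 3, 2), (2, 3, 0, 1), (3, 2, 1, 0),
      (0, 2, 3, 1), (1, 3, 2, 0), (2, 0, 1, 3), (3, 1, 0, 2),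
      (0, 3, 1, 2), (1, 2, 0, 3), (2, 1, 3, 0), (3, 0, 2, 1)] :
        List (Fin 4 × Fin 4 × Fin 4 × Fin 4)) := by
  revert π
  decide

/-- The cross ratio of the vertices of the tetrahedron `∞, 0, 1, z`, taken in an even order, is the
shape parameter of its first edge; the denominators are multiplied out. -/
theorem bracket_mul_bracket_eq_edgeShape_mul {z : B} (h0 : IsUnit z) (h1 : IsUnit (1 - z))
    {π : Equiv.Perm (Fin 4)} (hπ : Equiv.Perm.sign π = 1) :
    bracket (idealVector z (π 2)) (idealVector z (π 0)) *
        bracket (idealVector z (π 3)) (idealVector z (π 1)) =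
      edgeShape z (π 0) (π 1) * (bracket (idealVector z (π 2)) (idealVector z (π 1)) *
        bracket (idealVector z (π 3)) (idealVector z (π 0))) := by
  have h := even_perm_cases hπ
  have hz := Ring.inverse_mul_cancel z h0
  have hz' := Ring.inverse_mul_cancel (1 - z) h1
  generalize π 0 = a, π 1 = b, π 2 = c, π 3 = d at *
  simp only [List.mem_cons, Prod.mk.injEq, List.not_mem_nil, or_false] at h
  rcases h with h | h | h | h | h | h | h | h | h | h | h | h <;>
    obtain ⟨rfl, rfl, rfl, rfl⟩ := h <;>
    simp +decide only [edgeShape, bracket, idealVector, if_true, if_false, cons_val_zero,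
      cons_val_one, cons_val] <;>
    grind

end StandardTetrahedron

/-! ### The gluing maps of tetrahedra in standard position -/

section Gluing

variable {B : Type} [CommRing B] {n : ℕ} (T : IdealTriangulation n)

theorem turn_snd_zero (x : IdealTriangulation.Flag n) :
    (T.turn x).2 0 = T.perm x.1 (x.2 2) (x.2 0) := by
  simp [IdealTriangulation.turn, Equiv.swap_apply_def]

theorem turn_snd_one (x : IdealTriangulation.Flag n) :
    (T.turn x).2 1 = T.perm x.1 (x.2 2) (x.2 1) := by
  simp [IdealTriangulation.turn, Equiv.swap_apply_def]

theorem turn_snd_two (x : IdealTriangulation.Flag n) :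
    (T.turn x).2 2 = T.perm x.1 (x.2 2) (x.2 3) := by
  simp [IdealTriangulation.turn]

/-- The matrix that takes the first three vertices of a flag to `∞, 0, 1`. -/
def flagFrame (z : Fin n → B) (x : IdealTriangulation.Flag n) : Matrix (Fin 2) (Fin 2) B :=
  frameMatrix (idealVector (z x.1) (x.2 0)) (idealVector (z x.1) (x.2 1))
    (idealVector (z x.1) (x.2 2))

/-- The diagonal matrix that takes `∞, 0, 1` to the images of the vertices `0, 1, 3` of a flag under
its frame. -/
def flagShift (z : Fin n → B) (x : IdealTriangulation.Flag n) : Matrix (Fin 2) (Fin 2) B :=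
  Matrix.diagonal (flagFrame z x *ᵥ idealVector (z x.1) (x.2 3))

/-- An even ordering of the vertices whose third vertex is `f`. -/
def faceOrder : Fin 4 → Equiv.Perm (Fin 4) :=
  ![Equiv.swap 0 2 * Equiv.swap 1 3, Equiv.swap 0 3 * Equiv.swap 1 2, 1,
    Equiv.swap 0 1 * Equiv.swap 2 3]

theorem faceOrder_two (f : Fin 4) : faceOrder f 2 = f := by
  revert f
  decide

/-- The gluing map at a face for tetrahedra in the positions `∞, 0, 1, z`. -/
def standardGlue (z : Fin n → B) (j : Fin n) (f : Fin 4) : Matrix (Fin 2) (Fin 2) B :=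
  (flagFrame z (j, faceOrder f)).adjugate *
    (flagShift z (j, faceOrder f) * flagFrame z (T.turn (j, faceOrder f)))

theorem bracket_flag_mem (S : Submonoid B) (hS : -1 ∈ S) {z : Fin n → B}
    {x : IdealTriangulation.Flag n} (h0 : z x.1 ∈ S) (h1 : 1 - z x.1 ∈ S) {v w : Fin 4}
    (h : v ≠ w) : bracket (idealVector (z x.1) (x.2 v)) (idealVector (z x.1) (x.2 w)) ∈ S :=
  bracket_idealVector_mem S hS h0 h1 (x.2.injective.ne h)

theorem det_flagFrame_mem (S : Submonoid B) (hS : -1 ∈ S) {z : Fin n → B}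
    {x : IdealTriangulation.Flag n} (h0 : z x.1 ∈ S) (h1 : 1 - z x.1 ∈ S) :
    (flagFrame z x).det ∈ S := by
  have bracket_mem {v w : Fin 4} (h : v ≠ w) := bracket_flag_mem S hS (x := x) h0 h1 h
  rw [flagFrame, det_frameMatrix]
  exact S.mul_mem (S.mul_mem (bracket_mem (by decide)) (bracket_mem (by decide)))
    (bracket_mem (by decide))

theorem det_flagShift_mem (S : Submonoid B) (hS : -1 ∈ S) {z : Fin n → B}
    {x : IdealTriangulation.Flag n} (h0 : z x.1 ∈ S) (h1 : 1 - z x.1 ∈ S) :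
    (flagShift z x).det ∈ S := by
  have bracket_mem {v w : Fin 4} (h : v ≠ w) := bracket_flag_mem S hS (x := x) h0 h1 h
  rw [flagShift, Matrix.det_diagonal, Fin.prod_univ_two, flagFrame, frameMatrix_mulVec]
  exact S.mul_mem (S.mul_mem (bracket_mem (by decide)) (bracket_mem (by decide)))
    (S.mul_mem (bracket_mem (by decide)) (bracket_mem (by decide)))

theorem det_standardGlue_mem (S : Submonoid B) (hS : -1 ∈ S) {z : Fin n → B} (h0 : ∀ j, z j ∈ S)
    (h1 : ∀ j, 1 - z j ∈ S) (j : Fin n) (f : Fin 4) : (standardGlue T z j f).det ∈ S := by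
  rw [standardGlue, Matrix.det_mul, Matrix.det_mul, Matrix.det_adjugate]
  exact S.mul_mem (S.pow_mem (det_flagFrame_mem S hS (h0 _) (h1 _)) _)
    (S.mul_mem (det_flagShift_mem S hS (h0 _) (h1 _)) (det_flagFrame_mem S hS (h0 _) (h1 _)))

variable {T} {z : Fin n → B}

theorem isUnit_det_flagFrame {x : IdealTriangulation.Flag n} (h0 : IsUnit (z x.1))
    (h1 : IsUnit (1 - z x.1)) : IsUnit (flagFrame z x).det :=
  det_flagFrame_mem (IsUnit.submonoid B) isUnit_one.neg h0 h1

theorem flagFrame_mulVec_zero {x : IdealTriangulation.Flag n} (h0 : IsUnit (z x.1))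
    (h1 : IsUnit (1 - z x.1)) :
    ProjEq B (flagFrame z x *ᵥ idealVector (z x.1) (x.2 0)) ![1, 0] := by
  have isUnit_bracket {v w : Fin 4} (h : v ≠ w) :=
    bracket_flag_mem (IsUnit.submonoid B) isUnit_one.neg (x := x) h0 h1 h
  refine .of_isUnit ((isUnit_bracket (v := 2) (w := 0) (by decide)).mul
    (isUnit_bracket (v := 0) (w := 1) (by decide))) ?_
  rw [flagFrame, frameMatrix_mulVec]
  simp [bracket_self]

theorem flagFrame_mulVec_one {x : IdealTriangulation.Flag n} (h0 : IsUnit (z x.1))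
    (h1 : IsUnit (1 - z x.1)) :
    ProjEq B (flagFrame z x *ᵥ idealVector (z x.1) (x.2 1)) ![0, 1] := by
  have isUnit_bracket {v w : Fin 4} (h : v ≠ w) :=
    bracket_flag_mem (IsUnit.submonoid B) isUnit_one.neg (x := x) h0 h1 h
  refine .of_isUnit ((isUnit_bracket (v := 2) (w := 1) (by decide)).mul
    (isUnit_bracket (v := 1) (w := 0) (by decide))) ?_
  rw [flagFrame, frameMatrix_mulVec]
  simp [bracket_self]

theorem flagFrame_mulVec_two {x : IdealTriangulation.Flag n} (h0 : IsUnit (z x.1))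
    (h1 : IsUnit (1 - z x.1)) :
    ProjEq B (flagFrame z x *ᵥ idealVector (z x.1) (x.2 2)) ![1, 1] := by
  have isUnit_bracket {v w : Fin 4} (h : v ≠ w) :=
    bracket_flag_mem (IsUnit.submonoid B) isUnit_one.neg (x := x) h0 h1 h
  refine .of_isUnit ((isUnit_bracket (v := 2) (w := 0) (by decide)).mul
    (isUnit_bracket (v := 2) (w := 1) (by decide))) ?_
  rw [flagFrame, frameMatrix_mulVec]
  simp [mul_comm]

theorem projEq_flagShift {x : IdealTriangulation.Flag n} (h0 : IsUnit (z x.1))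
    (h1 : IsUnit (1 - z x.1)) (hx : Equiv.Perm.sign x.2 = 1) :
    ProjEq B (flagShift z x) (Matrix.diagonal ![edgeShape (z x.1) (x.2 0) (x.2 1), 1]) := by
  have isUnit_bracket {v w : Fin 4} (h : v ≠ w) :=
    bracket_flag_mem (IsUnit.submonoid B) isUnit_one.neg (x := x) h0 h1 h
  refine .of_isUnit ((isUnit_bracket (v := 2) (w := 1) (by decide)).mul
    (isUnit_bracket (v := 3) (w := 0) (by decide))) ?_
  rw [flagShift, flagFrame, frameMatrix_mulVec, bracket_mul_bracket_eq_edgeShape_mul h0 h1 hx,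
    ← Matrix.diagonal_smul]
  simp [mul_comm]

theorem projEq_diagonal_mulVec_zero {u : Fin 2 → B} (hu : IsUnit (u 0)) :
    ProjEq B (Matrix.diagonal u *ᵥ ![1, 0]) ![1, 0] :=
  .of_isUnit hu (by ext i; fin_cases i <;> simp [Matrix.mulVec_diagonal])

theorem projEq_diagonal_mulVec_one {u : Fin 2 → B} (hu : IsUnit (u 1)) :
    ProjEq B (Matrix.diagonal u *ᵥ ![0, 1]) ![0, 1] :=
  .of_isUnit hu (by ext i; fin_cases i <;> simp [Matrix.mulVec_diagonal])

theorem diagonal_mulVec_one_one (u : Fin 2 → B) : Matrix.diagonal u *ᵥ ![1, 1] = u := by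
  ext i
  fin_cases i <;> simp [Matrix.mulVec_diagonal]

theorem flagShift_mul_flagFrame_turn_mulVec (h0 : ∀ j, IsUnit (z j)) (h1 : ∀ j, IsUnit (1 - z j))
    (x : IdealTriangulation.Flag n) {v : Fin 4} (hv : v ≠ x.2 2) :
    ProjEq B ((flagShift z x * flagFrame z (T.turn x)) *ᵥ
        idealVector (z (T.nbr x.1 (x.2 2))) (T.perm x.1 (x.2 2) v))
      (flagFrame z x *ᵥ idealVector (z x.1) v) := by
  have hu : IsUnit (flagShift z x).det :=
    det_flagShift_mem (IsUnit.submonoid B) isUnit_one.neg (h0 _) (h1 _)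
  rw [flagShift, Matrix.det_diagonal, Fin.prod_univ_two] at hu
  obtain ⟨i, rfl⟩ := x.2.surjective v
  have hi : i = 0 ∨ i = 1 ∨ i = 3 := by
    have hi : i ≠ 2 := fun h => hv (by rw [h])
    clear hv
    revert i
    decide
  rw [← Matrix.mulVec_mulVec, flagShift]
  rcases hi with rfl | rfl | rfl
  · rw [← turn_snd_zero]
    exact ((flagFrame_mulVec_zero (x := T.turn x) (h0 _) (h1 _)).mulVec _).trans
      ((projEq_diagonal_mulVec_zero (isUnit_of_mul_isUnit_left hu)).trans
        (flagFrame_mulVec_zero (h0 _) (h1 _)).symm)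
  · rw [← turn_snd_one]
    exact ((flagFrame_mulVec_one (x := T.turn x) (h0 _) (h1 _)).mulVec _).trans
      ((projEq_diagonal_mulVec_one (isUnit_of_mul_isUnit_right hu)).trans
        (flagFrame_mulVec_one (h0 _) (h1 _)).symm)
  · rw [← turn_snd_two]
    have h := (flagFrame_mulVec_two (x := T.turn x) (h0 _) (h1 _)).mulVec
      (Matrix.diagonal (flagFrame z x *ᵥ idealVector (z x.1) (x.2 3)))
    rwa [diagonal_mulVec_one_one] at h

theorem standardGlue_mulVec (h0 : ∀ j, IsUnit (z j)) (h1 : ∀ j, IsUnit (1 - z j)) (j : Fin n)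
    {f v : Fin 4} (hv : v ≠ f) :
    ProjEq B (standardGlue T z j f *ᵥ idealVector (z (T.nbr j f)) (T.perm j f v))
      (idealVector (z j) v) := by
  have h := flagShift_mul_flagFrame_turn_mulVec (T := T) h0 h1 (j, faceOrder f) (v := v)
    (by rwa [faceOrder_two])
  simp only [faceOrder_two] at h
  rw [standardGlue, ← Matrix.mulVec_mulVec]
  refine (h.mulVec _).trans (.of_isUnit (isUnit_det_flagFrame (x := (j, faceOrder f)) (h0 _) (h1 _))
    ?_)
  rw [Matrix.mulVec_mulVec, Matrix.adjugate_mul, Matrix.smul_mulVec, Matrix.one_mulVec]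

theorem flagFrame_mul_standardGlue (h0 : ∀ j, IsUnit (z j)) (h1 : ∀ j, IsUnit (1 - z j))
    (x : IdealTriangulation.Flag n) (hx : Equiv.Perm.sign x.2 = 1) :
    ProjEq B (flagFrame z x * standardGlue T z x.1 (x.2 2))
      (Matrix.diagonal ![edgeShape (z x.1) (x.2 0) (x.2 1), 1] * flagFrame z (T.turn x)) := by
  have h_det : IsUnit (flagShift z x * flagFrame z (T.turn x)).det := by
    rw [Matrix.det_mul]
    exact .mul (det_flagShift_mem (IsUnit.submonoid B) isUnit_one.neg (h0 _) (h1 _))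
      (isUnit_det_flagFrame (h0 _) (h1 _))
  refine .trans ?_ ((projEq_flagShift (h0 _) (h1 _) hx).matrix_mul (.refl _))
  refine projEq_of_mulVec_idealVector (h0 (T.turn x).1) (h1 _) (T.perm x.1 (x.2 2) (x.2 2)) h_det
    fun v hv => ?_
  obtain ⟨v, rfl⟩ := (T.perm x.1 (x.2 2)).surjective v
  have hv' : v ≠ x.2 2 := fun h => hv (by rw [h])
  rw [← Matrix.mulVec_mulVec]
  exact ((standardGlue_mulVec h0 h1 x.1 hv').mulVec _).trans
    (flagShift_mul_flagFrame_turn_mulVec h0 h1 x hv').symm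

end Gluing

/-! ### Structures from solutions of Thurston's equations -/

section Action

variable {B : Type} [CommRing B] [StarRing B]

/-- The ideal point `u u*`. -/
def rankOne (u : Fin 2 → B) : Matrix (Fin 2) (Fin 2) B := Matrix.vecMulVec u (star u)

theorem standardPosition_eq (z : B) (v : Fin 4) :
    standardPosition z v = rankOne (idealVector z v) := by
  ext i j
  fin_cases v <;> fin_cases i <;> fin_cases j <;>
    simp [standardPosition, rankOne, idealVector, Matrix.vecMulVec_apply]

theorem conjTranspose_rankOne (u : Fin 2 → B) : (rankOne u)ᴴ = rankOne u := by
  ext i j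
  simp [rankOne, Matrix.vecMulVec_apply, mul_comm]

theorem det_rankOne (u : Fin 2 → B) : (rankOne u).det = 0 := by
  simp only [rankOne, Matrix.det_fin_two, Matrix.vecMulVec_apply]
  ring

theorem rankOne_smul (k : B) (u : Fin 2 → B) : rankOne (k • u) = (k * star k) • rankOne u := by
  ext i j
  simp only [rankOne, Matrix.vecMulVec_apply, Matrix.smul_apply, Pi.smul_apply, Pi.star_apply,
    smul_eq_mul, star_mul]
  ring

theorem act_rankOne (A : Matrix (Fin 2) (Fin 2) B) (u : Fin 2 → B) :
    act A (rankOne u) = rankOne (A *ᵥ u) := by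
  rw [act, rankOne, rankOne, Matrix.mul_vecMulVec, Matrix.vecMulVec_mul, Matrix.star_mulVec]

theorem act_act (A A' X : Matrix (Fin 2) (Fin 2) B) : act A (act A' X) = act (A * A') X := by
  simp only [act, Matrix.conjTranspose_mul, Matrix.mul_assoc]

theorem act_one (X : Matrix (Fin 2) (Fin 2) B) : act 1 X = X := by
  simp [act]

theorem act_zero (A : Matrix (Fin 2) (Fin 2) B) : act A 0 = 0 := by
  simp [act]

theorem act_sum {α : Type*} (s : Finset α) (A : Matrix (Fin 2) (Fin 2) B)
    (X : α → Matrix (Fin 2) (Fin 2) B) : act A (∑ i ∈ s, X i) = ∑ i ∈ s, act A (X i) := by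
  simp [act, Matrix.mul_sum, Matrix.sum_mul]

theorem det_act (A X : Matrix (Fin 2) (Fin 2) B) :
    (act A X).det = A.det * star A.det * X.det := by
  rw [act, Matrix.det_mul, Matrix.det_mul, Matrix.det_conjTranspose]
  ring

theorem conjTranspose_act (A X : Matrix (Fin 2) (Fin 2) B) : (act A X)ᴴ = act A Xᴴ := by
  simp only [act, Matrix.conjTranspose_mul, Matrix.conjTranspose_conjTranspose, Matrix.mul_assoc]

theorem act_smul_left (c : B) (A X : Matrix (Fin 2) (Fin 2) B) :
    act (c • A) X = (c * star c) • act A X := by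
  simp only [act, Matrix.conjTranspose_smul, Matrix.smul_mul, Matrix.mul_smul, smul_smul, mul_comm]

theorem isIdealPoint_standardPosition [Nontrivial B] (z : B) (v : Fin 4) :
    IsIdealPoint (standardPosition z v) := by
  refine ⟨by rw [standardPosition_eq, conjTranspose_rankOne], fun h => ?_,
    by rw [standardPosition_eq, det_rankOne]⟩
  have h₀ := congrFun (congrFun h 0) 0
  have h₁ := congrFun (congrFun h 1) 1
  fin_cases v <;> simp [standardPosition] at h₀ h₁

theorem isIdealPoint_act {A A' X : Matrix (Fin 2) (Fin 2) B} (hA : A' * A = 1)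
    (hX : IsIdealPoint X) : IsIdealPoint (act A X) := by
  refine ⟨by rw [conjTranspose_act, hX.1], fun h => hX.2.1 ?_, by rw [det_act, hX.2.2, mul_zero]⟩
  rw [← act_one X, ← hA, ← act_act, h, act_zero]

end Action

section RealMatrices

variable {B : Type} [CommRing B] [Algebra ℝ B]

/-- A real matrix as a matrix over `B`. -/
def realMatrix (Q : Matrix (Fin 2) (Fin 2) ℝ) : Matrix (Fin 2) (Fin 2) B :=
  Q.map (algebraMap ℝ B)

theorem realMatrix_inv_mul {Q : Matrix (Fin 2) (Fin 2) ℝ} (h : Q.det ≠ 0) :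
    (realMatrix Q⁻¹ * realMatrix Q : Matrix (Fin 2) (Fin 2) B) = 1 := by
  rw [realMatrix, realMatrix, ← Matrix.map_mul, Matrix.nonsing_inv_mul _ h.isUnit,
    Matrix.map_one _ (map_zero _) (map_one _)]

theorem det_realMatrix (Q : Matrix (Fin 2) (Fin 2) ℝ) :
    (realMatrix Q : Matrix (Fin 2) (Fin 2) B).det = algebraMap ℝ B Q.det := by
  simp [realMatrix, Matrix.det_fin_two]

theorem act_real_smul [StarRing B] (A : Matrix (Fin 2) (Fin 2) B) (r : ℝ)
    (X : Matrix (Fin 2) (Fin 2) B) : act A (r • X) = r • act A X := by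
  simp [act]

theorem ProjEq.real_smul {r : ℝ} (hr : r ≠ 0) (A : Matrix (Fin 2) (Fin 2) B) :
    ProjEq B (r • A) A :=
  .of_isUnit (hr.isUnit.map (algebraMap ℝ B)) (algebraMap_smul B r A).symm

end RealMatrices

section IdealTetrahedra

variable {B : Type} [CommRing B] [StarRing B] [Algebra ℝ B] [HasPlane B] [PlanarAlgebra B]

theorem sqNorm_smul (r : ℝ) (x : B) : sqNorm (r • x) = r ^ 2 * sqNorm x := by
  rw [Algebra.smul_def, sqNorm_mul, sqNorm_algebraMap]

variable (B) in
/-- The elements of positive square-norm. -/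
def positiveNorm : Submonoid B where
  carrier := {x | 0 < sqNorm x}
  mul_mem' {x y} hx hy := by
    rw [Set.mem_ofPred_eq] at *
    rw [sqNorm_mul]
    positivity
  one_mem' := by simp

theorem sqNorm_ne_zero_of_isUnit {x : B} (h : IsUnit x) : sqNorm x ≠ 0 := by
  obtain ⟨u, rfl⟩ := h
  have h_inv : sqNorm (u : B) * sqNorm (↑u⁻¹ : B) = 1 := by rw [← sqNorm_mul, u.mul_inv, sqNorm_one]
  exact left_ne_zero_of_mul_eq_one h_inv

theorem conjTranspose_real_smul (r : ℝ) (X : Matrix (Fin 2) (Fin 2) B) : (r • X)ᴴ = r • Xᴴ := by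
  ext i j
  simp [star_real_smul]

theorem isIdealPoint_real_smul {r : ℝ} (hr : r ≠ 0) {X : Matrix (Fin 2) (Fin 2) B}
    (hX : IsIdealPoint X) : IsIdealPoint (r • X) :=
  ⟨by rw [conjTranspose_real_smul, hX.1], by simpa [hr] using hX.2.1,
    by rw [Matrix.det_smul_of_tower, hX.2.2, smul_zero]⟩

theorem det_sum_standardPosition (z : B) (t : Fin 4 → ℝ) :
    (∑ v, t v • standardPosition z v).det = algebraMap ℝ B
      (t 0 * t 1 + t 0 * t 2 + t 0 * t 3 + t 1 * t 2 + t 1 * t 3 * sqNorm z +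
        t 2 * t 3 * sqNorm (1 - z)) := by
  have h_sum : ∑ v, t v • standardPosition z v =
      !![t 0 • 1 + t 2 • 1 + t 3 • (z * star z), t 2 • 1 + t 3 • z;
        t 2 • 1 + t 3 • star z, t 1 • 1 + t 2 • 1 + t 3 • 1] := by
    ext i j
    fin_cases i <;> fin_cases j <;> simp [Fin.sum_univ_four, standardPosition]
  rw [h_sum, Matrix.det_fin_two_of]
  simp only [map_add, map_mul, ← mul_star_self, Algebra.smul_def, star_sub, star_one]
  ring

theorem exists_ne_pos_of_sum_eq_one {ι : Type*} [Fintype ι] {s : ι → ℝ}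
    (hs : ∀ v, 0 ≤ s v ∧ s v < 1) (h : ∑ v, s v = 1) : ∃ v w, v ≠ w ∧ 0 < s v ∧ 0 < s w := by
  classical
  obtain ⟨v, -, hv⟩ := Finset.exists_lt_of_sum_lt (s := Finset.univ) (f := fun _ : ι => (0 : ℝ))
    (g := s) (by simp [h])
  have h_rest : 0 < ∑ w ∈ Finset.univ.erase v, s w := by
    have := Finset.add_sum_erase Finset.univ s (Finset.mem_univ v)
    linarith [(hs v).2]
  obtain ⟨w, hw, hw'⟩ := Finset.exists_lt_of_sum_lt (s := Finset.univ.erase v)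
    (f := fun _ : ι => (0 : ℝ)) (g := s) (by rwa [Finset.sum_const_zero])
  exact ⟨v, w, (Finset.ne_of_mem_erase hw).symm, hv, hw'⟩

theorem quadratic_form_pos {t : Fin 4 → ℝ} (ht : ∀ v w, 0 ≤ t v * t w) {v w : Fin 4} (hvw : v ≠ w)
    (h : 0 < t v * t w) {a b : ℝ} (ha : 0 < a) (hb : 0 < b) :
    0 < t 0 * t 1 + t 0 * t 2 + t 0 * t 3 + t 1 * t 2 + t 1 * t 3 * a + t 2 * t 3 * b := by
  have h₀₁ := ht 0 1
  have h₀₂ := ht 0 2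
  have h₀₃ := ht 0 3
  have h₁₂ := ht 1 2
  have h₁₃ := mul_nonneg (ht 1 3) ha.le
  have h₂₃ := mul_nonneg (ht 2 3) hb.le
  have h_a := mul_pos h ha
  have h_b := mul_pos h hb
  fin_cases v <;> fin_cases w <;> first
    | exact absurd rfl hvw
    | simp only [Fin.zero_eta, Fin.mk_one, Fin.reduceFinMk] at h h_a h_b; linarith

theorem inModel_act {A X : Matrix (Fin 2) (Fin 2) B} (hA : 0 < sqNorm A.det) (hX : InModel X) :
    InModel (act A X) := by
  obtain ⟨r, hr, h_det⟩ := hX.2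
  refine ⟨by rw [conjTranspose_act, hX.1], sqNorm A.det * r, by positivity, ?_⟩
  rw [det_act, h_det, mul_star_self, map_mul]

theorem inModel_sum_standardPosition {z : B} (h0 : 0 < sqNorm z) (h1 : 0 < sqNorm (1 - z))
    {t : Fin 4 → ℝ} (ht : ∀ v w, 0 ≤ t v * t w) {v w : Fin 4} (hvw : v ≠ w) (h : 0 < t v * t w) :
    InModel (∑ v, t v • standardPosition z v) := by
  refine ⟨?_, _, quadratic_form_pos ht hvw h h0 h1, det_sum_standardPosition z t⟩
  simp only [Matrix.conjTranspose_sum, conjTranspose_real_smul, standardPosition_eq,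
    conjTranspose_rankOne]

theorem sqNorm_det_realMatrix_pos {Q : Matrix (Fin 2) (Fin 2) ℝ} (hQ : Q.det ≠ 0) :
    0 < sqNorm (realMatrix Q : Matrix (Fin 2) (Fin 2) B).det := by
  rw [det_realMatrix, sqNorm_algebraMap]
  positivity

theorem isIdealTetrahedron_act_standardPosition {z : B} (h0 : 0 < sqNorm z)
    (h1 : 0 < sqNorm (1 - z)) {r : Fin 4 → ℝ} (hr : ∀ v w, 0 < r v * r w)
    {Q : Matrix (Fin 2) (Fin 2) ℝ} (hQ : Q.det ≠ 0) :
    IsIdealTetrahedron fun v => r v • act (realMatrix Q) (standardPosition z v) := by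
  have : Nontrivial B := ⟨0, 1, fun h => by simpa using congrArg rePart h⟩
  refine ⟨fun v => isIdealPoint_real_smul (fun h => by simpa [h] using hr v v)
    (isIdealPoint_act (realMatrix_inv_mul hQ) (isIdealPoint_standardPosition z v)),
    fun s hs h => ?_⟩
  have h_sum : ∑ v, s v • r v • act (realMatrix Q) (standardPosition z v) =
      act (realMatrix Q) (∑ v, (s v * r v) • standardPosition z v) := by
    simp only [act_sum, act_real_smul, smul_smul]
  obtain ⟨v, w, hvw, hv, hw⟩ := exists_ne_pos_of_sum_eq_one hs h
  rw [h_sum]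
  refine inModel_act (sqNorm_det_realMatrix_pos hQ)
    (inModel_sum_standardPosition h0 h1 (fun v w => ?_) hvw ?_)
  · rw [mul_mul_mul_comm]
    exact mul_nonneg (mul_nonneg (hs v).1 (hs w).1) (hr v w).le
  · rw [mul_mul_mul_comm]
    exact mul_pos (mul_pos hv hw) (hr v w)

end IdealTetrahedra

section Turning

variable {n : ℕ} {T : IdealTriangulation n}

theorem sign_turn (x : IdealTriangulation.Flag n) :
    Equiv.Perm.sign (T.turn x).2 = Equiv.Perm.sign x.2 := by
  simp [IdealTriangulation.turn, T.sign_perm, Equiv.Perm.sign_swap (show (2 : Fin 4) ≠ 3 by decide)]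

theorem sign_turn_iterate (x : IdealTriangulation.Flag n) (k : ℕ) :
    Equiv.Perm.sign (T.turn^[k] x).2 = Equiv.Perm.sign x.2 := by
  induction k with
  | zero => rfl
  | succ k ih => rw [Function.iterate_succ_apply', sign_turn, ih]

theorem diagonal_one_one {B : Type} [CommRing B] : Matrix.diagonal ![(1 : B), 1] = 1 := by
  ext i j
  fin_cases i <;> fin_cases j <;> simp

theorem diagonal_partialHolonomy_succ {B : Type} [CommRing B] (z : Fin n → B)
    (x : IdealTriangulation.Flag n) (k : ℕ) :
    Matrix.diagonal ![partialHolonomy T z x (k + 1), 1] =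
      Matrix.diagonal ![partialHolonomy T z x k, 1] *
        Matrix.diagonal
          ![edgeShape (z (T.turn^[k] x).1) ((T.turn^[k] x).2 0) ((T.turn^[k] x).2 1), 1] := by
  rw [Matrix.diagonal_mul_diagonal, partialHolonomy, Finset.prod_range_succ, ← partialHolonomy]
  congr 1
  ext i
  fin_cases i <;> simp

end Turning

/-- The choices that turn shape parameters into a triangulated structure: the position and the
representatives of the ideal vertices of each tetrahedron, and the representatives of the gluing
maps. -/
structure Marking (n : ℕ) where
  pos : Fin n → Matrix (Fin 2) (Fin 2) ℝ
  scale : Fin n → Fin 4 → ℝ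
  glueScale : Fin n → Fin 4 → ℝ
  det_pos_ne : ∀ j, (pos j).det ≠ 0
  scale_mul : ∀ j v w, 0 < scale j v * scale j w
  glueScale_ne : ∀ j f, glueScale j f ≠ 0

namespace Marking

variable {B : Type} [CommRing B] [Algebra ℝ B]
variable {n : ℕ} {T : IdealTriangulation n} (m : Marking n)

theorem scale_ne (j : Fin n) (v : Fin 4) : m.scale j v ≠ 0 :=
  fun h => by simpa [h] using m.scale_mul j v v

theorem det_inv_pos_ne (j : Fin n) : (m.pos j)⁻¹.det ≠ 0 := by
  rw [Matrix.det_nonsing_inv, Ring.inverse_eq_inv']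
  exact inv_ne_zero (m.det_pos_ne j)

variable (T) in
/-- The gluing maps of the marked tetrahedra. -/
def glue (z : Fin n → B) (j : Fin n) (f : Fin 4) : Matrix (Fin 2) (Fin 2) B :=
  m.glueScale j f •
    (realMatrix (m.pos j) * standardGlue T z j f * realMatrix (m.pos (T.nbr j f))⁻¹)

/-- The matrix that takes the first three vertices of a flag in a marked tetrahedron to
`∞, 0, 1`. -/
def frame (z : Fin n → B) (x : IdealTriangulation.Flag n) : Matrix (Fin 2) (Fin 2) B :=
  flagFrame z x * realMatrix (m.pos x.1)⁻¹

variable {z : Fin n → B}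

theorem frame_mul_glue (h0 : ∀ j, IsUnit (z j)) (h1 : ∀ j, IsUnit (1 - z j))
    (x : IdealTriangulation.Flag n) (hx : Equiv.Perm.sign x.2 = 1) :
    ProjEq B (m.frame z x * m.glue T z x.1 (x.2 2))
      (Matrix.diagonal ![edgeShape (z x.1) (x.2 0) (x.2 1), 1] * m.frame z (T.turn x)) := by
  have h_cancel : m.frame z x * m.glue T z x.1 (x.2 2) = m.glueScale x.1 (x.2 2) •
      (flagFrame z x * standardGlue T z x.1 (x.2 2) * realMatrix (m.pos (T.turn x).1)⁻¹) := by
    rw [frame, glue, Matrix.mul_smul, Matrix.mul_assoc (realMatrix _), Matrix.mul_assoc,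
      ← Matrix.mul_assoc (realMatrix _) (realMatrix _), realMatrix_inv_mul (m.det_pos_ne _),
      Matrix.one_mul, Matrix.mul_assoc]
    rfl
  rw [h_cancel, frame, ← Matrix.mul_assoc]
  exact (ProjEq.real_smul (m.glueScale_ne _ _) _).trans
    ((flagFrame_mul_standardGlue h0 h1 x hx).matrix_mul (.refl _))

theorem frame_mul_prod_glue (h0 : ∀ j, IsUnit (z j)) (h1 : ∀ j, IsUnit (1 - z j))
    (x : IdealTriangulation.Flag n) (hx : Equiv.Perm.sign x.2 = 1) (k : ℕ) :
    ProjEq B (m.frame z x * ((List.range k).map fun i =>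
        m.glue T z (T.turn^[i] x).1 ((T.turn^[i] x).2 2)).prod)
      (Matrix.diagonal ![partialHolonomy T z x k, 1] * m.frame z (T.turn^[k] x)) := by
  induction k with
  | zero => simpa [partialHolonomy, diagonal_one_one] using ProjEq.refl (m.frame z x)
  | succ k ih =>
    rw [List.range_succ, List.map_append, List.prod_append, List.map_singleton,
      List.prod_singleton, diagonal_partialHolonomy_succ,
      Matrix.mul_assoc (Matrix.diagonal _), ← Matrix.mul_assoc (m.frame z x),
      Function.iterate_succ_apply']
    refine (ih.matrix_mul (.refl _)).trans ?_
    rw [Matrix.mul_assoc]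
    exact (ProjEq.refl _).matrix_mul
      (m.frame_mul_glue h0 h1 _ (by rw [sign_turn_iterate, hx]))

theorem isUnit_frame (h0 : ∀ j, IsUnit (z j)) (h1 : ∀ j, IsUnit (1 - z j))
    (x : IdealTriangulation.Flag n) : IsUnit (m.frame z x) := by
  rw [Matrix.isUnit_iff_isUnit_det, frame, Matrix.det_mul, det_realMatrix]
  exact (isUnit_det_flagFrame (h0 _) (h1 _)).mul ((m.det_inv_pos_ne _).isUnit.map _)

theorem edge_holonomy (h0 : ∀ j, IsUnit (z j)) (h1 : ∀ j, IsUnit (1 - z j))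
    (x : IdealTriangulation.Flag n) (hx : Equiv.Perm.sign x.2 = 1)
    (h : partialHolonomy T z x (T.valence x) = 1) :
    ∃ c : B, ((List.range (T.valence x)).map fun k =>
      m.glue T z (T.turn^[k] x).1 ((T.turn^[k] x).2 2)).prod =
        c • (1 : Matrix (Fin 2) (Fin 2) B) := by
  have h_period : T.turn^[T.valence x] x = x := Function.iterate_minimalPeriod
  obtain ⟨c, hc⟩ := m.frame_mul_prod_glue (T := T) h0 h1 x hx (T.valence x)
  refine ⟨c, (m.isUnit_frame h0 h1 x).mul_left_cancel ?_⟩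
  rw [hc, h, h_period, diagonal_one_one, Matrix.one_mul, Matrix.mul_smul, Matrix.mul_one]

variable [StarRing B]

/-- The vertices of the marked tetrahedra. -/
def vertex (z : Fin n → B) (j : Fin n) (v : Fin 4) : Matrix (Fin 2) (Fin 2) B :=
  m.scale j v • act (realMatrix (m.pos j)) (standardPosition (z j) v)

theorem act_inv_pos_vertex (z : Fin n → B) (j : Fin n) (v : Fin 4) :
    act (realMatrix (m.pos j)⁻¹) (m.vertex z j v) = m.scale j v • standardPosition (z j) v := by
  rw [vertex, act_real_smul, act_act, realMatrix_inv_mul (m.det_pos_ne j), act_one]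

variable [HasPlane B] [PlanarAlgebra B]

theorem glue_vertex (h0 : ∀ j, 0 < sqNorm (z j)) (h1 : ∀ j, 0 < sqNorm (1 - z j)) (j : Fin n)
    (f v : Fin 4) (hv : v ≠ f) :
    SamePoint (act (m.glue T z j f) (m.vertex z (T.nbr j f) (T.perm j f v))) (m.vertex z j v) := by
  obtain ⟨k, hk⟩ := standardGlue_mulVec (T := T) (fun j => isUnit_of_sqNorm_pos (h0 j))
    (fun j => isUnit_of_sqNorm_pos (h1 j)) j hv
  refine ⟨m.glueScale j f ^ 2 * m.scale (T.nbr j f) (T.perm j f v) * sqNorm (k : B) /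
    m.scale j v, ?_, ?_⟩
  · exact div_ne_zero (mul_ne_zero (mul_ne_zero (pow_ne_zero 2 (m.glueScale_ne j f))
      (m.scale_ne _ _)) (sqNorm_ne_zero_of_isUnit k.isUnit)) (m.scale_ne j v)
  · have h_standard : act (standardGlue T z j f) (standardPosition (z (T.nbr j f)) (T.perm j f v)) =
        sqNorm (k : B) • standardPosition (z j) v := by
      rw [standardPosition_eq, act_rankOne, hk, rankOne_smul, mul_star_self, algebraMap_smul,
        standardPosition_eq]
    rw [glue, ← algebraMap_smul B (m.glueScale j f), act_smul_left, mul_star_self,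
      sqNorm_algebraMap, algebraMap_smul, ← act_act, act_inv_pos_vertex, act_real_smul, ← act_act,
      h_standard, act_real_smul, vertex]
    simp only [smul_smul]
    rw [div_mul_cancel₀ _ (m.scale_ne j v), mul_assoc]

theorem isIsometry_glue (h0 : ∀ j, 0 < sqNorm (z j)) (h1 : ∀ j, 0 < sqNorm (1 - z j))
    (j : Fin n) (f : Fin 4) : IsIsometry (m.glue T z j f) := by
  have h_standard : 0 < sqNorm (standardGlue T z j f).det :=
    det_standardGlue_mem T (positiveNorm B) (by simp [positiveNorm]) h0 h1 j f
  have h_pos : 0 < sqNorm (realMatrix (m.pos j) : Matrix (Fin 2) (Fin 2) B).det :=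
    sqNorm_det_realMatrix_pos (m.det_pos_ne j)
  have h_inv_pos :
      0 < sqNorm (realMatrix (m.pos (T.nbr j f))⁻¹ : Matrix (Fin 2) (Fin 2) B).det :=
    sqNorm_det_realMatrix_pos (m.det_inv_pos_ne _)
  have h_scale := m.glueScale_ne j f
  refine isPosReal_mul_star ?_
  rw [glue, Matrix.det_smul_of_tower, sqNorm_smul, Matrix.det_mul, Matrix.det_mul, sqNorm_mul,
    sqNorm_mul]
  positivity

theorem hasShape_vertex (z : Fin n → B) (j : Fin n) : HasShape (m.vertex z j) (z j) :=
  ⟨realMatrix (m.pos j)⁻¹, isPosReal_mul_star (sqNorm_det_realMatrix_pos (m.det_inv_pos_ne j)),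
    fun v => ⟨m.scale j v, m.scale_ne j v, m.act_inv_pos_vertex z j v⟩⟩

/-- The triangulated structure with given marking and shape parameters. -/
def build (h0 : ∀ j, 0 < sqNorm (z j)) (h1 : ∀ j, 0 < sqNorm (1 - z j))
    (hT : ThurstonEquations T z) : TriangulatedStructure T B where
  vertex := m.vertex z
  glue := m.glue T z
  shape := z
  ideal j :=
    isIdealTetrahedron_act_standardPosition (h0 j) (h1 j) (m.scale_mul j) (m.det_pos_ne j)
  hasShape := m.hasShape_vertex z
  isometry := m.isIsometry_glue h0 h1
  glue_vertex := m.glue_vertex h0 h1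
  edge_holonomy x hx := m.edge_holonomy (fun j => isUnit_of_sqNorm_pos (h0 j))
    (fun j => isUnit_of_sqNorm_pos (h1 j)) x hx (hT x hx).1
  edge_angle x hx := (hT x hx).2

/-- The marking with all tetrahedra in the positions `∞, 0, 1, z`. -/
def standard (n : ℕ) : Marking n where
  pos _ := 1
  scale _ _ := 1
  glueScale _ _ := 1
  det_pos_ne _ := by simp
  scale_mul _ _ _ := by simp
  glueScale_ne _ _ := one_ne_zero

end Marking

theorem sqNorm_real (x : ℝ) : sqNorm x = x ^ 2 := sqNorm_algebraMap (B := ℝ) x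

theorem exists_foliation_shape_eq {n : ℕ} {T : IdealTriangulation n} {z : Fin n → ℝ}
    (hz : z ∈ realDeformationVariety T) : ∃ F : Foliation T, F.shape = z := by
  have h0 (j : Fin n) : 0 < sqNorm (z j) := by
    have := (hz.1 j).1
    rw [sqNorm_real]
    positivity
  have h1 (j : Fin n) : 0 < sqNorm (1 - z j) := by
    have := sub_ne_zero.2 (hz.1 j).2.symm
    rw [sqNorm_real]
    positivity
  exact ⟨(Marking.standard n).build h0 h1 hz.2, rfl⟩

/-! ### Orientation -/

section Orientation

/-- The action of a real matrix on Hermitian matrices, as a matrix acting from the right on the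
coordinates `hermCoord`. -/
def coordAction (Q : Matrix (Fin 2) (Fin 2) ℝ) : Matrix (Fin 4) (Fin 4) ℝ :=
  !![(Q 0 0 ^ 2 + Q 1 0 ^ 2 + Q 0 1 ^ 2 + Q 1 1 ^ 2) / 2,
      (Q 0 0 ^ 2 - Q 1 0 ^ 2 + Q 0 1 ^ 2 - Q 1 1 ^ 2) / 2, Q 0 0 * Q 1 0 + Q 0 1 * Q 1 1, 0;
    (Q 0 0 ^ 2 + Q 1 0 ^ 2 - Q 0 1 ^ 2 - Q 1 1 ^ 2) / 2,
      (Q 0 0 ^ 2 - Q 1 0 ^ 2 - Q 0 1 ^ 2 + Q 1 1 ^ 2) / 2, Q 0 0 * Q 1 0 - Q 0 1 * Q 1 1, 0;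
    Q 0 0 * Q 0 1 + Q 1 0 * Q 1 1, Q 0 0 * Q 0 1 - Q 1 0 * Q 1 1,
      Q 0 0 * Q 1 1 + Q 0 1 * Q 1 0, 0;
    0, 0, 0, Q 0 0 * Q 1 1 - Q 0 1 * Q 1 0]

theorem det_eq_mul_det_of_last_column {R : Type*} [CommRing R] {n : ℕ}
    {M : Matrix (Fin (n + 1)) (Fin (n + 1)) R}
    (h : ∀ i : Fin n, M i.castSucc (Fin.last n) = 0) :
    M.det = M (Fin.last n) (Fin.last n) * (M.submatrix Fin.castSucc Fin.castSucc).det := by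
  rw [Matrix.det_succ_column _ (Fin.last n), Fin.sum_univ_castSucc]
  simp [h, ← two_mul, Fin.succAbove_last]

theorem det_coordAction (Q : Matrix (Fin 2) (Fin 2) ℝ) : (coordAction Q).det = Q.det ^ 4 := by
  rw [det_eq_mul_det_of_last_column (fun i => by fin_cases i <;> rfl), Matrix.det_fin_three,
    Matrix.det_fin_two]
  simp only [coordAction, Matrix.submatrix_apply, Matrix.of_apply, Fin.reduceCastSucc,
    Fin.reduceLast, Matrix.cons_val]
  ring

theorem hermCoord_eq {B : Type} [HasPlane B] (X : Matrix (Fin 2) (Fin 2) B) :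
    hermCoord X = ![(rePart (X 0 0) + rePart (X 1 1)) / 2, (rePart (X 0 0) - rePart (X 1 1)) / 2,
      rePart (X 1 0), imPart (X 1 0)] := rfl

variable {B : Type} [CommRing B] [StarRing B] [Algebra ℝ B] [HasPlane B] [PlanarAlgebra B]

theorem act_realMatrix_apply (Q : Matrix (Fin 2) (Fin 2) ℝ) (X : Matrix (Fin 2) (Fin 2) B)
    (i j : Fin 2) : act (realMatrix Q) X i j =
      (Q i 0 * Q j 0) • X 0 0 + (Q i 0 * Q j 1) • X 0 1 + (Q i 1 * Q j 0) • X 1 0 +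
        (Q i 1 * Q j 1) • X 1 1 := by
  simp only [act, realMatrix, Matrix.mul_apply, Fin.sum_univ_two, Matrix.conjTranspose_apply,
    Matrix.map_apply, star_algebraMap, Algebra.smul_def, map_mul]
  ring

theorem imPart_eq_zero_of_star_eq {x : B} (h : star x = x) : imPart x = 0 := by
  have := imPart_star x
  rw [h] at this
  linarith

theorem hermCoord_act (Q : Matrix (Fin 2) (Fin 2) ℝ) (r : ℝ) {X : Matrix (Fin 2) (Fin 2) B}
    (hX : Xᴴ = X) :
    hermCoord (r • act (realMatrix Q) X) = r • (hermCoord X ᵥ* coordAction Q) := by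
  have h_star (i j : Fin 2) : star (X i j) = X j i := congrFun (congrFun hX j) i
  have h₀ : imPart (X 0 0) = 0 := imPart_eq_zero_of_star_eq (h_star 0 0)
  have h₁ : imPart (X 1 1) = 0 := imPart_eq_zero_of_star_eq (h_star 1 1)
  ext i
  fin_cases i <;>
    simp only [hermCoord_eq, Matrix.smul_apply, act_realMatrix_apply, ← h_star 1 0, Matrix.vecMul,
      dotProduct, Fin.sum_univ_four, coordAction, rePart_smul, imPart_smul, rePart_add, imPart_add,
      rePart_star, imPart_star, Pi.smul_apply, smul_eq_mul, h₀, h₁, Matrix.of_apply,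
      Matrix.cons_val, Fin.zero_eta, Fin.mk_one, Fin.reduceFinMk] <;> ring

theorem det_hermCoord_standardPosition (z : B) :
    (Matrix.of fun v => hermCoord (standardPosition z v)).det = imPart z / 2 := by
  have h_rows : (Matrix.of fun v => hermCoord (standardPosition z v)) =
      !![1 / 2, 1 / 2, 0, 0; 1 / 2, -1 / 2, 0, 0; 1, 0, 1, 0;
        (rePart (z * star z) + 1) / 2, (rePart (z * star z) - 1) / 2, rePart z, -imPart z] := by
    ext v i
    fin_cases v <;> fin_cases i <;> simp [hermCoord_eq, standardPosition]
  rw [h_rows, det_eq_mul_det_of_last_column, Matrix.det_fin_three]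
  · simp only [Matrix.submatrix_apply, Matrix.of_apply, Fin.reduceCastSucc, Fin.reduceLast,
      Matrix.cons_val]
    ring
  · intro i
    fin_cases i <;> rfl

theorem Marking.isPositivelyOriented {n : ℕ} (m : Marking n) {z : Fin n → B} (j : Fin n)
    (hz : 0 < imPart (z j)) : IsPositivelyOriented (m.vertex z j) := by
  have h_coord : (Matrix.of fun v => hermCoord (m.vertex z j v)) =
      Matrix.diagonal (m.scale j) * ((Matrix.of fun v => hermCoord (standardPosition (z j) v)) *
        coordAction (m.pos j)) := by
    ext v i
    rw [Matrix.of_apply, Marking.vertex,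
      hermCoord_act _ _ (by rw [standardPosition_eq, conjTranspose_rankOne]), Matrix.diagonal_mul]
    rfl
  have h_scale : 0 < m.scale j 0 * m.scale j 1 * m.scale j 2 * m.scale j 3 := by
    rw [mul_assoc]
    exact mul_pos (m.scale_mul j 0 1) (m.scale_mul j 2 3)
  have h_det := m.det_pos_ne j
  rw [IsPositivelyOriented, h_coord, Matrix.det_mul, Matrix.det_mul, Matrix.det_diagonal,
    det_coordAction, det_hermCoord_standardPosition, Fin.prod_univ_four]
  positivity

end Orientation

section Continuity

variable {B : Type} [CommRing B] [StarRing B] [Algebra ℝ B] [HasPlane B] [PlanarAlgebra B]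
  {ι : Type*} {l : Filter ι} {n : ℕ} {T : IdealTriangulation n} {Z : ι → Fin n → B}
  {z : Fin n → ℝ}

theorem MatrixConvergesTo.adjugate {X : ι → Matrix (Fin 2) (Fin 2) B}
    {Y : Matrix (Fin 2) (Fin 2) ℝ} (h : MatrixConvergesTo l X Y) :
    MatrixConvergesTo l (fun t => (X t).adjugate) Y.adjugate := by
  simp only [Matrix.adjugate_fin_two]
  intro i j
  fin_cases i <;> fin_cases j
  · exact h 1 1
  · exact (h 0 1).neg
  · exact (h 1 0).neg
  · exact h 0 0

theorem MatrixConvergesTo.diagonal {x : ι → Fin 2 → B} {a : Fin 2 → ℝ}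
    (h : ∀ i, ConvergesTo l (fun t => x t i) (a i)) :
    MatrixConvergesTo l (fun t => Matrix.diagonal (x t)) (Matrix.diagonal a) := by
  intro i j
  rcases eq_or_ne i j with rfl | hij
  · simpa only [Matrix.diagonal_apply_eq] using h i
  · simpa only [Matrix.diagonal_apply_ne _ hij] using ConvergesTo.zero

theorem convergesTo_idealVector {x : ι → B} {a : ℝ} (h : ConvergesTo l x a) (v : Fin 4)
    (i : Fin 2) : ConvergesTo l (fun t => idealVector (x t) v i) (idealVector a v i) := by
  fin_cases v <;> fin_cases i <;>
    first | exact h | exact ConvergesTo.one | exact ConvergesTo.zero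

theorem convergesTo_bracket {x y : ι → Fin 2 → B} {a b : Fin 2 → ℝ}
    (hx : ∀ i, ConvergesTo l (fun t => x t i) (a i))
    (hy : ∀ i, ConvergesTo l (fun t => y t i) (b i)) :
    ConvergesTo l (fun t => bracket (x t) (y t)) (bracket a b) :=
  ((hx 0).mul (hy 1)).sub ((hx 1).mul (hy 0))

theorem matrixConvergesTo_flagFrame (h : ∀ j, ConvergesTo l (fun t => Z t j) (z j))
    (x : IdealTriangulation.Flag n) :
    MatrixConvergesTo l (fun t => flagFrame (Z t) x) (flagFrame z x) := by
  have h_vector (v : Fin 4) (i : Fin 2) := convergesTo_idealVector (h x.1) v i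
  have h_bracket (v w : Fin 4) := convergesTo_bracket (h_vector v) (h_vector w)
  intro i j
  fin_cases i <;> fin_cases j
  · exact (h_bracket _ _).mul (h_vector _ _)
  · exact ((h_bracket _ _).mul (h_vector _ _)).neg
  · exact (h_bracket _ _).mul (h_vector _ _)
  · exact ((h_bracket _ _).mul (h_vector _ _)).neg

theorem matrixConvergesTo_flagShift (h : ∀ j, ConvergesTo l (fun t => Z t j) (z j))
    (x : IdealTriangulation.Flag n) :
    MatrixConvergesTo l (fun t => flagShift (Z t) x) (flagShift z x) :=
  .diagonal fun i => ConvergesTo.sum Finset.univ fun k _ =>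
    (matrixConvergesTo_flagFrame h x i k).mul (convergesTo_idealVector (h x.1) (x.2 3) k)

theorem matrixConvergesTo_standardGlue (h : ∀ j, ConvergesTo l (fun t => Z t j) (z j))
    (j : Fin n) (f : Fin 4) :
    MatrixConvergesTo l (fun t => standardGlue T (Z t) j f) (standardGlue T z j f) :=
  (matrixConvergesTo_flagFrame h _).adjugate.mul
    ((matrixConvergesTo_flagShift h _).mul (matrixConvergesTo_flagFrame h _))

theorem Marking.matrixConvergesTo_glue (m : Marking n)
    (h : ∀ j, ConvergesTo l (fun t => Z t j) (z j)) (j : Fin n) (f : Fin 4) :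
    MatrixConvergesTo l (fun t => m.glue T (Z t) j f) (m.glue T z j f) :=
  MatrixConvergesTo.smul _ (((MatrixConvergesTo.const _).mul
    (matrixConvergesTo_standardGlue h j f)).mul (MatrixConvergesTo.const _))

theorem Marking.matrixConvergesTo_vertex (m : Marking n)
    (h : ∀ j, ConvergesTo l (fun t => Z t j) (z j)) (j : Fin n) (v : Fin 4) :
    MatrixConvergesTo l (fun t => m.vertex (Z t) j v) (m.vertex z j v) := by
  refine MatrixConvergesTo.smul _ (MatrixConvergesTo.act (MatrixConvergesTo.const _) ?_)
  intro a b
  simp only [standardPosition_eq]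
  exact (convergesTo_idealVector (h j) v a).mul (convergesTo_idealVector (h j) v b).star

end Continuity

section FoliationMarking

variable {n : ℕ} {T : IdealTriangulation n}

theorem realMatrix_real (Q : Matrix (Fin 2) (Fin 2) ℝ) : realMatrix Q = Q := by
  ext i j
  simp [realMatrix]

theorem det_ne_zero_of_isIsometry {A : Matrix (Fin 2) (Fin 2) ℝ} (h : IsIsometry A) :
    A.det ≠ 0 := by
  obtain ⟨r, hr, h⟩ := h
  rintro h_zero
  rw [h_zero, zero_mul, Algebra.algebraMap_self, RingHom.id_apply] at h
  exact hr.ne h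

theorem projEq_of_rankOne_eq_smul {x y : Fin 2 → ℝ} {r : ℝ} (hr : r ≠ 0) (hy : y ≠ 0)
    (h : rankOne x = r • rankOne y) : ProjEq ℝ x y := by
  obtain ⟨i, hi⟩ := Function.ne_iff.1 hy
  rw [Pi.zero_apply] at hi
  have h_entry (j : Fin 2) : x j * x i = r * (y j * y i) := by
    simpa [rankOne, Matrix.vecMulVec_apply] using congrFun (congrFun h j) i
  have hx : x i ≠ 0 := by
    intro hx
    have := h_entry i
    rw [hx, mul_zero] at this
    exact mul_ne_zero hr (mul_ne_zero hi hi) this.symm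
  refine .of_isUnit (div_ne_zero (mul_ne_zero hr hi) hx).isUnit ?_
  ext j
  rw [Pi.smul_apply, smul_eq_mul, div_mul_eq_mul_div, eq_div_iff hx, h_entry j]
  ring

theorem idealVector_ne_zero {B : Type} [CommRing B] [Nontrivial B] (z : B) (v : Fin 4) :
    idealVector z v ≠ 0 := by
  intro h
  have h₀ := congrFun h 0
  have h₁ := congrFun h 1
  fin_cases v <;> simp [idealVector] at h₀ h₁

theorem quadratic_form_pos_of_isIdealTetrahedron {z : ℝ} {r : Fin 4 → ℝ}
    {Q : Matrix (Fin 2) (Fin 2) ℝ}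
    (h : IsIdealTetrahedron fun v => r v • act Q (standardPosition z v)) {s : Fin 4 → ℝ}
    (hs : ∀ v, 0 ≤ s v ∧ s v < 1) (h_sum : ∑ v, s v = 1) :
    0 < s 0 * r 0 * (s 1 * r 1) + s 0 * r 0 * (s 2 * r 2) + s 0 * r 0 * (s 3 * r 3) +
      s 1 * r 1 * (s 2 * r 2) + s 1 * r 1 * (s 3 * r 3) * z ^ 2 +
      s 2 * r 2 * (s 3 * r 3) * (1 - z) ^ 2 := by
  obtain ⟨-, c, hc, h_det⟩ := h.2 s hs h_sum
  have h_act : ∑ v, s v • r v • act Q (standardPosition z v) =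
      act Q (∑ v, (s v * r v) • standardPosition z v) := by
    simp only [act_sum, act_real_smul, smul_smul]
  rw [h_act, det_act, det_sum_standardPosition, sqNorm_real, sqNorm_real, star_trivial,
    Algebra.algebraMap_self, RingHom.id_apply, RingHom.id_apply] at h_det
  rw [← h_det] at hc
  exact pos_of_mul_pos_right hc (mul_self_nonneg _)

theorem mul_pos_of_isIdealTetrahedron {z : ℝ} {r : Fin 4 → ℝ} (hr : ∀ v, r v ≠ 0)
    {Q : Matrix (Fin 2) (Fin 2) ℝ}
    (h : IsIdealTetrahedron fun v => r v • act Q (standardPosition z v)) (v w : Fin 4) :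
    0 < r v * r w := by
  rcases eq_or_ne v w with rfl | hvw
  · exact mul_self_pos.2 (hr v)
  have h_midpoint := quadratic_form_pos_of_isIdealTetrahedron h
    (s := fun u => if u = v ∨ u = w then 1 / 2 else 0) (fun u => by split_ifs <;> norm_num)
    (by simp [Finset.sum_ite, Finset.filter_or, Finset.filter_eq', hvw])
  clear h
  by_contra! h_nonpos
  have hz : r v * r w * z ^ 2 ≤ 0 := mul_nonpos_of_nonpos_of_nonneg h_nonpos (sq_nonneg _)
  have hz' : r v * r w * (1 - z) ^ 2 ≤ 0 := mul_nonpos_of_nonpos_of_nonneg h_nonpos (sq_nonneg _)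
  fin_cases v <;> fin_cases w <;> simp at hvw h_midpoint h_nonpos hz hz' <;> linarith

theorem projEq_standardGlue {z : Fin n → ℝ} (h0 : ∀ j, z j ≠ 0) (h1 : ∀ j, z j ≠ 1) (j : Fin n)
    (f : Fin 4) {G : Matrix (Fin 2) (Fin 2) ℝ}
    (hG : ∀ v, v ≠ f → SamePoint (act G (standardPosition (z (T.nbr j f)) (T.perm j f v)))
      (standardPosition (z j) v)) : ProjEq ℝ G (standardGlue T z j f) := by
  have isUnit_shape (j) : IsUnit (z j) := (h0 j).isUnit
  have isUnit_one_sub (j) : IsUnit (1 - z j) := (sub_ne_zero.2 (h1 j).symm).isUnit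
  refine projEq_of_mulVec_idealVector (isUnit_shape (T.nbr j f)) (isUnit_one_sub _) (T.perm j f f)
    (det_standardGlue_mem T (IsUnit.submonoid ℝ) isUnit_one.neg isUnit_shape isUnit_one_sub j f)
    fun v hv => ?_
  obtain ⟨v, rfl⟩ := (T.perm j f).surjective v
  have hvf : v ≠ f := fun h => hv (by rw [h])
  obtain ⟨c, hc, h_act⟩ := hG v hvf
  rw [standardPosition_eq, standardPosition_eq, act_rankOne] at h_act
  exact (projEq_of_rankOne_eq_smul hc (idealVector_ne_zero _ _) h_act).trans
    (standardGlue_mulVec isUnit_shape isUnit_one_sub j hvf).symm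

theorem Marking.exists_of_foliation (F : Foliation T) (h0 : ∀ j, F.shape j ≠ 0)
    (h1 : ∀ j, F.shape j ≠ 1) :
    ∃ m : Marking n, m.vertex F.shape = F.vertex ∧ m.glue T F.shape = F.glue := by
  choose A hA hA_vertex using F.hasShape
  choose r hr hr_vertex using hA_vertex
  have hA_unit (j) : IsUnit (A j).det := (det_ne_zero_of_isIsometry (hA j)).isUnit
  have h_vertex (j v) : r j v • act (A j)⁻¹ (standardPosition (F.shape j) v) = F.vertex j v := by
    rw [← act_real_smul, ← hr_vertex, act_act, Matrix.nonsing_inv_mul _ (hA_unit j), act_one]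
  have h_glue (j : Fin n) (f : Fin 4) :
      ProjEq ℝ (A j * F.glue j f * (A (T.nbr j f))⁻¹) (standardGlue T F.shape j f) := by
    refine projEq_standardGlue h0 h1 j f fun v hv => ?_
    obtain ⟨c, hc, h_act⟩ := F.glue_vertex j f v hv
    have h_ne := hr (T.nbr j f) (T.perm j f v)
    refine ⟨(r (T.nbr j f) (T.perm j f v))⁻¹ * (c * r j v),
      mul_ne_zero (inv_ne_zero h_ne) (mul_ne_zero hc (hr _ _)), ?_⟩
    rw [← act_act, ← act_act, mul_smul, eq_inv_smul_iff₀ h_ne, mul_smul, ← hr_vertex,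
      ← act_real_smul _ c, ← h_act, ← act_real_smul, ← act_real_smul, h_vertex]
  choose c hc using h_glue
  refine ⟨⟨fun j => (A j)⁻¹, r, fun j f => c j f, fun j => ?_, fun j => ?_,
    fun j f => (c j f).ne_zero⟩, ?_, ?_⟩
  · exact ((Matrix.isUnit_nonsing_inv_det_iff).2 (hA_unit j)).ne_zero
  · refine mul_pos_of_isIdealTetrahedron (z := F.shape j) (Q := (A j)⁻¹) (hr j) ?_
    simpa only [h_vertex] using F.ideal j
  · funext j v
    rw [Marking.vertex, realMatrix_real, h_vertex]
  · funext j f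
    simp only [Marking.glue, realMatrix_real]
    rw [← Matrix.smul_mul, ← Matrix.mul_smul, ← hc,
      Matrix.nonsing_inv_nonsing_inv _ (hA_unit _), Matrix.mul_assoc, Matrix.mul_assoc,
      Matrix.nonsing_inv_mul _ (hA_unit _), Matrix.mul_one, ← Matrix.mul_assoc,
      Matrix.nonsing_inv_mul _ (hA_unit _), Matrix.one_mul]

end FoliationMarking

/-! ### Dihedral angles near a real solution -/

section Angle

theorem tendsto_arg_of_im_pos {ι : Type*} {l : Filter ι} {q : ι → ℂ} {c : ℝ} (hc : c ≠ 0)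
    (h : Tendsto q l (𝓝 (c : ℂ))) (him : ∀ᶠ t in l, 0 < (q t).im) :
    Tendsto (fun t => (q t).arg) l (𝓝 (c : ℂ).arg) := by
  rcases lt_or_gt_of_ne hc with hneg | hpos
  · have hcont := Complex.continuousWithinAt_arg_of_re_neg_of_im_zero (z := (c : ℂ))
      (by simpa using hneg) (by simp)
    exact hcont.tendsto.comp (tendsto_nhdsWithin_iff.2 ⟨h, him.mono fun t ht => ht.le⟩)
  · exact (Complex.continuousAt_arg (Or.inl (by simpa using hpos))).tendsto.comp h

theorem prod_norm_mul_exp_sum_arg (f : ℕ → ℂ) (k : ℕ) (hf : ∀ i < k, f i ≠ 0) :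
    f 0 * ((∏ i ∈ Finset.range k, ‖f (i + 1) / f i‖ : ℝ) : ℂ) *
      Complex.exp ((∑ i ∈ Finset.range k, (f (i + 1) / f i).arg : ℝ) * Complex.I) = f k := by
  induction k with
  | zero => simp
  | succ k ih =>
    have ih := ih fun i hi => hf i (by omega)
    rw [Finset.prod_range_succ, Finset.sum_range_succ]
    push_cast at ih ⊢
    rw [add_mul, Complex.exp_add]
    calc _ = (f 0 * (∏ i ∈ Finset.range k, (‖f (i + 1) / f i‖ : ℂ)) *
        Complex.exp ((∑ i ∈ Finset.range k, ((f (i + 1) / f i).arg : ℂ)) * Complex.I)) *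
        (‖f (k + 1) / f k‖ * Complex.exp ((f (k + 1) / f k).arg * Complex.I)) := by ring
      _ = _ := by
        rw [ih, Complex.norm_mul_exp_arg_mul_I, mul_div_cancel₀ _ (hf k (by omega))]

theorem exists_sum_arg_eq_int_mul_two_pi (f : ℕ → ℂ) (k : ℕ) (hf : ∀ i, f i ≠ 0)
    (h : f k = f 0) :
    ∃ m : ℤ, ∑ i ∈ Finset.range k, (f (i + 1) / f i).arg = m * (2 * Real.pi) := by
  have hclosed := prod_norm_mul_exp_sum_arg f k fun i _ => hf i
  rw [h, mul_assoc] at hclosed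
  have hpolar := mul_left_cancel₀ (hf 0) (hclosed.trans (mul_one _).symm)
  set R := ∏ i ∈ Finset.range k, ‖f (i + 1) / f i‖
  set S := ∑ i ∈ Finset.range k, (f (i + 1) / f i).arg
  have hR : R = 1 := by
    have hnorm := congrArg norm hpolar
    rwa [norm_mul, Complex.norm_exp_ofReal_mul_I, mul_one, norm_one, Complex.norm_real,
      Real.norm_of_nonneg (Finset.prod_nonneg fun _ _ => norm_nonneg _)] at hnorm
  rw [hR, Complex.ofReal_one, one_mul, Complex.exp_eq_one_iff] at hpolar
  obtain ⟨m, hm⟩ := hpolar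
  exact ⟨m, by simpa using congrArg Complex.im hm⟩

theorem eq_two_pi_of_mem_Ioo {θ : ℝ} {m : ℤ} (hm : θ = m * (2 * Real.pi))
    (hθ : θ ∈ Set.Ioo 0 (4 * Real.pi)) : θ = 2 * Real.pi := by
  have hpi := Real.two_pi_pos
  have hpos : (0 : ℝ) < m := pos_of_mul_pos_left (hm ▸ hθ.1) hpi.le
  have hlt : (m : ℝ) < 2 := lt_of_mul_lt_mul_right (by linarith [hθ.2]) hpi.le
  obtain rfl : m = 1 := by
    have : 0 < m := by exact_mod_cast hpos
    have : m < 2 := by exact_mod_cast hlt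
    omega
  simpa using hm

theorem edgeShape_cases {A : Type} [CommRing A] (z : A) (a b : Fin 4) :
    edgeShape z a b = z ∨ edgeShape z a b = Ring.inverse (1 - z) ∨
      edgeShape z a b = (z - 1) * Ring.inverse z := by
  unfold edgeShape
  split_ifs <;> simp

theorem edgeShape_ne_zero {K : Type} [Field K] {z : K} (h0 : z ≠ 0) (h1 : z ≠ 1) (a b : Fin 4) :
    edgeShape z a b ≠ 0 := by
  rcases edgeShape_cases z a b with h | h | h <;> rw [h] <;> simp [sub_eq_zero, h0, h1, h1.symm]

variable {n : ℕ} {T : IdealTriangulation n}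

theorem partialHolonomy_succ {A : Type} [CommRing A] (z : Fin n → A)
    (x : IdealTriangulation.Flag n) (k : ℕ) :
    partialHolonomy T z x (k + 1) = partialHolonomy T z x k *
      edgeShape (z (T.turn^[k] x).1) ((T.turn^[k] x).2 0) ((T.turn^[k] x).2 1) :=
  Finset.prod_range_succ _ _

theorem partialHolonomy_ne_zero {K : Type} [Field K] {z : Fin n → K} (h0 : ∀ j, z j ≠ 0)
    (h1 : ∀ j, z j ≠ 1) (x : IdealTriangulation.Flag n) (k : ℕ) :
    partialHolonomy T z x k ≠ 0 :=
  Finset.prod_ne_zero_iff.2 fun _ _ => edgeShape_ne_zero (h0 _) (h1 _) _ _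

variable {B : Type} [CommRing B] [StarRing B] [Algebra ℝ B] [HasPlane B] [PlanarAlgebra B]

theorem sqNorm_ringInverse_pos {x : B} (h : 0 < sqNorm x) : 0 < sqNorm (Ring.inverse x) := by
  have hmul := sqNorm_mul x (Ring.inverse x)
  rw [Ring.mul_inverse_cancel _ (isUnit_of_sqNorm_pos h), sqNorm_one] at hmul
  exact pos_of_mul_pos_right (hmul ▸ one_pos) h.le

theorem sqNorm_edgeShape_pos {z : B} (h0 : 0 < sqNorm z) (h1 : 0 < sqNorm (1 - z))
    (a b : Fin 4) : 0 < sqNorm (edgeShape z a b) := by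
  rcases edgeShape_cases z a b with h | h | h <;> rw [h]
  · exact h0
  · exact sqNorm_ringInverse_pos h1
  · rw [sqNorm_mul, ← neg_sub, sqNorm_neg]
    exact mul_pos h1 (sqNorm_ringInverse_pos h0)

theorem sqNorm_partialHolonomy_pos {z : Fin n → B} (h0 : ∀ j, 0 < sqNorm (z j))
    (h1 : ∀ j, 0 < sqNorm (1 - z j)) (x : IdealTriangulation.Flag n) (k : ℕ) :
    0 < sqNorm (partialHolonomy T z x k) :=
  (positiveNorm B).prod_mem fun _ _ => sqNorm_edgeShape_pos (h0 _) (h1 _) _ _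

theorem imPart_edgeShape_pos {z : B} (h0 : 0 < sqNorm z) (h1 : 0 < sqNorm (1 - z))
    (h : 0 < imPart z) (a b : Fin 4) : 0 < imPart (edgeShape z a b) := by
  rcases edgeShape_cases z a b with e | e | e <;> rw [e]
  · exact h
  · rw [ringInverse_eq h1]
    simp only [imPart_mul, rePart_algebraMap, imPart_algebraMap, imPart_star, imPart_sub,
      imPart_one, zero_mul, add_zero, zero_sub, neg_neg]
    positivity
  · rw [sub_mul, Ring.mul_inverse_cancel _ (isUnit_of_sqNorm_pos h0), one_mul, imPart_sub,
      ringInverse_eq h0]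
    simp only [imPart_mul, rePart_algebraMap, imPart_algebraMap, imPart_star,
      imPart_one, zero_mul, add_zero, zero_sub, mul_neg, neg_neg]
    positivity

theorem plane_ne_zero_of_sqNorm_pos {w : B} (hw : 0 < sqNorm w) : HasPlane.plane w ≠ 0 := by
  intro h
  have hre : rePart w = 0 := congrArg Complex.re h
  have him : imPart w = 0 := congrArg Complex.im h
  simp [sqNorm, hre, him] at hw

theorem im_plane_mul_div_plane_pos {w c : B} (hw : 0 < sqNorm w) (hc : 0 < imPart c) :
    0 < (HasPlane.plane (w * c) / HasPlane.plane w).im := by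
  rw [Complex.div_im, ← sub_div]
  refine div_pos ?_ (Complex.normSq_pos.2 (plane_ne_zero_of_sqNorm_pos hw))
  calc 0 < imPart c * sqNorm w := mul_pos hc hw
    _ = imPart (w * c) * rePart w - rePart (w * c) * imPart w := by
      rw [imPart_mul, rePart_mul, sqNorm]; ring

theorem im_plane_partialHolonomy_div_pos {z : Fin n → B} (h0 : ∀ j, 0 < sqNorm (z j))
    (h1 : ∀ j, 0 < sqNorm (1 - z j)) (him : ∀ j, 0 < imPart (z j))
    (x : IdealTriangulation.Flag n) (k : ℕ) :
    0 < (HasPlane.plane (partialHolonomy T z x (k + 1)) /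
      HasPlane.plane (partialHolonomy T z x k)).im := by
  rw [partialHolonomy_succ]
  exact im_plane_mul_div_plane_pos (sqNorm_partialHolonomy_pos h0 h1 x k)
    (imPart_edgeShape_pos (h0 _) (h1 _) (him _) _ _)

theorem exists_totalAngle_eq_int_mul_two_pi {z : Fin n → B} (h0 : ∀ j, 0 < sqNorm (z j))
    (h1 : ∀ j, 0 < sqNorm (1 - z j)) (x : IdealTriangulation.Flag n)
    (hprod : partialHolonomy T z x (T.valence x) = 1) :
    ∃ m : ℤ, totalAngle T z x = m * (2 * Real.pi) :=
  exists_sum_arg_eq_int_mul_two_pi (fun k => HasPlane.plane (partialHolonomy T z x k)) _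
    (fun k => plane_ne_zero_of_sqNorm_pos (sqNorm_partialHolonomy_pos h0 h1 x k))
    (by simp only [hprod]; simp [partialHolonomy])

variable {ι : Type*} {l : Filter ι} {Z : ι → Fin n → B} {z : Fin n → ℝ}

theorem convergesTo_edgeShape {x : ι → B} {a : ℝ} (h : ConvergesTo l x a) (h0 : a ≠ 0)
    (h1 : a ≠ 1) (v w : Fin 4) :
    ConvergesTo l (fun t => edgeShape (x t) v w) (edgeShape a v w) := by
  unfold edgeShape
  split_ifs
  · exact h
  · simpa using (ConvergesTo.one.sub h).ringInverse (sub_ne_zero.2 h1.symm)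
  · simpa using (h.sub ConvergesTo.one).mul (h.ringInverse h0)

theorem convergesTo_partialHolonomy (h0 : ∀ j, z j ≠ 0) (h1 : ∀ j, z j ≠ 1)
    (hZ : ∀ j, ConvergesTo l (fun t => Z t j) (z j)) (x : IdealTriangulation.Flag n) (k : ℕ) :
    ConvergesTo l (fun t => partialHolonomy T (Z t) x k) (partialHolonomy T z x k) :=
  ConvergesTo.prod _ fun _ _ => convergesTo_edgeShape (hZ _) (h0 _) (h1 _) _ _

theorem eventually_sqNorm_pos (h0 : ∀ j, z j ≠ 0)
    (hZ : ∀ j, ConvergesTo l (fun t => Z t j) (z j)) : ∀ᶠ t in l, ∀ j, 0 < sqNorm (Z t j) :=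
  eventually_all.2 fun j => (hZ j).eventually_sqNorm_pos (h0 j)

theorem eventually_sqNorm_one_sub_pos (h1 : ∀ j, z j ≠ 1)
    (hZ : ∀ j, ConvergesTo l (fun t => Z t j) (z j)) :
    ∀ᶠ t in l, ∀ j, 0 < sqNorm (1 - Z t j) :=
  eventually_all.2 fun j =>
    (ConvergesTo.one.sub (hZ j)).eventually_sqNorm_pos (sub_ne_zero.2 (h1 j).symm)

theorem tendsto_totalAngle (h0 : ∀ j, z j ≠ 0) (h1 : ∀ j, z j ≠ 1)
    (hZ : ∀ j, ConvergesTo l (fun t => Z t j) (z j))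
    (him : ∀ᶠ t in l, ∀ j, 0 < imPart (Z t j)) (x : IdealTriangulation.Flag n) :
    Tendsto (fun t => totalAngle T (Z t) x) l (𝓝 (totalAngle T z x)) := by
  refine tendsto_finsetSum _ fun k _ => ?_
  have hne := partialHolonomy_ne_zero (T := T) h0 h1 x
  have hquot := (convergesTo_partialHolonomy (T := T) h0 h1 hZ x (k + 1)).div
    (convergesTo_partialHolonomy h0 h1 hZ x k) (Complex.ofReal_ne_zero.2 (hne k))
  rw [← Complex.ofReal_div] at hquot
  have harg := tendsto_arg_of_im_pos (div_ne_zero (hne (k + 1)) (hne k)) hquot (by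
    filter_upwards [eventually_sqNorm_pos h0 hZ, eventually_sqNorm_one_sub_pos h1 hZ, him]
      with t t0 t1 tim using im_plane_partialHolonomy_div_pos t0 t1 tim x k)
  simpa [HasPlane.plane] using harg

theorem eventually_totalAngle_eq_two_pi (h0 : ∀ j, z j ≠ 0) (h1 : ∀ j, z j ≠ 1)
    (hZ : ∀ j, ConvergesTo l (fun t => Z t j) (z j))
    (him : ∀ᶠ t in l, ∀ j, 0 < imPart (Z t j)) (x : IdealTriangulation.Flag n)
    (hprod : ∀ᶠ t in l, partialHolonomy T (Z t) x (T.valence x) = 1)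
    (hang : totalAngle T z x = 2 * Real.pi) :
    ∀ᶠ t in l, totalAngle T (Z t) x = 2 * Real.pi := by
  have hnear := (hang ▸ tendsto_totalAngle (T := T) h0 h1 hZ him x).eventually
    (Ioo_mem_nhds Real.two_pi_pos (show 2 * Real.pi < 4 * Real.pi by linarith [Real.pi_pos]))
  filter_upwards [hnear, eventually_sqNorm_pos h0 hZ, eventually_sqNorm_one_sub_pos h1 hZ, hprod]
    with t hmem t0 t1 tprod
  obtain ⟨m, hm⟩ := exists_totalAngle_eq_int_mul_two_pi t0 t1 x tprod
  exact eq_two_pi_of_mem_Ioo hm hmem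

theorem eventually_thurstonEquations (h0 : ∀ j, z j ≠ 0) (h1 : ∀ j, z j ≠ 1)
    (hZ : ∀ j, ConvergesTo l (fun t => Z t j) (z j))
    (him : ∀ᶠ t in l, ∀ j, 0 < imPart (Z t j))
    (hprod : ∀ᶠ t in l, ∀ x : IdealTriangulation.Flag n, Equiv.Perm.sign x.2 = 1 →
      partialHolonomy T (Z t) x (T.valence x) = 1)
    (hang : ∀ x : IdealTriangulation.Flag n, Equiv.Perm.sign x.2 = 1 →
      totalAngle T z x = 2 * Real.pi) :
    ∀ᶠ t in l, ThurstonEquations T (Z t) := by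
  refine eventually_all.2 fun x => eventually_imp_distrib_left.2 fun hx => ?_
  have hprod_x := hprod.mono fun t ht => ht x hx
  exact hprod_x.and (eventually_totalAngle_eq_two_pi h0 h1 hZ him x hprod_x (hang x hx))

end Angle

/-! ### Regeneration along a curve of shape parameters -/

section Regenerate

theorem exists_reparametrization {δ : ℝ} (hδ : 0 < δ) :
    ∃ p : Set.Ioi (0 : ℝ) → ℝ, Continuous p ∧ (∀ t, p t ∈ Set.Ioo 0 δ) ∧
      Tendsto p toZero (𝓝[>] 0) := by
  have hmem (t : Set.Ioi (0 : ℝ)) : δ * (t.1 / (1 + t.1)) ∈ Set.Ioo 0 δ := by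
    have ht : (0 : ℝ) < t.1 := t.2
    refine ⟨by positivity, mul_lt_of_lt_one_right hδ ?_⟩
    rw [div_lt_one (by positivity)]
    linarith
  refine ⟨fun t => δ * (t.1 / (1 + t.1)), ?_, hmem, ?_⟩
  · refine continuous_const.mul (continuous_subtype_val.div (by fun_prop) fun t => ?_)
    have ht : (0 : ℝ) < t.1 := t.2
    positivity
  · refine tendsto_nhdsWithin_iff.2 ⟨?_, Eventually.of_forall fun t => (hmem t).1⟩
    have hcont : ContinuousAt (fun t : ℝ => δ * (t / (1 + t))) 0 :=
      continuousAt_const.mul (continuousAt_id.div (by fun_prop) (by simp))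
    have hlim := hcont.tendsto
    simp only [zero_div, mul_zero] at hlim
    exact hlim.comp tendsto_comap

variable {B : Type} [CommRing B] [StarRing B] [Algebra ℝ B] [HasPlane B] [PlanarAlgebra B]
  {n : ℕ} {T : IdealTriangulation n}

theorem matrixConvergesTo_holonomy {ι : Type*} {l : Filter ι} {S : ι → TriangulatedStructure T B}
    {F : Foliation T} (h : ∀ j f, MatrixConvergesTo l (fun t => (S t).glue j f) (F.glue j f))
    (j : Fin n) (path : List (Fin 4)) :
    MatrixConvergesTo l (fun t => (S t).holonomy j path) (F.holonomy j path) := by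
  induction path generalizing j with
  | nil => exact MatrixConvergesTo.one
  | cons f path ih => exact (h j f).mul (ih _)

theorem collapsesTo_of_matrixConvergesTo {S : Set.Ioi (0 : ℝ) → TriangulatedStructure T B}
    {F : Foliation T}
    (hvertex : ∀ j v, MatrixConvergesTo toZero (fun t => (S t).vertex j v) (F.vertex j v))
    (hglue : ∀ j f, MatrixConvergesTo toZero (fun t => (S t).glue j f) (F.glue j f))
    (hshape : ∀ j, ConvergesTo toZero (fun t => (S t).shape j) (F.shape j)) :
    CollapsesTo S F := by
  have hhol := matrixConvergesTo_holonomy hglue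
  refine ⟨fun j path v => ⟨fun _ => 1, fun _ => one_ne_zero, ?_⟩,
    fun j path => ⟨fun _ => 1, fun _ => isUnit_one, ?_⟩, hshape⟩
  · simp only [one_smul]
    exact (hhol j path).act (hvertex _ v)
  · simp only [one_smul]
    exact hhol j path

theorem exists_path_collapsesTo (F : Foliation T) (h0 : ∀ j, F.shape j ≠ 0)
    (h1 : ∀ j, F.shape j ≠ 1) (Z : ℝ → Fin n → B)
    (hcont : ∀ᶠ s in 𝓝[>] (0 : ℝ), ∀ j, ContinuousAt (fun s => HasPlane.plane (Z s j)) s)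
    (hZ : ∀ j, ConvergesTo (𝓝[>] (0 : ℝ)) (fun s => Z s j) (F.shape j))
    (him : ∀ᶠ s in 𝓝[>] (0 : ℝ), ∀ j, 0 < imPart (Z s j))
    (hprod : ∀ᶠ s in 𝓝[>] (0 : ℝ), ∀ x : IdealTriangulation.Flag n, Equiv.Perm.sign x.2 = 1 →
      partialHolonomy T (Z s) x (T.valence x) = 1) :
    ∃ S : Set.Ioi (0 : ℝ) →
        {S : TriangulatedStructure T B // ∀ j, IsPositivelyOriented (S.vertex j)},
      IsPath (fun t => (S t).1) ∧ CollapsesTo (fun t => (S t).1) F := by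
  have hthurston := eventually_thurstonEquations (T := T) h0 h1 hZ him hprod F.edge_angle
  obtain ⟨δ, hδ, hall⟩ := mem_nhdsGT_iff_exists_Ioo_subset.1
    (hcont.and (him.and ((eventually_sqNorm_pos h0 hZ).and
      ((eventually_sqNorm_one_sub_pos h1 hZ).and hthurston))))
  obtain ⟨p, hp_cont, hp_mem, hp_lim⟩ := exists_reparametrization hδ
  have hgood (t) := hall (hp_mem t)
  choose g_cont g_im g0 g1 g_thurston using hgood
  obtain ⟨m, hm_vertex, hm_glue⟩ := Marking.exists_of_foliation F h0 h1
  have hZp (j) : ConvergesTo toZero (fun t => Z (p t) j) (F.shape j) := (hZ j).comp hp_lim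
  refine ⟨fun t => ⟨m.build (g0 t) (g1 t) (g_thurston t),
    fun j => m.isPositivelyOriented j (g_im t j)⟩, fun j => ?_,
    collapsesTo_of_matrixConvergesTo (fun j v => ?_) (fun j f => ?_) hZp⟩
  · exact continuous_iff_continuousAt.2 fun t =>
      ContinuousAt.comp (g := fun s => HasPlane.plane (Z s j)) (g_cont t j) hp_cont.continuousAt
  · exact hm_vertex ▸ m.matrixConvergesTo_vertex hZp j v
  · exact hm_glue ▸ m.matrixConvergesTo_glue hZp j f

end Regenerate

/-! ### Edge cycles -/

section Cycles

theorem halfTurn_mul_halfTurn : halfTurn * halfTurn = 1 := by decide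

variable {n : ℕ}

/-- The flag of the same edge with the opposite orientation. -/
def reverseFlag : Equiv.Perm (IdealTriangulation.Flag n) :=
  Function.Involutive.toPerm (fun x => (x.1, x.2 * halfTurn)) fun x => by
    simp [mul_assoc, halfTurn_mul_halfTurn]

/-- The half turn of the tetrahedra, acting on flags. -/
def halfTurnFlag : Equiv.Perm (IdealTriangulation.Flag n) :=
  Function.Involutive.toPerm (fun x => (x.1, halfTurn * x.2)) fun x => by
    simp [← mul_assoc, halfTurn_mul_halfTurn]

variable (T : IdealTriangulation n)

theorem turn_reverseFlag_turn (x : IdealTriangulation.Flag n) :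
    T.turn (reverseFlag (T.turn x)) = reverseFlag x := by
  have hface : (T.turn x).2 (halfTurn 2) = T.perm x.1 (x.2 2) (x.2 2) := by
    have : Equiv.swap (2 : Fin 4) 3 (halfTurn 2) = 2 := by decide
    simp [IdealTriangulation.turn, this]
  have hswap : Equiv.swap (2 : Fin 4) 3 * (halfTurn * Equiv.swap 2 3) = halfTurn := by decide
  refine Prod.ext ?_ ?_
  · change T.nbr (T.turn x).1 ((T.turn x).2 (halfTurn 2)) = x.1
    rw [hface]
    exact T.nbr_nbr _ _
  · change T.perm (T.turn x).1 ((T.turn x).2 (halfTurn 2)) * ((T.turn x).2 * halfTurn) *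
      Equiv.swap 2 3 = x.2 * halfTurn
    have hback : T.perm (T.turn x).1 (T.perm x.1 (x.2 2) (x.2 2)) = (T.perm x.1 (x.2 2))⁻¹ :=
      T.perm_perm x.1 (x.2 2)
    rw [hface, hback]
    simp only [IdealTriangulation.turn, mul_assoc, inv_mul_cancel_left, hswap]

/-- Turning around edges as a permutation of the flags. -/
def turnPerm : Equiv.Perm (IdealTriangulation.Flag n) where
  toFun := T.turn
  invFun x := reverseFlag (T.turn (reverseFlag x))
  left_inv x := by
    change reverseFlag (T.turn (reverseFlag (T.turn x))) = x
    rw [turn_reverseFlag_turn]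
    exact reverseFlag.left_inv x
  right_inv x := by
    rw [turn_reverseFlag_turn]
    exact reverseFlag.left_inv x

open Classical in
/-- The flags around the edge of a flag. -/
def edgeCycle (x : IdealTriangulation.Flag n) : Finset (IdealTriangulation.Flag n) :=
  {y | (turnPerm T).SameCycle x y}

variable {T}

theorem mem_edgeCycle {x y : IdealTriangulation.Flag n} :
    y ∈ edgeCycle T x ↔ (turnPerm T).SameCycle x y := by
  simp [edgeCycle]

theorem edgeCycle_eq {x y : IdealTriangulation.Flag n} (h : (turnPerm T).SameCycle x y) :
    edgeCycle T x = edgeCycle T y := by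
  ext u
  simp only [mem_edgeCycle]
  exact ⟨h.symm.trans, h.trans⟩

theorem turnPerm_pow (x : IdealTriangulation.Flag n) (k : ℕ) :
    (turnPerm T ^ k) x = T.turn^[k] x := by
  rw [← Equiv.Perm.iterate_eq_pow]
  rfl

theorem valence_pos (x : IdealTriangulation.Flag n) : 0 < T.valence x :=
  Function.minimalPeriod_pos_of_mem_periodicPts ((turnPerm T).injective.mem_periodicPts x)

theorem edgeCycle_eq_image (x : IdealTriangulation.Flag n) :
    edgeCycle T x = (Finset.range (T.valence x)).image fun k => T.turn^[k] x := by
  ext y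
  simp only [mem_edgeCycle, Finset.mem_image, Finset.mem_range]
  constructor
  · intro h
    obtain ⟨k, -, hk⟩ := h.exists_pow_eq'
    refine ⟨k % T.valence x, Nat.mod_lt _ (valence_pos x), ?_⟩
    rw [← hk, turnPerm_pow]
    exact Function.iterate_mod_minimalPeriod_eq
  · rintro ⟨k, -, rfl⟩
    exact ⟨k, by rw [zpow_natCast, turnPerm_pow]⟩

@[to_additive]
theorem prod_edgeCycle {M : Type*} [CommMonoid M] (f : IdealTriangulation.Flag n → M)
    (x : IdealTriangulation.Flag n) :
    ∏ y ∈ edgeCycle T x, f y = ∏ k ∈ Finset.range (T.valence x), f (T.turn^[k] x) := by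
  rw [edgeCycle_eq_image, Finset.prod_image]
  intro a ha b hb h
  simp only [Finset.coe_range] at ha hb
  exact Function.iterate_injOn_Iio_minimalPeriod ha hb h

theorem sign_of_mem_edgeCycle {x y : IdealTriangulation.Flag n} (h : y ∈ edgeCycle T x) :
    Equiv.Perm.sign y.2 = Equiv.Perm.sign x.2 := by
  rw [edgeCycle_eq_image] at h
  obtain ⟨k, -, rfl⟩ := Finset.mem_image.1 h
  exact sign_turn_iterate x k

theorem sameCycle_reverseFlag {x y : IdealTriangulation.Flag n}
    (h : (turnPerm T).SameCycle x y) :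
    (turnPerm T).SameCycle (reverseFlag x) (reverseFlag y) := by
  have hconj : reverseFlag * turnPerm T * reverseFlag⁻¹ = (turnPerm T)⁻¹ := by
    rw [mul_inv_eq_iff_eq_mul, eq_inv_mul_iff_mul_eq]
    ext1 x
    exact turn_reverseFlag_turn T x
  simpa only [hconj, Equiv.Perm.sameCycle_inv] using h.conj (g := reverseFlag)

@[to_additive]
theorem prod_edgeCycle_of_involutive {M : Type*} [CommMonoid M]
    {g : IdealTriangulation.Flag n → IdealTriangulation.Flag n} (hinv : Function.Involutive g)
    (hg : ∀ x y, (turnPerm T).SameCycle x y → (turnPerm T).SameCycle (g x) (g y))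
    {f : IdealTriangulation.Flag n → M} (hf : ∀ x, f (g x) = f x)
    (x : IdealTriangulation.Flag n) :
    ∏ y ∈ edgeCycle T (g x), f y = ∏ y ∈ edgeCycle T x, f y := by
  refine Finset.prod_nbij' g g (fun y hy => ?_) (fun y hy => ?_) (fun y _ => hinv y)
    (fun y _ => hinv y) (fun y _ => (hf y).symm)
  · rw [mem_edgeCycle] at hy ⊢
    simpa only [hinv x] using hg _ _ hy
  · rw [mem_edgeCycle] at hy ⊢
    exact hg _ _ hy

/-- The shape parameter at the edge of a flag. -/
def flagShape {A : Type} [CommRing A] (z : Fin n → A) (x : IdealTriangulation.Flag n) : A :=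
  edgeShape (z x.1) (x.2 0) (x.2 1)

theorem partialHolonomy_valence {A : Type} [CommRing A] (z : Fin n → A)
    (x : IdealTriangulation.Flag n) :
    partialHolonomy T z x (T.valence x) = ∏ y ∈ edgeCycle T x, flagShape z y := by
  rw [prod_edgeCycle]
  rfl

theorem plane_partialHolonomy_succ_div {z : Fin n → ℝ} (h0 : ∀ j, z j ≠ 0) (h1 : ∀ j, z j ≠ 1)
    (x : IdealTriangulation.Flag n) (k : ℕ) :
    HasPlane.plane (partialHolonomy T z x (k + 1)) / HasPlane.plane (partialHolonomy T z x k) =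
      ((flagShape z (T.turn^[k] x) : ℝ) : ℂ) := by
  have hne : ((partialHolonomy T z x k : ℝ) : ℂ) ≠ 0 := by
    exact_mod_cast partialHolonomy_ne_zero h0 h1 x k
  rw [partialHolonomy_succ]
  change ((_ * _ : ℝ) : ℂ) / ((_ : ℝ) : ℂ) = _
  rw [Complex.ofReal_mul, mul_div_cancel_left₀ _ hne]
  rfl

theorem totalAngle_eq_sum_edgeCycle {z : Fin n → ℝ} (h0 : ∀ j, z j ≠ 0) (h1 : ∀ j, z j ≠ 1)
    (x : IdealTriangulation.Flag n) :
    totalAngle T z x = ∑ y ∈ edgeCycle T x, if flagShape z y < 0 then Real.pi else 0 := by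
  rw [sum_edgeCycle, totalAngle]
  refine Finset.sum_congr rfl fun k _ => ?_
  rw [plane_partialHolonomy_succ_div h0 h1]
  split_ifs with hneg
  · exact Complex.arg_ofReal_of_neg hneg
  · exact Complex.arg_ofReal_of_nonneg (not_lt.1 hneg)

theorem card_filter_flagShape_neg {z : Fin n → ℝ} (h0 : ∀ j, z j ≠ 0) (h1 : ∀ j, z j ≠ 1)
    {x : IdealTriangulation.Flag n} (h : totalAngle T z x = 2 * Real.pi) :
    ((edgeCycle T x).filter fun y => flagShape z y < 0).card = 2 := by
  rw [totalAngle_eq_sum_edgeCycle h0 h1, ← Finset.sum_filter, Finset.sum_const,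
    nsmul_eq_mul] at h
  exact_mod_cast mul_right_cancel₀ Real.pi_ne_zero h

end Cycles

/-! ### Types of edges -/

section EdgeTypes

/-- The pair of opposite edges that contains `a b`. -/
def edgeType (a b : Fin 4) : Fin 3 :=
  if ({a, b} : Finset (Fin 4)) = {0, 1} ∨ ({a, b} : Finset (Fin 4)) = {2, 3} then 0
  else if ({a, b} : Finset (Fin 4)) = {0, 2} ∨ ({a, b} : Finset (Fin 4)) = {1, 3} then 1
  else 2

/-- The three shape parameters of a tetrahedron, one for each pair of opposite edges. -/
def typeShape {A : Type} [CommRing A] (z : A) : Fin 3 → A :=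
  ![z, Ring.inverse (1 - z), (z - 1) * Ring.inverse z]

theorem edgeShape_eq_typeShape {A : Type} [CommRing A] (z : A) (a b : Fin 4) :
    edgeShape z a b = typeShape z (edgeType a b) := by
  unfold edgeShape edgeType
  split_ifs <;> rfl

variable {n : ℕ}

/-- The pair of opposite edges that contains the edge of a flag. -/
def flagType (x : IdealTriangulation.Flag n) : Fin 3 := edgeType (x.2 0) (x.2 1)

theorem flagShape_eq_typeShape {A : Type} [CommRing A] (z : Fin n → A)
    (x : IdealTriangulation.Flag n) : flagShape z x = typeShape (z x.1) (flagType x) :=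
  edgeShape_eq_typeShape _ _ _

theorem flagType_reverseFlag (x : IdealTriangulation.Flag n) :
    flagType (reverseFlag x) = flagType x := by
  have h : ∀ π : Equiv.Perm (Fin 4),
      edgeType ((π * halfTurn) 0) ((π * halfTurn) 1) = edgeType (π 0) (π 1) := by decide
  exact h x.2

theorem flagType_halfTurnFlag (x : IdealTriangulation.Flag n) :
    flagType (halfTurnFlag x) = flagType x := by
  have h : ∀ π : Equiv.Perm (Fin 4),
      edgeType ((halfTurn * π) 0) ((halfTurn * π) 1) = edgeType (π 0) (π 1) := by decide
  exact h x.2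

theorem card_even_edgeType_eq (i : Fin 3) :
    (Finset.univ.filter fun π : Equiv.Perm (Fin 4) =>
      Equiv.Perm.sign π = 1 ∧ edgeType (π 0) (π 1) = i).card = 4 := by
  revert i
  decide

@[to_additive]
theorem prod_even_edgeType {M : Type*} [CommMonoid M] (f : Fin 3 → M) :
    ∏ π : Equiv.Perm (Fin 4) with Equiv.Perm.sign π = 1, f (edgeType (π 0) (π 1)) =
      (f 0 * f 1 * f 2) ^ 4 := by
  rw [← Finset.prod_fiberwise' (g := fun π : Equiv.Perm (Fin 4) => edgeType (π 0) (π 1))]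
  simp only [Finset.prod_const, Finset.filter_filter, card_even_edgeType_eq]
  rw [Fin.prod_univ_three, mul_pow, mul_pow]

/-- The flags that are positive orderings of the vertices. -/
def evenFlags (n : ℕ) : Finset (IdealTriangulation.Flag n) :=
  {x | Equiv.Perm.sign x.2 = 1}

theorem mem_evenFlags {x : IdealTriangulation.Flag n} :
    x ∈ evenFlags n ↔ Equiv.Perm.sign x.2 = 1 := by
  simp [evenFlags]

@[to_additive]
theorem prod_evenFlags {M : Type*} [CommMonoid M] (f : Fin n → Fin 3 → M) :
    ∏ x ∈ evenFlags n, f x.1 (flagType x) = ∏ j, (f j 0 * f j 1 * f j 2) ^ 4 := by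
  have hprod : evenFlags n = Finset.univ ×ˢ
      ({π | Equiv.Perm.sign π = 1} : Finset (Equiv.Perm (Fin 4))) := by
    ext x
    simp [evenFlags]
  rw [hprod, Finset.prod_product]
  exact Finset.prod_congr rfl fun j _ => prod_even_edgeType (f j)

end EdgeTypes

/-! ### Edges of the monodromy triangulation -/

section Letters

/-- For the pair of edges of the unit square that the letter `b` fixes (the horizontal edges for
`R`, the vertical ones for `L`), a flag from which one turns upwards. -/
def Letter.upward : Letter → Equiv.Perm (Fin 4)
  | .R => Equiv.swap 2 0 * Equiv.swap 2 3
  | .L => Equiv.swap 1 2 * Equiv.swap 2 3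

/-- The type of the edges of the unit square that the letter fixes. -/
def Letter.fixedType : Letter → Fin 3
  | .R => 2
  | .L => 1

theorem sign_upward (b : Letter) : Equiv.Perm.sign b.upward = 1 := by
  cases b <;> decide

theorem edgeType_upward (b : Letter) :
    edgeType (b.upward 0) (b.upward 1) = b.fixedType := by
  cases b <;> decide

theorem halfTurn_mul_upward_mul_halfTurn_ne (b : Letter) :
    halfTurn * b.upward * halfTurn ≠ b.upward := by
  cases b <;> decide

theorem perm_cases_of_edgeType_eq_fixedType (b : Letter) {π : Equiv.Perm (Fin 4)}
    (hsign : Equiv.Perm.sign π = 1) (htype : edgeType (π 0) (π 1) = b.fixedType) :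
    π = b.upward ∨ π = halfTurn * b.upward ∨ π = b.upward * halfTurn ∨
      π = halfTurn * (b.upward * halfTurn) := by
  cases b <;> revert π <;> decide

theorem two_le_upward {b : Letter} {π : Equiv.Perm (Fin 4)}
    (hπ : π = b.upward ∨ π = halfTurn * b.upward) : 2 ≤ π 2 := by
  cases b <;> revert π <;> decide

theorem upPerm_upward_self (b : Letter) {h : Equiv.Perm (Fin 4)} (hh : h = 1 ∨ h = halfTurn)
    {π : Equiv.Perm (Fin 4)} (hπ : π = b.upward ∨ π = halfTurn * b.upward) :
    upPerm b h (π 2) * π * Equiv.swap 2 3 = b.upward ∨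
      upPerm b h (π 2) * π * Equiv.swap 2 3 = halfTurn * b.upward := by
  rcases hh with rfl | rfl <;> cases b <;> revert π <;> decide

theorem upPerm_upward_of_ne {a b : Letter} (hab : a ≠ b) {h : Equiv.Perm (Fin 4)}
    (hh : h = 1 ∨ h = halfTurn) {π : Equiv.Perm (Fin 4)}
    (hπ : π = b.upward ∨ π = halfTurn * b.upward) :
    halfTurn * (upPerm a h (π 2) * π * Equiv.swap 2 3) * halfTurn =
      upPerm a h (π 2) * π * Equiv.swap 2 3 := by
  rcases hh with rfl | rfl <;> cases a <;> cases b <;>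
    first
      | exact absurd rfl hab
      | (clear hab; revert π; decide)

theorem two_le_halfTurn_iff (f : Fin 4) : 2 ≤ halfTurn f ↔ 2 ≤ f := by
  revert f
  decide

theorem upPerm_halfTurn_mul (a : Letter) {h : Equiv.Perm (Fin 4)} (hh : h = 1 ∨ h = halfTurn)
    (f : Fin 4) : upPerm a h (halfTurn f) * halfTurn = halfTurn * upPerm a h f := by
  rcases hh with rfl | rfl <;> cases a <;> revert f <;> decide

theorem downPerm_halfTurn_mul (a : Letter) {h : Equiv.Perm (Fin 4)} (hh : h = 1 ∨ h = halfTurn)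
    (f : Fin 4) : downPerm a h (halfTurn f) * halfTurn = halfTurn * downPerm a h f := by
  rcases hh with rfl | rfl <;> cases a <;> revert f <;> decide

end Letters

section NegativeFlags

variable {n : ℕ}

/-- The letter that fixes the edges of negative shape parameter of a tetrahedron whose shape
parameter `z` at the diagonals is positive. -/
def negLetter (z : ℝ) : Letter := if 1 < z then .L else .R

theorem typeShape_neg_iff {z : ℝ} (h0 : 0 < z) (h1 : z ≠ 1) (i : Fin 3) :
    typeShape z i < 0 ↔ i = (negLetter z).fixedType := by
  rcases lt_or_gt_of_ne h1 with h | h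
  · have hneg : (z - 1) * z⁻¹ < 0 := mul_neg_of_neg_of_pos (sub_neg.2 h) (inv_pos.2 h0)
    fin_cases i <;> simp [typeShape, negLetter, Letter.fixedType, h.not_gt, h0.le, hneg]
  · fin_cases i <;> simp [typeShape, negLetter, Letter.fixedType, h, h0.le]

/-- A flag at an edge of negative shape parameter from which one turns upwards. -/
def upFlag (z : Fin n → ℝ) (j : Fin n) : IdealTriangulation.Flag n :=
  (j, (negLetter (z j)).upward)

theorem sign_upFlag (z : Fin n → ℝ) (j : Fin n) : Equiv.Perm.sign (upFlag z j).2 = 1 :=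
  sign_upward _

theorem flagType_upFlag (z : Fin n → ℝ) (j : Fin n) :
    flagType (upFlag z j) = (negLetter (z j)).fixedType :=
  edgeType_upward _

theorem flagShape_upFlag_neg {z : Fin n → ℝ} (h0 : ∀ j, 0 < z j) (h1 : ∀ j, z j ≠ 1)
    (j : Fin n) : flagShape z (upFlag z j) < 0 := by
  rw [flagShape_eq_typeShape, typeShape_neg_iff (h0 _) (h1 _), flagType_upFlag]
  rfl

theorem flag_cases_of_flagShape_neg {z : Fin n → ℝ} (h0 : ∀ j, 0 < z j) (h1 : ∀ j, z j ≠ 1)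
    {x : IdealTriangulation.Flag n} (hx : Equiv.Perm.sign x.2 = 1) (hneg : flagShape z x < 0) :
    x = upFlag z x.1 ∨ x = halfTurnFlag (upFlag z x.1) ∨ x = reverseFlag (upFlag z x.1) ∨
      x = halfTurnFlag (reverseFlag (upFlag z x.1)) := by
  rw [flagShape_eq_typeShape, typeShape_neg_iff (h0 _) (h1 _)] at hneg
  rcases perm_cases_of_edgeType_eq_fixedType _ hx hneg with h | h | h | h
  · exact Or.inl (Prod.ext rfl h)
  · exact Or.inr (Or.inl (Prod.ext rfl h))
  · exact Or.inr (Or.inr (Or.inl (Prod.ext rfl h)))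
  · exact Or.inr (Or.inr (Or.inr (Prod.ext rfl h)))

theorem reverseFlag_halfTurnFlag_upFlag_ne (z : Fin n → ℝ) (j : Fin n) :
    reverseFlag (halfTurnFlag (upFlag z j)) ≠ upFlag z j :=
  fun h => halfTurn_mul_upward_mul_halfTurn_ne _ (congrArg Prod.snd h)

theorem flagShape_reverseFlag_halfTurnFlag (z : Fin n → ℝ) (x : IdealTriangulation.Flag n) :
    flagShape z (reverseFlag (halfTurnFlag x)) = flagShape z x := by
  rw [flagShape_eq_typeShape, flagType_reverseFlag, flagType_halfTurnFlag, flagShape_eq_typeShape]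
  rfl

end NegativeFlags

section Monodromy

theorem forall_of_finRotate {n : ℕ} {S : Fin n → Prop} (h : ∀ k, S k → S (finRotate n k))
    {k : Fin n} (hk : S k) (l : Fin n) : S l := by
  have hpow (i : ℕ) : S ((finRotate n ^ i) k) := by
    induction i with
    | zero => exact hk
    | succ i ih => exact pow_succ' (finRotate n) i ▸ h _ ih
  rcases le_or_gt 2 n with hn | hn
  · have hmove (x : Fin n) : finRotate n x ≠ x := by
      rw [← Equiv.Perm.mem_support, support_finRotate_of_le hn]
      exact Finset.mem_univ x
    obtain ⟨i, rfl⟩ := (isCycle_finRotate_of_le hn).exists_pow_eq (hmove k) (hmove l)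
    exact hpow i
  · have : Subsingleton (Fin n) := Fin.subsingleton_iff_le_one.2 (by omega)
    exact Subsingleton.elim k l ▸ hk

variable {w : List Letter} {ε : ℤˣ}

local notation "𝒯" => monodromyTriangulation w ε

theorem turn_halfTurnFlag (x : IdealTriangulation.Flag w.length) :
    (𝒯).turn (halfTurnFlag x) = halfTurnFlag ((𝒯).turn x) := by
  refine Prod.ext ?_ ?_
  · change (𝒯).nbr x.1 (halfTurn (x.2 2)) = (𝒯).nbr x.1 (x.2 2)
    simp only [monodromyTriangulation, two_le_halfTurn_iff]
  · change (𝒯).perm x.1 (halfTurn (x.2 2)) * (halfTurn * x.2) * Equiv.swap 2 3 =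
      halfTurn * ((𝒯).perm x.1 (x.2 2) * x.2 * Equiv.swap 2 3)
    rw [← mul_assoc]
    simp only [monodromyTriangulation, two_le_halfTurn_iff]
    split_ifs
    · rw [upPerm_halfTurn_mul _ (layerTurn_cases w ε _)]
      simp only [mul_assoc]
    · rw [downPerm_halfTurn_mul _ (layerTurn_cases w ε _)]
      simp only [mul_assoc]

theorem sameCycle_halfTurnFlag {x y : IdealTriangulation.Flag w.length}
    (h : (turnPerm 𝒯).SameCycle x y) :
    (turnPerm 𝒯).SameCycle (halfTurnFlag x) (halfTurnFlag y) := by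
  have hconj : halfTurnFlag * turnPerm 𝒯 * halfTurnFlag⁻¹ = turnPerm 𝒯 := by
    rw [mul_inv_eq_iff_eq_mul]
    ext1 x
    exact (turn_halfTurnFlag x).symm
  simpa only [hconj] using h.conj (g := halfTurnFlag)

theorem turn_of_two_le {x : IdealTriangulation.Flag w.length} (h : 2 ≤ x.2 2) :
    (𝒯).turn x = (finRotate _ x.1,
      upPerm w[x.1] (layerTurn w ε x.1) (x.2 2) * x.2 * Equiv.swap 2 3) := by
  simp [IdealTriangulation.turn, monodromyTriangulation, h]

theorem sameCycle_upPerm {b : Letter} {x : IdealTriangulation.Flag w.length} {l : Fin w.length}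
    {π : Equiv.Perm (Fin 4)} (hπ : π = b.upward ∨ π = halfTurn * b.upward)
    (h : (turnPerm 𝒯).SameCycle x (l, π)) :
    (turnPerm 𝒯).SameCycle x
      (finRotate _ l, upPerm w[l] (layerTurn w ε l) (π 2) * π * Equiv.swap 2 3) := by
  rw [← turn_of_two_le (x := (l, π)) (two_le_upward hπ)]
  exact h.trans Equiv.Perm.SameCycle.rfl.apply_right

-- An edge that the letter `b` fixes climbs through the layers until the first letter other than
-- `b`, where it becomes a diagonal.
theorem exists_sameCycle_upward_diagonal (b : Letter) (hb : ∃ k : Fin w.length, w[k] ≠ b)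
    (k : Fin w.length) :
    ∃ y, (turnPerm 𝒯).SameCycle (k, b.upward) y ∧ halfTurn * y.2 * halfTurn = y.2 := by
  by_contra! hdiag
  have hletter (l π) (hπ : π = b.upward ∨ π = halfTurn * b.upward)
      (hs : (turnPerm 𝒯).SameCycle (k, b.upward) (l, π)) : w[l] = b := by
    by_contra hne
    exact hdiag _ (sameCycle_upPerm hπ hs) (upPerm_upward_of_ne hne (layerTurn_cases w ε l) hπ)
  have hclimb (l) : ∃ π, (π = b.upward ∨ π = halfTurn * b.upward) ∧
      (turnPerm 𝒯).SameCycle (k, b.upward) (l, π) := by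
    refine forall_of_finRotate (S := fun l => ∃ π, (π = b.upward ∨ π = halfTurn * b.upward) ∧
      (turnPerm 𝒯).SameCycle (k, b.upward) (l, π)) ?_
      ⟨_, Or.inl rfl, Equiv.Perm.SameCycle.rfl⟩ l
    rintro l ⟨π, hπ, hs⟩
    refine ⟨_, ?_, sameCycle_upPerm hπ hs⟩
    rw [hletter l π hπ hs]
    exact upPerm_upward_self b (layerTurn_cases w ε l) hπ
  obtain ⟨l, hl⟩ := hb
  obtain ⟨π, hπ, hs⟩ := hclimb l
  exact hl (hletter l π hπ hs)

theorem sameCycle_upFlag_reverseFlag_halfTurnFlag (hw : ∀ b, ∃ k : Fin w.length, w[k] ≠ b)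
    (z : Fin w.length → ℝ) (j : Fin w.length) :
    (turnPerm 𝒯).SameCycle (upFlag z j) (reverseFlag (halfTurnFlag (upFlag z j))) := by
  obtain ⟨y, hy, hdiag⟩ :=
    exists_sameCycle_upward_diagonal (ε := ε) (negLetter (z j)) (hw _) j
  have hfix : reverseFlag (halfTurnFlag y) = y := Prod.ext rfl hdiag
  have hsymm := sameCycle_reverseFlag (sameCycle_halfTurnFlag hy)
  rw [hfix] at hsymm
  exact hy.trans hsymm.symm

@[to_additive]
theorem prod_edgeCycle_eq_of_flagShape_neg {M : Type*} [CommMonoid M] {z : Fin w.length → ℝ}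
    (h0 : ∀ j, 0 < z j) (h1 : ∀ j, z j ≠ 1) (f : Fin w.length → Fin 3 → M)
    {x : IdealTriangulation.Flag w.length} (hx : Equiv.Perm.sign x.2 = 1)
    (hneg : flagShape z x < 0) :
    ∏ y ∈ edgeCycle 𝒯 x, f y.1 (flagType y) =
      ∏ y ∈ edgeCycle 𝒯 (upFlag z x.1), f y.1 (flagType y) := by
  have hhalf (u) := prod_edgeCycle_of_involutive (T := 𝒯) (g := halfTurnFlag)
    halfTurnFlag.left_inv (fun _ _ => sameCycle_halfTurnFlag)
    (f := fun y => f y.1 (flagType y)) (fun y => by rw [flagType_halfTurnFlag]; rfl) u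
  have hrev (u) := prod_edgeCycle_of_involutive (T := 𝒯) (g := reverseFlag)
    reverseFlag.left_inv (fun _ _ => sameCycle_reverseFlag)
    (f := fun y => f y.1 (flagType y)) (fun y => by rw [flagType_reverseFlag]; rfl) u
  rcases flag_cases_of_flagShape_neg h0 h1 hx hneg with h | h | h | h
  · conv_lhs => rw [h]
  · conv_lhs => rw [h, hhalf]
  · conv_lhs => rw [h, hrev]
  · conv_lhs => rw [h, hhalf, hrev]

-- The edge has exactly two negative flags, and these two already belong to the tetrahedron `j`.
theorem fst_eq_of_mem_edgeCycle_upFlag (hw : ∀ b, ∃ k : Fin w.length, w[k] ≠ b)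
    {z : Fin w.length → ℝ} (hz : z ∈ canonicalComponents w ε)
    {j : Fin w.length} {x : IdealTriangulation.Flag w.length}
    (hx : x ∈ edgeCycle 𝒯 (upFlag z j)) (hneg : flagShape z x < 0) : x.1 = j := by
  obtain ⟨⟨h01, hT⟩, hpos⟩ := hz
  have hcard := card_filter_flagShape_neg (fun j => (h01 j).1) (fun j => (h01 j).2)
    (hT _ (sign_upFlag z j)).2
  have hneg_up := flagShape_upFlag_neg hpos (fun j => (h01 j).2) j
  set u := reverseFlag (halfTurnFlag (upFlag z j))
  have hsub : ({upFlag z j, u} : Finset _) ⊆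
      (edgeCycle 𝒯 (upFlag z j)).filter fun y => flagShape z y < 0 := by
    intro v hv
    rw [Finset.mem_insert, Finset.mem_singleton] at hv
    rw [Finset.mem_filter, mem_edgeCycle]
    rcases hv with rfl | rfl
    · exact ⟨Equiv.Perm.SameCycle.rfl, hneg_up⟩
    · exact ⟨sameCycle_upFlag_reverseFlag_halfTurnFlag hw z j,
        by rwa [flagShape_reverseFlag_halfTurnFlag]⟩
  have heq := Finset.eq_of_subset_of_card_le hsub
    (by rw [hcard, Finset.card_pair (reverseFlag_halfTurnFlag_upFlag_ne z j).symm])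
  have hmem : x ∈ ({upFlag z j, u} : Finset _) := heq ▸ Finset.mem_filter.2 ⟨hx, hneg⟩
  rw [Finset.mem_insert, Finset.mem_singleton] at hmem
  rcases hmem with rfl | rfl <;> rfl

end Monodromy

/-! ### Curves of solutions -/

section Generators

variable {ι 𝕜 : Type*} [RCLike 𝕜] {K : ι → ι → ℝ} {m : ι → ℕ}

/-- An irreducible Markov generator `K` with weights `m`: nonnegative off the diagonal, with zero
`m`-weighted column sums, and such that the graph of its positive off-diagonal entries is strongly
connected (stated as the absence of proper nonempty absorbing sets). It plays the role of the
Jacobian of the logarithmic edge equations. -/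
structure IsGenerator [Fintype ι] (K : ι → ι → ℝ) (m : ι → ℕ) : Prop where
  weight_pos : ∀ j, 0 < m j
  off_diag : ∀ j l, j ≠ l → 0 ≤ K j l
  column_sum : ∀ l, ∑ j, (m j : ℝ) * K j l = 0
  irreducible : ∀ S : ι → Prop, (∀ j, S j → ∀ l, j ≠ l → 0 < K j l → S l) →
    ∀ j, S j → ∀ l, S l

namespace IsGenerator

variable [Fintype ι]

theorem sum_weight_mul_eq_zero (hK : IsGenerator K m) (q : ι → 𝕜) :
    ∑ j, (m j : 𝕜) * ∑ l, (K j l : 𝕜) * q l = 0 := by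
  have column_sum (l) : ∑ j, (m j : 𝕜) * (K j l : 𝕜) = 0 := by
    exact_mod_cast congrArg (RCLike.ofReal : ℝ → 𝕜) (hK.column_sum l)
  simp only [Finset.mul_sum, ← mul_assoc]
  rw [Finset.sum_comm]
  simp only [← Finset.sum_mul, column_sum, zero_mul, Finset.sum_const_zero]

theorem sum_mul_norm_nonneg (hK : IsGenerator K m) {p : ι → 𝕜} {j : ι}
    (hp : ∑ l, (K j l : 𝕜) * p l = 0) : 0 ≤ ∑ l, K j l * ‖p l‖ := by
  classical
  rw [← Finset.add_sum_erase _ _ (Finset.mem_univ j)] at hp ⊢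
  have off_diag (l) (hl : l ∈ Finset.univ.erase j) : 0 ≤ K j l :=
    hK.off_diag j l (Finset.ne_of_mem_erase hl).symm
  suffices -(K j j * ‖p j‖) ≤ ∑ l ∈ Finset.univ.erase j, K j l * ‖p l‖ by linarith
  calc -(K j j * ‖p j‖) ≤ ‖(K j j : 𝕜) * p j‖ := by
        rw [norm_mul, RCLike.norm_ofReal, ← neg_mul]
        gcongr
        exact neg_le_abs _
    _ = ‖∑ l ∈ Finset.univ.erase j, (K j l : 𝕜) * p l‖ := by
        rw [eq_neg_of_add_eq_zero_left hp, norm_neg]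
    _ ≤ ∑ l ∈ Finset.univ.erase j, K j l * ‖p l‖ :=
        norm_sum_le_of_le _ fun l hl => by
          rw [norm_mul, RCLike.norm_ofReal, abs_of_nonneg (off_diag l hl)]

theorem sum_mul_norm_eq_zero (hK : IsGenerator K m) {p : ι → 𝕜}
    (hp : ∀ j, ∑ l, (K j l : 𝕜) * p l = 0) (j : ι) : ∑ l, K j l * ‖p l‖ = 0 := by
  have total : ∑ j, (m j : ℝ) * ∑ l, K j l * ‖p l‖ = 0 :=
    hK.sum_weight_mul_eq_zero fun l => ‖p l‖
  have summand : (m j : ℝ) * ∑ l, K j l * ‖p l‖ = 0 :=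
    (Finset.sum_eq_zero_iff_of_nonneg fun j _ =>
      mul_nonneg (Nat.cast_nonneg _) (hK.sum_mul_norm_nonneg (hp j))).1 total j (Finset.mem_univ j)
  exact (mul_eq_zero.1 summand).resolve_left (Nat.cast_ne_zero.2 (hK.weight_pos j).ne')

theorem eq_zero_of_apply_eq_zero (hK : IsGenerator K m) {p : ι → 𝕜}
    (hp : ∀ j, ∑ l, (K j l : 𝕜) * p l = 0) {i : ι} (hi : p i = 0) : p = 0 := by
  classical
  funext l
  refine hK.irreducible (fun l => p l = 0) (fun j hj l hjl hpos => ?_) i hi l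
  have sum_erase := hK.sum_mul_norm_eq_zero hp j
  rw [← Finset.add_sum_erase _ _ (Finset.mem_univ j), hj, norm_zero, mul_zero, zero_add]
    at sum_erase
  have summand : K j l * ‖p l‖ = 0 :=
    (Finset.sum_eq_zero_iff_of_nonneg fun l hl =>
      mul_nonneg (hK.off_diag j l (Finset.ne_of_mem_erase hl).symm) (norm_nonneg _)).1 sum_erase l
        (Finset.mem_erase.2 ⟨hjl.symm, Finset.mem_univ l⟩)
  exact norm_eq_zero.1 ((mul_eq_zero.1 summand).resolve_left hpos.ne')

variable [Nonempty ι]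

theorem exists_kernel_ne_zero (hK : IsGenerator K m) :
    ∃ p : ι → ℝ, p ≠ 0 ∧ ∀ j, ∑ l, K j l * p l = 0 := by
  classical
  have hdet : (Matrix.of K).det = 0 := by
    refine Matrix.exists_vecMul_eq_zero_iff.1 ⟨fun j => m j, fun hzero => ?_, ?_⟩
    · obtain ⟨j⟩ := ‹Nonempty ι›
      exact (hK.weight_pos j).ne' (Nat.cast_eq_zero.1 (congrFun hzero j))
    · exact funext hK.column_sum
  obtain ⟨p, hp0, hp⟩ := Matrix.exists_mulVec_eq_zero_iff.2 hdet
  exact ⟨p, hp0, congrFun hp⟩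

theorem exists_pos_kernel (hK : IsGenerator K m) :
    ∃ p : ι → ℝ, (∀ j, 0 < p j) ∧ ∑ j, p j = 1 ∧ ∀ j, ∑ l, K j l * p l = 0 := by
  obtain ⟨p, hp0, hp⟩ := hK.exists_kernel_ne_zero
  have hpos (j) : 0 < ‖p j‖ :=
    norm_pos_iff.2 fun hj => hp0 (hK.eq_zero_of_apply_eq_zero hp hj)
  have hsum : 0 < ∑ j, ‖p j‖ := Finset.sum_pos (fun j _ => hpos j) Finset.univ_nonempty
  refine ⟨fun j => ‖p j‖ / ∑ i, ‖p i‖, fun j => div_pos (hpos j) hsum, ?_, fun j => ?_⟩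
  · rw [← Finset.sum_div, div_self hsum.ne']
  · simp only [← mul_div_assoc]
    rw [← Finset.sum_div, hK.sum_mul_norm_eq_zero hp, zero_div]

theorem sum_eq_zero (hK : IsGenerator K m) {q : ι → 𝕜}
    (hq : ∀ j, ∑ l, (K j l : 𝕜) * q l + ∑ l, q l = 0) : ∑ l, q l = 0 := by
  have hweights : ((∑ j, m j : ℕ) : 𝕜) ≠ 0 :=
    Nat.cast_ne_zero.2 (Finset.sum_pos (fun j _ => hK.weight_pos j) Finset.univ_nonempty).ne'
  refine (mul_eq_zero.1 ?_).resolve_left hweights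
  calc ((∑ j, m j : ℕ) : 𝕜) * ∑ l, q l
      = ∑ j, (m j : 𝕜) * (∑ l, (K j l : 𝕜) * q l + ∑ l, q l) := by
        simp only [mul_add, Finset.sum_add_distrib]
        rw [hK.sum_weight_mul_eq_zero, zero_add, ← Finset.sum_mul, Nat.cast_sum]
    _ = 0 := by simp only [hq, mul_zero, Finset.sum_const_zero]

theorem eq_zero_of_sum_add_sum_eq_zero (hK : IsGenerator K m) {q : ι → 𝕜}
    (hq : ∀ j, ∑ l, (K j l : 𝕜) * q l + ∑ l, q l = 0) : q = 0 := by
  have hsum := hK.sum_eq_zero hq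
  obtain ⟨p, hpos, hp1, hker⟩ := hK.exists_pos_kernel
  obtain ⟨i⟩ := ‹Nonempty ι›
  have hpi : (p i : 𝕜) ≠ 0 := RCLike.ofReal_ne_zero.2 (hpos i).ne'
  have hp1 : ∑ l, (p l : 𝕜) = 1 := by exact_mod_cast congrArg (RCLike.ofReal : ℝ → 𝕜) hp1
  have hker (j) : ∑ l, (K j l : 𝕜) * (p l : 𝕜) = 0 := by
    exact_mod_cast congrArg (RCLike.ofReal : ℝ → 𝕜) (hker j)
  have proportional : (fun l => q l - q i / p i * p l) = 0 := by
    refine hK.eq_zero_of_apply_eq_zero (i := i) (fun j => ?_) (by simp [hpi])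
    simp only [mul_sub, Finset.sum_sub_distrib, mul_left_comm _ (q i / p i)]
    rw [← Finset.mul_sum, hker, mul_zero, sub_zero]
    simpa only [hsum, add_zero] using hq j
  have hq_eq (l) : q l = q i / p i * p l := sub_eq_zero.1 (congrFun proportional l)
  have hratio : q i / p i = 0 := by
    rw [← hsum, Finset.sum_congr rfl fun l _ => hq_eq l, ← Finset.mul_sum, hp1, mul_one]
  funext l
  rw [hq_eq, hratio, zero_mul, Pi.zero_apply]

theorem exists_continuousLinearEquiv (𝕜 : Type*) [RCLike 𝕜] (hK : IsGenerator K m) :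
    ∃ E : (ι → 𝕜) ≃L[𝕜] (ι → 𝕜), ∀ q j, E q j = ∑ l, (K j l : 𝕜) * q l + ∑ l, q l := by
  let D : (ι → 𝕜) →ₗ[𝕜] (ι → 𝕜) := LinearMap.pi fun j =>
    ∑ l, (K j l : 𝕜) • LinearMap.proj l + ∑ l, LinearMap.proj l
  have hD (q : ι → 𝕜) (j : ι) : D q j = ∑ l, (K j l : 𝕜) * q l + ∑ l, q l := by
    simp only [D, LinearMap.pi_apply, LinearMap.add_apply, LinearMap.sum_apply,
      LinearMap.smul_apply, LinearMap.proj_apply, smul_eq_mul]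
  have hinj : Function.Injective D := (injective_iff_map_eq_zero D).2 fun q hq =>
    hK.eq_zero_of_sum_add_sum_eq_zero fun j => by rw [← hD, hq, Pi.zero_apply]
  exact ⟨(LinearEquiv.ofInjectiveEndo D hinj).toContinuousLinearEquiv, hD⟩

end IsGenerator

end Generators

section Curves

variable {𝕜 E : Type*} [RCLike 𝕜] [NormedAddCommGroup E] [NormedSpace 𝕜 E]

theorem eventually_eq_zero_of_one_add_pow_eq_one {M : ℕ} (hM : M ≠ 0) :
    ∀ᶠ x in 𝓝 (0 : 𝕜), (1 + x) ^ M = 1 → x = 0 := by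
  have hder : HasDerivAt (fun x : 𝕜 => (1 + x) ^ M) (M : 𝕜) 0 := by
    simpa using ((hasDerivAt_id (0 : 𝕜)).const_add 1).fun_pow M
  filter_upwards [eventually_nhdsWithin_iff.1 (hder.eventually_ne (c := 1) (Nat.cast_ne_zero.2 hM))]
    with x hx hx1
  by_contra hne
  exact hx hne hx1

theorem exists_curve_of_hasStrictFDerivAt_equiv {E' : Type*} [NormedAddCommGroup E']
    [NormedSpace 𝕜 E'] [CompleteSpace E] {Φ : E → E'} {D : E ≃L[𝕜] E'} {z : E}
    (hΦ : HasStrictFDerivAt Φ (D : E →L[𝕜] E') z) (v : E') :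
    ∃ Z : 𝕜 → E, Z 0 = z ∧ HasDerivAt Z (D.symm v) 0 ∧
      (∀ᶠ s in 𝓝 (0 : 𝕜), ContinuousAt Z s) ∧ ∀ᶠ s in 𝓝 (0 : 𝕜), Φ (Z s) = Φ z + s • v := by
  let line : 𝕜 → E' := fun s => Φ z + s • v
  have line_zero : line 0 = Φ z := by simp [line]
  have line_continuous : Continuous line := by fun_prop
  have hline : HasDerivAt line v 0 := by
    simpa only [one_smul] using! ((hasDerivAt_id (0 : 𝕜)).smul_const v).const_add (Φ z)
  let chart := hΦ.toOpenPartialHomeomorph Φ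
  have tendsto_line : Tendsto line (𝓝 0) (𝓝 (Φ z)) := line_zero ▸ line_continuous.tendsto 0
  refine ⟨fun s => hΦ.localInverse Φ D z (line s), ?_, ?_, ?_, ?_⟩
  · simp only [line_zero, hΦ.localInverse_apply_image]
  · exact (line_zero ▸ hΦ.to_localInverse.hasFDerivAt).comp_hasDerivAt 0 hline
  · have hmem : line 0 ∈ chart.target :=
      line_zero ▸ hΦ.image_mem_toOpenPartialHomeomorph_target
    filter_upwards [(chart.open_target.preimage line_continuous).mem_nhds hmem] with s hs
    exact (chart.continuousAt_symm hs).comp line_continuous.continuousAt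
  · exact tendsto_line.eventually hΦ.eventually_right_inverse

-- Adding the sum of the coordinates to every equation makes the derivative invertible. Along the
-- curve on which all modified equations increase at unit speed, the values `F j` agree, and their
-- weighted product pins the common value to `1`.
theorem exists_curve_of_isGenerator {ι : Type*} [Fintype ι] [Nonempty ι] {K : ι → ι → ℝ}
    {m : ι → ℕ} (hK : IsGenerator K m) {F : ι → (ι → 𝕜) → 𝕜} {z : ι → 𝕜}
    (hF : ∀ j, HasStrictFDerivAt (F j)
      (∑ l, (K j l : 𝕜) • ContinuousLinearMap.proj (R := 𝕜) (φ := fun _ : ι => 𝕜) l) z)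
    (h1 : ∀ j, F j z = 1) (hprod : ∀ᶠ x in 𝓝 z, ∏ j, F j x ^ m j = 1) :
    ∃ (Z : 𝕜 → ι → 𝕜) (p : ι → ℝ), Z 0 = z ∧ (∀ j, 0 < p j) ∧
      (∀ j, HasDerivAt (fun s => Z s j) (p j : 𝕜) 0) ∧
      (∀ᶠ s in 𝓝 (0 : 𝕜), ContinuousAt Z s) ∧ ∀ᶠ s in 𝓝 (0 : 𝕜), ∀ j, F j (Z s) = 1 := by
  obtain ⟨p, hpos, hp1, hker⟩ := hK.exists_pos_kernel
  obtain ⟨D, hD⟩ := hK.exists_continuousLinearEquiv 𝕜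
  let total : (ι → 𝕜) →L[𝕜] 𝕜 :=
    ∑ l, ContinuousLinearMap.proj (R := 𝕜) (φ := fun _ : ι => 𝕜) l
  let Φ : (ι → 𝕜) → (ι → 𝕜) := fun x j => F j x + total x
  have hΦ : HasStrictFDerivAt Φ (D : (ι → 𝕜) →L[𝕜] (ι → 𝕜)) z := by
    refine hasStrictFDerivAt_pi'.2 fun j => ((hF j).add total.hasStrictFDerivAt).congr_fderiv ?_
    ext q
    simp [hD, total]
  have velocity : D.symm (fun _ => 1) = fun j => (p j : 𝕜) := by
    rw [ContinuousLinearEquiv.symm_apply_eq]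
    funext j
    rw [hD]
    exact_mod_cast congrArg (RCLike.ofReal : ℝ → 𝕜) (by rw [hker, hp1, zero_add] :
      (1 : ℝ) = ∑ l, K j l * p l + ∑ l, p l)
  obtain ⟨Z, hZ0, hder, hcont, hsol⟩ := exists_curve_of_hasStrictFDerivAt_equiv hΦ fun _ => 1
  refine ⟨Z, p, hZ0, hpos, hasDerivAt_pi.1 (velocity ▸ hder), hcont, ?_⟩
  have tendsto_Z : Tendsto Z (𝓝 0) (𝓝 z) := hZ0 ▸ hder.continuousAt
  let error : 𝕜 → 𝕜 := fun s => s - (total (Z s) - total z)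
  have tendsto_error : Tendsto error (𝓝 0) (𝓝 0) := by
    simpa using tendsto_id.sub (((total.continuous.tendsto z).comp tendsto_Z).sub_const (total z))
  have hweights : ∑ j, m j ≠ 0 :=
    (Finset.sum_pos (fun j _ => hK.weight_pos j) Finset.univ_nonempty).ne'
  filter_upwards [hsol, tendsto_Z.eventually hprod, tendsto_error.eventually
    (eventually_eq_zero_of_one_add_pow_eq_one hweights)] with s hs hs_prod hs_error j
  have common_value (j : ι) : F j (Z s) = 1 + error s := by
    have hj : F j (Z s) + total (Z s) = F j z + total z + s * 1 := congrFun hs j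
    linear_combination hj + h1 j
  rw [common_value, hs_error, add_zero]
  rw [← Finset.prod_pow_eq_pow_sum]
  simpa only [common_value] using hs_prod

theorem hasStrictFDerivAt_prod_of_log {α : Type*} (s : Finset α) {f : α → E → 𝕜}
    {g : α → E →L[𝕜] 𝕜} {x : E} (h : ∀ i ∈ s, HasStrictFDerivAt (f i) (f i x • g i) x) :
    HasStrictFDerivAt (fun y => ∏ i ∈ s, f i y) ((∏ i ∈ s, f i x) • ∑ i ∈ s, g i) x := by
  classical
  refine (HasStrictFDerivAt.finsetProd h).congr_fderiv ?_
  rw [Finset.smul_sum]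
  refine Finset.sum_congr rfl fun i hi => ?_
  rw [smul_smul, Finset.prod_erase_mul _ _ hi]

end Curves

/-! ### Logarithmic derivatives of the edge equations -/

section ShapeFunctions

variable {A A' : Type} [CommRing A] [CommRing A'] (φ : A →+* A')

theorem map_ringInverse_of_isUnit {a : A} (h : IsUnit a) :
    φ (Ring.inverse a) = Ring.inverse (φ a) := by
  refine (h.map φ).mul_left_cancel ?_
  rw [Ring.mul_inverse_cancel _ (h.map φ), ← map_mul, Ring.mul_inverse_cancel _ h, map_one]

theorem map_typeShape {z : A} (h0 : IsUnit z) (h1 : IsUnit (1 - z)) (i : Fin 3) :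
    φ (typeShape z i) = typeShape (φ z) i := by
  fin_cases i
  · rfl
  · simp [typeShape, map_ringInverse_of_isUnit φ h1]
  · simp [typeShape, map_ringInverse_of_isUnit φ h0]

theorem map_partialHolonomy {n : ℕ} {T : IdealTriangulation n} {z : Fin n → A}
    (h0 : ∀ j, IsUnit (z j)) (h1 : ∀ j, IsUnit (1 - z j)) (x : IdealTriangulation.Flag n) (k : ℕ) :
    φ (partialHolonomy T z x k) = partialHolonomy T (fun j => φ (z j)) x k := by
  unfold partialHolonomy
  rw [map_prod]
  refine Finset.prod_congr rfl fun i _ => ?_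
  rw [edgeShape_eq_typeShape, edgeShape_eq_typeShape, map_typeShape φ (h0 _) (h1 _)]

theorem typeShape_mul_typeShape_mul_typeShape {K : Type} [Field K] {z : K} (h0 : z ≠ 0)
    (h1 : z ≠ 1) : typeShape z 0 * typeShape z 1 * typeShape z 2 = -1 := by
  have h1z : 1 - z ≠ 0 := sub_ne_zero.2 h1.symm
  change z * Ring.inverse (1 - z) * ((z - 1) * Ring.inverse z) = -1
  rw [Ring.inverse_eq_inv']
  field_simp
  ring

/-- The logarithmic derivatives of the three shape parameters of a tetrahedron. -/
def typeDlog (z : ℝ) : Fin 3 → ℝ := ![z⁻¹, (1 - z)⁻¹, (z * (z - 1))⁻¹]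

theorem typeDlog_add_typeDlog_add_typeDlog {z : ℝ} (h0 : z ≠ 0) (h1 : z ≠ 1) :
    typeDlog z 0 + typeDlog z 1 + typeDlog z 2 = 0 := by
  have h1z : 1 - z ≠ 0 := sub_ne_zero.2 h1.symm
  have hz1 : z - 1 ≠ 0 := sub_ne_zero.2 h1
  change z⁻¹ + (1 - z)⁻¹ + (z * (z - 1))⁻¹ = 0
  field_simp
  ring

theorem typeDlog_pos {z : ℝ} (h0 : 0 < z) (h1 : z ≠ 1) {i : Fin 3} (h : ¬ typeShape z i < 0) :
    0 < typeDlog z i := by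
  rw [typeShape_neg_iff h0 h1] at h
  rcases lt_or_gt_of_ne h1 with hz | hz
  · have hneg : negLetter z = .R := if_neg hz.not_gt
    fin_cases i
    · simpa [typeDlog] using h0
    · simpa [typeDlog] using hz
    · exact absurd (by rw [hneg]; rfl) h
  · have hneg : negLetter z = .L := if_pos hz
    fin_cases i
    · simpa [typeDlog] using h0
    · exact absurd (by rw [hneg]; rfl) h
    · exact inv_pos.2 (mul_pos h0 (sub_pos.2 hz))

theorem hasStrictDerivAt_typeShape {𝕜 : Type} [RCLike 𝕜] {z : ℝ} (h0 : z ≠ 0) (h1 : z ≠ 1)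
    (i : Fin 3) : HasStrictDerivAt (fun x : 𝕜 => typeShape x i)
      (typeShape (z : 𝕜) i * (typeDlog z i : ℝ)) (z : 𝕜) := by
  have z_ne_zero : (z : 𝕜) ≠ 0 := by exact_mod_cast h0
  have z_ne_one : (z : 𝕜) ≠ 1 := by exact_mod_cast h1
  have one_sub_ne_zero : 1 - (z : 𝕜) ≠ 0 := sub_ne_zero.2 z_ne_one.symm
  have sub_one_ne_zero : (z : 𝕜) - 1 ≠ 0 := sub_ne_zero.2 z_ne_one
  have hid : HasStrictDerivAt (fun x : 𝕜 => x) 1 (z : 𝕜) := hasStrictDerivAt_id _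
  fin_cases i
  · simpa [typeShape, typeDlog, z_ne_zero] using hid
  · change HasStrictDerivAt (fun x : 𝕜 => Ring.inverse (1 - x))
      (Ring.inverse (1 - (z : 𝕜)) * ((1 - z)⁻¹ : ℝ)) (z : 𝕜)
    simp only [Ring.inverse_eq_inv']
    refine ((hasStrictDerivAt_inv one_sub_ne_zero).comp (z : 𝕜)
      (HasStrictDerivAt.const_sub 1 hid)).congr_deriv ?_
    push_cast
    field_simp
  · change HasStrictDerivAt (fun x : 𝕜 => (x - 1) * Ring.inverse x)
      (((z : 𝕜) - 1) * Ring.inverse (z : 𝕜) * ((z * (z - 1))⁻¹ : ℝ)) (z : 𝕜)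
    simp only [Ring.inverse_eq_inv']
    refine (HasStrictDerivAt.fun_mul (hid.sub_const 1)
      (hasStrictDerivAt_inv z_ne_zero)).congr_deriv ?_
    push_cast
    field_simp
    ring

end ShapeFunctions

section Deformation

variable {w : List Letter} {ε : ℤˣ} {z : Fin w.length → ℝ}

local notation "𝒯" => monodromyTriangulation w ε

/-- The number of negative even flags of a tetrahedron. -/
def negativeCount {n : ℕ} (z : Fin n → ℝ) (j : Fin n) : ℕ :=
  (((evenFlags n).filter fun x => flagShape z x < 0).filter fun x => x.1 = j).card

-- The exponent `2` is the number of negative flags around each edge.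
@[to_additive]
theorem prod_prod_edgeCycle_pow_negativeCount {M : Type*} [CommMonoid M]
    (hz : z ∈ canonicalComponents w ε) (f : Fin w.length → Fin 3 → M) :
    ∏ j, (∏ y ∈ edgeCycle 𝒯 (upFlag z j), f y.1 (flagType y)) ^ negativeCount z j =
      (∏ x ∈ evenFlags w.length, f x.1 (flagType x)) ^ 2 := by
  obtain ⟨⟨h01, hT⟩, hpos⟩ := hz
  have h1 (j) := (h01 j).2
  set negative := (evenFlags w.length).filter fun x => flagShape z x < 0 with negative_eq
  have mem_iff (x y) : x ∈ evenFlags w.length ∧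
      y ∈ (edgeCycle 𝒯 x).filter (fun y => flagShape z y < 0) ↔
      x ∈ edgeCycle 𝒯 y ∧ y ∈ negative := by
    have hcomm : y ∈ edgeCycle 𝒯 x ↔ x ∈ edgeCycle 𝒯 y := by
      rw [mem_edgeCycle, mem_edgeCycle, Equiv.Perm.sameCycle_comm]
    simp only [negative_eq, Finset.mem_filter, mem_evenFlags, hcomm]
    constructor
    · rintro ⟨hx, hy, hneg⟩
      exact ⟨hy, by rw [← sign_of_mem_edgeCycle hy, hx], hneg⟩
    · rintro ⟨hx, hy, hneg⟩
      exact ⟨by rw [sign_of_mem_edgeCycle hx, hy], hx, hneg⟩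
  symm
  calc (∏ x ∈ evenFlags w.length, f x.1 (flagType x)) ^ 2
      = ∏ x ∈ evenFlags w.length, ∏ _y ∈ (edgeCycle 𝒯 x).filter fun y => flagShape z y < 0,
          f x.1 (flagType x) := by
        rw [← Finset.prod_pow]
        refine Finset.prod_congr rfl fun x hx => ?_
        rw [Finset.prod_const, card_filter_flagShape_neg (fun j => (h01 j).1) h1
          (hT x (mem_evenFlags.1 hx)).2]
    _ = ∏ y ∈ negative, ∏ x ∈ edgeCycle 𝒯 y, f x.1 (flagType x) := Finset.prod_comm' mem_iff
    _ = ∏ y ∈ negative, ∏ x ∈ edgeCycle 𝒯 (upFlag z y.1), f x.1 (flagType x) :=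
        Finset.prod_congr rfl fun y hy => by
          obtain ⟨heven, hneg⟩ := Finset.mem_filter.1 hy
          exact prod_edgeCycle_eq_of_flagShape_neg hpos h1 f (mem_evenFlags.1 heven) hneg
    _ = _ := by
        rw [← Finset.prod_fiberwise negative (fun y => y.1)]
        refine Finset.prod_congr rfl fun j _ => ?_
        rw [negativeCount, ← negative_eq, ← Finset.prod_const]
        exact Finset.prod_congr rfl fun y hy => by rw [(Finset.mem_filter.1 hy).2]

/-- The Jacobian at `z` of the logarithms of the edge equations, where the equation number `j` is
that of the edge of negative shape parameter of the tetrahedron `j`. -/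
def edgeJacobian (w : List Letter) (ε : ℤˣ) (z : Fin w.length → ℝ) (j l : Fin w.length) : ℝ :=
  ∑ y ∈ edgeCycle (monodromyTriangulation w ε) (upFlag z j),
    if y.1 = l then typeDlog (z y.1) (flagType y) else 0

theorem negativeCount_pos (hpos : ∀ j, 0 < z j) (h1 : ∀ j, z j ≠ 1) (j : Fin w.length) :
    0 < negativeCount z j := by
  refine Finset.card_pos.2 ⟨upFlag z j, ?_⟩
  simp only [Finset.mem_filter, mem_evenFlags]
  exact ⟨⟨sign_upFlag z j, flagShape_upFlag_neg hpos h1 j⟩, rfl⟩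

theorem sum_negativeCount_mul_edgeJacobian (hz : z ∈ canonicalComponents w ε) (l : Fin w.length) :
    ∑ j, (negativeCount z j : ℝ) * edgeJacobian w ε z j l = 0 := by
  let dlog (j : Fin w.length) (i : Fin 3) : ℝ := if j = l then typeDlog (z j) i else 0
  have hsum (j) : dlog j 0 + dlog j 1 + dlog j 2 = 0 := by
    by_cases h : j = l
    · simp only [dlog, if_pos h, typeDlog_add_typeDlog_add_typeDlog (hz.1.1 j).1 (hz.1.1 j).2]
    · simp only [dlog, if_neg h, add_zero]
  have hcount := sum_sum_edgeCycle_nsmul_negativeCount hz dlog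
  simp only [sum_evenFlags, hsum, nsmul_eq_mul, mul_zero, Finset.sum_const_zero] at hcount
  exact hcount

theorem typeDlog_pos_of_mem_edgeCycle (hw : ∀ b, ∃ k : Fin w.length, w[k] ≠ b)
    (hz : z ∈ canonicalComponents w ε) {j : Fin w.length}
    {y : IdealTriangulation.Flag w.length} (hy : y ∈ edgeCycle 𝒯 (upFlag z j)) (hyj : y.1 ≠ j) :
    0 < typeDlog (z y.1) (flagType y) := by
  refine typeDlog_pos (hz.2 _) (hz.1.1 _).2 fun hneg => hyj ?_
  rw [← flagShape_eq_typeShape] at hneg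
  exact fst_eq_of_mem_edgeCycle_upFlag hw hz hy hneg

theorem fst_turn_upFlag (z : Fin w.length → ℝ) (j : Fin w.length) :
    ((𝒯).turn (upFlag z j)).1 = finRotate _ j := by
  rw [turn_of_two_le (two_le_upward (.inl rfl))]
  rfl

theorem isGenerator_edgeJacobian (hw : ∀ b, ∃ k : Fin w.length, w[k] ≠ b)
    (hz : z ∈ canonicalComponents w ε) :
    IsGenerator (edgeJacobian w ε z) (negativeCount z) := by
  have summand_pos {j l : Fin w.length} (hjl : j ≠ l) {y : IdealTriangulation.Flag w.length}
      (hy : y ∈ edgeCycle 𝒯 (upFlag z j)) (hyl : y.1 = l) :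
      0 < if y.1 = l then typeDlog (z y.1) (flagType y) else 0 := by
    rw [if_pos hyl]
    exact typeDlog_pos_of_mem_edgeCycle hw hz hy (hyl.trans_ne hjl.symm)
  have summand_nonneg {j l : Fin w.length} (hjl : j ≠ l) (y)
      (hy : y ∈ edgeCycle 𝒯 (upFlag z j)) :
      0 ≤ if y.1 = l then typeDlog (z y.1) (flagType y) else 0 := by
    by_cases hyl : y.1 = l
    · exact (summand_pos hjl hy hyl).le
    · rw [if_neg hyl]
  refine ⟨negativeCount_pos hz.2 fun j => (hz.1.1 j).2,
    fun j l hjl => Finset.sum_nonneg (summand_nonneg hjl),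
    sum_negativeCount_mul_edgeJacobian hz, fun S hS j hj => ?_⟩
  refine forall_of_finRotate (fun k hk => ?_) hj
  by_cases hfix : k = finRotate _ k
  · rwa [← hfix]
  have hturn : (𝒯).turn (upFlag z k) ∈ edgeCycle 𝒯 (upFlag z k) :=
    mem_edgeCycle.2 Equiv.Perm.SameCycle.rfl.apply_right
  exact hS k hk _ hfix (Finset.sum_pos' (summand_nonneg hfix)
    ⟨_, hturn, summand_pos hfix hturn (fst_turn_upFlag z k)⟩)

/-- The product of the shape parameters `Z` around the edge at which the tetrahedron `j` has
negative shape parameter with respect to `z`. -/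
def edgeHolonomy {𝕜 : Type} [CommRing 𝕜] (w : List Letter) (ε : ℤˣ) (z : Fin w.length → ℝ)
    (j : Fin w.length) (Z : Fin w.length → 𝕜) : 𝕜 :=
  ∏ y ∈ edgeCycle (monodromyTriangulation w ε) (upFlag z j), typeShape (Z y.1) (flagType y)

theorem exists_partialHolonomy_valence_eq_edgeHolonomy (𝕜 : Type) [CommRing 𝕜]
    (hz : z ∈ canonicalComponents w ε) {x : IdealTriangulation.Flag w.length}
    (hx : Equiv.Perm.sign x.2 = 1) :
    ∃ j, ∀ Z : Fin w.length → 𝕜,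
      partialHolonomy 𝒯 Z x ((𝒯).valence x) = edgeHolonomy w ε z j Z := by
  have hcard := card_filter_flagShape_neg (fun j => (hz.1.1 j).1) (fun j => (hz.1.1 j).2)
    (hz.1.2 x hx).2
  obtain ⟨y, hy⟩ := Finset.card_pos.1 (hcard ▸ two_pos)
  obtain ⟨hy, hneg⟩ := Finset.mem_filter.1 hy
  refine ⟨y.1, fun Z => ?_⟩
  rw [partialHolonomy_valence, edgeCycle_eq (mem_edgeCycle.1 hy)]
  simp only [flagShape_eq_typeShape]
  exact prod_edgeCycle_eq_of_flagShape_neg hz.2 (fun j => (hz.1.1 j).2)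
    (fun j i => typeShape (Z j) i) (by rw [sign_of_mem_edgeCycle hy, hx]) hneg

variable {𝕜 : Type} [RCLike 𝕜]

theorem edgeHolonomy_ofReal_eq_one (hz : z ∈ realDeformationVariety 𝒯) (j : Fin w.length) :
    edgeHolonomy w ε z j (fun l => (z l : 𝕜)) = 1 := by
  have hmap := map_partialHolonomy (T := 𝒯) (algebraMap ℝ 𝕜) (fun j => (hz.1 j).1.isUnit)
    (fun j => (sub_ne_zero.2 (hz.1 j).2.symm).isUnit) (upFlag z j) ((𝒯).valence (upFlag z j))
  rw [(hz.2 _ (sign_upFlag z j)).1, map_one, partialHolonomy_valence] at hmap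
  rw [hmap]
  exact Finset.prod_congr rfl fun y _ => (flagShape_eq_typeShape (fun l => (z l : 𝕜)) y).symm

theorem hasStrictFDerivAt_edgeHolonomy (hz : z ∈ realDeformationVariety 𝒯) (j : Fin w.length) :
    HasStrictFDerivAt (edgeHolonomy w ε z j) (∑ l, (edgeJacobian w ε z j l : 𝕜) •
      ContinuousLinearMap.proj (R := 𝕜) (φ := fun _ : Fin w.length => 𝕜) l)
      (fun l => (z l : 𝕜)) := by
  let proj (l : Fin w.length) : (Fin w.length → 𝕜) →L[𝕜] 𝕜 := ContinuousLinearMap.proj l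
  have factor (y : IdealTriangulation.Flag w.length) :
      HasStrictFDerivAt (fun Z : Fin w.length → 𝕜 => typeShape (Z y.1) (flagType y))
        (typeShape (z y.1 : 𝕜) (flagType y) • (typeDlog (z y.1) (flagType y) : 𝕜) • proj y.1)
        (fun l => (z l : 𝕜)) := by
    have hshape := hasStrictDerivAt_typeShape (𝕜 := 𝕜) (hz.1 y.1).1 (hz.1 y.1).2 (flagType y)
    rw [smul_smul]
    exact hshape.comp_hasStrictFDerivAt (x := fun l => (z l : 𝕜)) (f := proj y.1)
      (proj y.1).hasStrictFDerivAt
  refine (hasStrictFDerivAt_prod_of_log _ fun y _ => factor y).congr_fderiv ?_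
  have hone := edgeHolonomy_ofReal_eq_one (𝕜 := 𝕜) hz j
  rw [edgeHolonomy] at hone
  rw [hone, one_smul]
  ext v
  simp only [edgeJacobian, proj, _root_.sum_apply, _root_.smul_apply,
    ContinuousLinearMap.proj_apply, smul_eq_mul, map_sum, Finset.sum_mul]
  rw [Finset.sum_comm]
  refine Finset.sum_congr rfl fun y _ => ?_
  rw [Finset.sum_eq_single y.1 (fun l _ hl => by rw [if_neg hl.symm, map_zero, zero_mul])
    (fun h => absurd (Finset.mem_univ _) h), if_pos rfl]

theorem prod_edgeHolonomy_pow_negativeCount (hz : z ∈ canonicalComponents w ε)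
    {Z : Fin w.length → 𝕜} (h0 : ∀ j, Z j ≠ 0) (h1 : ∀ j, Z j ≠ 1) :
    ∏ j, edgeHolonomy w ε z j Z ^ negativeCount z j = 1 := by
  unfold edgeHolonomy
  rw [prod_prod_edgeCycle_pow_negativeCount hz fun j i => typeShape (Z j) i,
    prod_evenFlags fun j i => typeShape (Z j) i,
    Finset.prod_congr rfl fun j _ => by rw [typeShape_mul_typeShape_mul_typeShape (h0 j) (h1 j)]]
  norm_num

theorem exists_solution_curve (𝕜 : Type) [RCLike 𝕜] (hw : ∀ b, ∃ k : Fin w.length, w[k] ≠ b)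
    (hz : z ∈ canonicalComponents w ε) :
    ∃ (Z : 𝕜 → Fin w.length → 𝕜) (p : Fin w.length → ℝ), (∀ j, Z 0 j = (z j : 𝕜)) ∧
      (∀ j, 0 < p j) ∧ (∀ j, HasDerivAt (fun s => Z s j) (p j : 𝕜) 0) ∧
      (∀ᶠ s in 𝓝 (0 : 𝕜), ContinuousAt Z s) ∧
      ∀ᶠ s in 𝓝 (0 : 𝕜), ∀ x : IdealTriangulation.Flag w.length, Equiv.Perm.sign x.2 = 1 →
        partialHolonomy 𝒯 (Z s) x ((𝒯).valence x) = 1 := by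
  have : Nonempty (Fin w.length) := ⟨(hw .R).choose⟩
  have hprod : ∀ᶠ Z in 𝓝 fun j => (z j : 𝕜),
      ∏ j, edgeHolonomy w ε z j Z ^ negativeCount z j = 1 := by
    have eventually_ne (c : ℝ) (hc : ∀ j, z j ≠ c) :
        ∀ᶠ Z in 𝓝 fun j => (z j : 𝕜), ∀ j, Z j ≠ (c : 𝕜) :=
      eventually_all.2 fun j => (continuous_apply j).continuousAt.eventually_ne
        (RCLike.ofReal_injective.ne (hc j))
    filter_upwards [eventually_ne 0 fun j => (hz.1.1 j).1, eventually_ne 1 fun j => (hz.1.1 j).2]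
      with Z hZ0 hZ1
    exact prod_edgeHolonomy_pow_negativeCount hz (by simpa using hZ0) (by simpa using hZ1)
  obtain ⟨Z, p, hZ0, hp, hder, hcont, hsol⟩ :=
    exists_curve_of_isGenerator (isGenerator_edgeJacobian hw hz)
      (hasStrictFDerivAt_edgeHolonomy hz.1) (edgeHolonomy_ofReal_eq_one hz.1) hprod
  refine ⟨Z, p, congrFun hZ0, hp, hder, hcont, hsol.mono fun s hs x hx => ?_⟩
  obtain ⟨j, hj⟩ := exists_partialHolonomy_valence_eq_edgeHolonomy 𝕜 hz hx
  rw [hj, hs]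

end Deformation

/-! ### Words of Anosov elements -/

section Words

theorem sq_sub_trace_mul_add_det_eq_zero {K : Type*} [Field K] {A : Matrix (Fin 2) (Fin 2) K}
    {a : K} (ha : Module.End.HasEigenvalue (Matrix.toLin' A) a) :
    a ^ 2 - A.trace * a + A.det = 0 := by
  rw [Module.End.hasEigenvalue_iff_isRoot_charpoly, Matrix.charpoly_toLin',
    Matrix.charpoly_fin_two] at ha
  simpa [Polynomial.IsRoot] using ha

theorem mat_R_pow (n : ℕ) : Letter.R.mat ^ n = !![1, (n : ℤ); 0, 1] := by
  induction n with
  | zero => simp [Matrix.one_fin_two]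
  | succ n ih => rw [pow_succ, ih]; simp [Letter.mat, add_comm]

theorem mat_L_eq_transpose : Letter.L.mat = (Letter.R.mat)ᵀ := by
  ext i j
  fin_cases i <;> fin_cases j <;> rfl

theorem trace_wordMat_replicate (n : ℕ) (b : Letter) :
    (wordMat (List.replicate n b)).trace = 2 := by
  rw [wordMat, List.map_replicate, List.prod_replicate]
  cases b
  case R => simp [mat_R_pow, Matrix.trace_fin_two]
  case L =>
    rw [mat_L_eq_transpose, ← Matrix.transpose_pow, Matrix.trace_transpose, mat_R_pow]
    simp [Matrix.trace_fin_two]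

theorem trace_conj (φ P : Matrix.SpecialLinearGroup (Fin 2) ℤ) :
    (P * φ * P⁻¹).1.trace = φ.1.trace := by
  rw [Matrix.SpecialLinearGroup.coe_mul, Matrix.trace_mul_comm, ← Matrix.SpecialLinearGroup.coe_mul,
    ← mul_assoc, inv_mul_cancel, one_mul]

theorem IsAnosov.trace_ne {φ : Matrix.SpecialLinearGroup (Fin 2) ℤ} (hφ : IsAnosov φ) (ε : ℤˣ) :
    φ.1.trace ≠ 2 * ε := by
  intro htrace
  have eigenvalue_eq (a : ℝ)
      (ha : Module.End.HasEigenvalue (Matrix.toLin' (φ.1.map (Int.cast : ℤ → ℝ))) a) :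
      a = (ε : ℤ) := by
    have hroot := sq_sub_trace_mul_add_det_eq_zero ha
    have hmap_trace : (φ.1.map (Int.cast : ℤ → ℝ)).trace = 2 * (ε : ℤ) := by
      exact_mod_cast (AddMonoidHom.map_trace (Int.castAddHom ℝ) φ.1).symm.trans
        (congrArg (Int.castAddHom ℝ) htrace)
    have hmap_det : (φ.1.map (Int.cast : ℤ → ℝ)).det = 1 := by
      rw [← Int.cast_det, φ.2, Int.cast_one]
    have hε : ((ε : ℤ) : ℝ) ^ 2 = 1 := by
      rcases Int.units_eq_one_or ε with rfl | rfl <;> norm_num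
    rw [hmap_trace, hmap_det] at hroot
    exact sub_eq_zero.1 (pow_eq_zero_iff two_ne_zero |>.1 (by linear_combination hroot + hε))
  obtain ⟨a, b, hab, ha, hb⟩ := hφ
  exact hab ((eigenvalue_eq a ha).trans (eigenvalue_eq b hb).symm)

theorem exists_letter_ne {φ P : Matrix.SpecialLinearGroup (Fin 2) ℤ} (hφ : IsAnosov φ) {ε : ℤˣ}
    {w : List Letter} (hw : (P * φ * P⁻¹).1 = (ε : ℤ) • wordMat w) (b : Letter) :
    ∃ k : Fin w.length, w[k] ≠ b := by
  by_contra! hconst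
  have hrep : w = List.replicate w.length b := by
    refine List.eq_replicate_iff.2 ⟨rfl, fun a ha => ?_⟩
    obtain ⟨k, hk, rfl⟩ := List.getElem_of_mem ha
    exact hconst ⟨k, hk⟩
  refine hφ.trace_ne ε ?_
  rw [← trace_conj φ P, hw, Matrix.trace_smul, hrep, trace_wordMat_replicate, smul_eq_mul, mul_comm]

end Words

/-! ### Regeneration of canonical foliations -/

section Regeneration

theorem eventually_pos_of_hasDerivAt {f : ℝ → ℝ} {a x : ℝ} (h : HasDerivAt f a x) (hx : f x = 0)
    (ha : 0 < a) : ∀ᶠ s in 𝓝[>] x, 0 < f s := by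
  have hsign := (eventually_nhdsWithin_sign_eq_of_deriv_pos (h.deriv.symm ▸ ha) hx).filter_mono
    (nhdsWithin_le_nhds (s := Set.Ioi x))
  filter_upwards [hsign, self_mem_nhdsWithin] with s hs hpos
  rwa [sign_pos (sub_pos.2 hpos), sign_eq_one_iff] at hs

/-- The characters `a + b τ ↦ a ± b` of the pseudo-complex numbers, which together identify
`ℝ + ℝ τ` with `ℝ × ℝ`. -/
def pseudoCharacter (σ : ℤˣ) : PseudoComplex →+* ℝ where
  toFun z := z.re + ((σ : ℤ) : ℝ) * z.im
  map_zero' := by simp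
  map_one' := by rw [QuadraticAlgebra.re_one, QuadraticAlgebra.im_one, mul_zero, add_zero]
  map_add' x y := by rw [QuadraticAlgebra.re_add, QuadraticAlgebra.im_add]; ring
  map_mul' x y := by
    rcases Int.units_eq_one_or σ with rfl | rfl <;> simp <;> ring

theorem pseudoCharacter_apply (σ : ℤˣ) (z : PseudoComplex) :
    pseudoCharacter σ z = z.re + ((σ : ℤ) : ℝ) * z.im := rfl

theorem eq_of_forall_pseudoCharacter_eq {x y : PseudoComplex}
    (h : ∀ σ, pseudoCharacter σ x = pseudoCharacter σ y) : x = y := by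
  have hplus := h 1
  have hminus := h (-1)
  simp only [pseudoCharacter_apply, Units.val_one, Units.val_neg, Int.cast_one, Int.cast_neg,
    one_mul, neg_mul] at hplus hminus
  exact QuadraticAlgebra.ext (by linarith) (by linarith)

/-- The value at `s τ` of the extension of a real function `g` to the pseudo-complex numbers: the
element whose images under the two characters are `g s` and `g (-s)`. -/
def pseudoLift (g : ℝ → ℝ) (s : ℝ) : PseudoComplex :=
  ⟨(g s + g (-s)) / 2, (g s - g (-s)) / 2⟩

section PseudoLift

variable {g : ℝ → ℝ}

theorem rePart_pseudoLift (g : ℝ → ℝ) (s : ℝ) :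
    rePart (pseudoLift g s) = (g s + g (-s)) / 2 := rfl

theorem imPart_pseudoLift (g : ℝ → ℝ) (s : ℝ) :
    imPart (pseudoLift g s) = (g s - g (-s)) / 2 := rfl

theorem pseudoCharacter_pseudoLift (g : ℝ → ℝ) (σ : ℤˣ) (s : ℝ) :
    pseudoCharacter σ (pseudoLift g s) = g (((σ : ℤ) : ℝ) * s) := by
  rcases Int.units_eq_one_or σ with rfl | rfl <;>
    simp [pseudoCharacter_apply, pseudoLift] <;> ring

theorem convergesTo_pseudoLift (hg : ContinuousAt g 0) :
    ConvergesTo (𝓝 0) (pseudoLift g) (g 0) := by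
  have hneg : Tendsto (fun s => g (-s)) (𝓝 0) (𝓝 (g 0)) :=
    hg.tendsto.comp (by simpa using continuous_neg.tendsto (0 : ℝ))
  rw [convergesTo_iff]
  simp only [rePart_pseudoLift, imPart_pseudoLift]
  exact ⟨by simpa using (hg.tendsto.add hneg).div_const 2,
    by simpa using (hg.tendsto.sub hneg).div_const 2⟩

theorem continuousAt_plane_pseudoLift {s : ℝ} (hpos : ContinuousAt g s)
    (hneg : ContinuousAt g (-s)) : ContinuousAt (fun s => HasPlane.plane (pseudoLift g s)) s := by
  have hneg : ContinuousAt (fun s => g (-s)) s := hneg.comp continuous_neg.continuousAt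
  exact Complex.equivRealProdCLM.symm.continuous.continuousAt.comp
    (((hpos.add hneg).div_const 2).prodMk ((hpos.sub hneg).div_const 2))

theorem eventually_imPart_pseudoLift_pos {a : ℝ} (hg : HasDerivAt g a 0) (ha : 0 < a) :
    ∀ᶠ s in 𝓝[>] 0, 0 < imPart (pseudoLift g s) := by
  have hneg : HasDerivAt (fun s => g (-s)) (-a) 0 := by
    rw [← neg_zero] at hg
    exact (hg.comp (0 : ℝ) (hasDerivAt_neg (0 : ℝ))).congr_deriv (by simp)
  have him : HasDerivAt (fun s => imPart (pseudoLift g s)) a 0 :=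
    ((hg.sub hneg).div_const 2).congr_deriv (by ring)
  exact eventually_pos_of_hasDerivAt him (by simp [imPart_pseudoLift]) ha

theorem partialHolonomy_pseudoLift_eq_one {n : ℕ} {T : IdealTriangulation n} {Z : ℝ → Fin n → ℝ}
    {s : ℝ} (h0 : ∀ j, 0 < sqNorm (pseudoLift (fun s => Z s j) s))
    (h1 : ∀ j, 0 < sqNorm (1 - pseudoLift (fun s => Z s j) s)) {x : IdealTriangulation.Flag n}
    {k : ℕ} (hpos : partialHolonomy T (Z s) x k = 1) (hneg : partialHolonomy T (Z (-s)) x k = 1) :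
    partialHolonomy T (fun j => pseudoLift (fun s => Z s j) s) x k = 1 := by
  refine eq_of_forall_pseudoCharacter_eq fun σ => ?_
  rw [map_partialHolonomy (pseudoCharacter σ) (fun j => isUnit_of_sqNorm_pos (h0 j))
    (fun j => isUnit_of_sqNorm_pos (h1 j)), map_one]
  simp only [pseudoCharacter_pseudoLift]
  rcases Int.units_eq_one_or σ with rfl | rfl
  · simpa using hpos
  · simpa using hneg

end PseudoLift

section ImaginaryAxis

variable {g : ℂ → ℂ}

theorem tendsto_ofReal_mul_I : Tendsto (fun s : ℝ => (s : ℂ) * Complex.I) (𝓝 0) (𝓝 0) := by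
  simpa using (Complex.continuous_ofReal.mul_const Complex.I).tendsto 0

theorem eventually_im_mul_I_pos {a b : ℝ} (hg : HasDerivAt g a 0) (h0 : g 0 = b) (ha : 0 < a) :
    ∀ᶠ s : ℝ in 𝓝[>] 0, 0 < (g (s * Complex.I)).im := by
  have haxis : HasDerivAt (fun s : ℝ => (s : ℂ) * Complex.I) Complex.I 0 := by
    simpa using (Complex.ofRealCLM.hasDerivAt (x := (0 : ℝ))).mul_const Complex.I
  have hcomp : HasDerivAt (fun s : ℝ => g (s * Complex.I)) (a * Complex.I) 0 :=
    HasDerivAt.comp (h₂ := g) (0 : ℝ) (by simpa using hg) haxis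
  have him : HasDerivAt (fun s : ℝ => (g (s * Complex.I)).im) a 0 := by
    exact (Complex.imCLM.hasFDerivAt.comp_hasDerivAt (0 : ℝ) hcomp).congr_deriv (by simp)
  exact eventually_pos_of_hasDerivAt him (by simp [h0]) ha

end ImaginaryAxis

variable {w : List Letter} {ε : ℤˣ} {F : Foliation (monodromyTriangulation w ε)}

theorem exists_hyperbolicStructure_collapsesTo (hw : ∀ b, ∃ k : Fin w.length, w[k] ≠ b)
    (hz : F.shape ∈ canonicalComponents w ε) :
    ∃ H : Set.Ioi (0 : ℝ) → HyperbolicStructure (monodromyTriangulation w ε),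
      IsPath (fun t => (H t).1) ∧ CollapsesTo (fun t => (H t).1) F := by
  obtain ⟨Z, p, hZ0, hp, hder, hcont, hsol⟩ := exists_solution_curve ℂ hw hz
  have haxis := tendsto_ofReal_mul_I.mono_left (nhdsWithin_le_nhds (s := Set.Ioi 0))
  refine exists_path_collapsesTo F (fun j => (hz.1.1 j).1) (fun j => (hz.1.1 j).2)
    (fun s => Z (s * Complex.I)) ?_ (fun j => ?_)
    (eventually_all.2 fun j => eventually_im_mul_I_pos (hder j) (hZ0 j) (hp j))
    (haxis.eventually hsol)
  · filter_upwards [haxis.eventually hcont] with s hs j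
    exact ContinuousAt.comp (g := fun u => Z u j) (continuousAt_pi.1 hs j)
      (Complex.continuous_ofReal.mul_const Complex.I).continuousAt
  · exact (hZ0 j ▸ (hder j).continuousAt.tendsto).comp haxis

theorem exists_adSStructure_collapsesTo (hw : ∀ b, ∃ k : Fin w.length, w[k] ≠ b)
    (hz : F.shape ∈ canonicalComponents w ε) :
    ∃ A : Set.Ioi (0 : ℝ) → AdSStructure (monodromyTriangulation w ε),
      IsPath (fun t => (A t).1) ∧ CollapsesTo (fun t => (A t).1) F := by
  obtain ⟨Z, p, hZ0, hp, hder, hcont, hsol⟩ := exists_solution_curve ℝ hw hz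
  have h0 (j) : F.shape j ≠ 0 := (hz.1.1 j).1
  have h1 (j) : F.shape j ≠ 1 := (hz.1.1 j).2
  have hright : Tendsto id (𝓝[>] (0 : ℝ)) (𝓝 0) := nhdsWithin_le_nhds
  have hleft : Tendsto (fun s : ℝ => -s) (𝓝[>] 0) (𝓝 0) := by simpa using hright.neg
  have hlim (j) : ConvergesTo (𝓝[>] (0 : ℝ)) (pseudoLift fun s => Z s j) (F.shape j) := by
    have h := (convergesTo_pseudoLift (hder j).continuousAt).comp hright
    rwa [hZ0] at h
  refine exists_path_collapsesTo F h0 h1 (fun s j => pseudoLift (fun s => Z s j) s) ?_ hlim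
    (eventually_all.2 fun j => eventually_imPart_pseudoLift_pos (hder j) (hp j)) ?_
  · filter_upwards [hright.eventually hcont, hleft.eventually hcont] with s hpos hneg j
    exact continuousAt_plane_pseudoLift (continuousAt_pi.1 hpos j) (continuousAt_pi.1 hneg j)
  · filter_upwards [eventually_sqNorm_pos h0 hlim, eventually_sqNorm_one_sub_pos h1 hlim,
      hright.eventually hsol, hleft.eventually hsol] with s hs0 hs1 hpos hneg x hx
    exact partialHolonomy_pseudoLift_eq_one hs0 hs1 (hpos x hx) (hneg x hx)

end Regeneration

end Regen

end

theorem theorem2 (φ P : Matrix.SpecialLinearGroup (Fin 2) ℤ) (hφ : Regen.IsAnosov φ)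
    (ε : ℤˣ) (w : List Regen.Letter)
    (hw : (P * φ * P⁻¹).1 = (ε : ℤ) • Regen.wordMat w)
    (z : Fin w.length → ℝ) (hz : z ∈ Regen.canonicalComponents w ε) :
    (∃ F : Regen.Foliation (Regen.monodromyTriangulation w ε), F.shape = z) ∧
    ∀ F : Regen.Foliation (Regen.monodromyTriangulation w ε), F.shape = z →
      (∃ H : Set.Ioi (0 : ℝ) → Regen.HyperbolicStructure (Regen.monodromyTriangulation w ε),
        Regen.IsPath (fun t => (H t).1) ∧ Regen.CollapsesTo (fun t => (H t).1) F) ∧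
      (∃ A : Set.Ioi (0 : ℝ) → Regen.AdSStructure (Regen.monodromyTriangulation w ε),
        Regen.IsPath (fun t => (A t).1) ∧ Regen.CollapsesTo (fun t => (A t).1) F) := by
  have hletters := Regen.exists_letter_ne hφ hw
  refine ⟨Regen.exists_foliation_shape_eq hz.1, ?_⟩
  rintro F rfl
  exact ⟨Regen.exists_hyperbolicStructure_collapsesTo hletters hz,
    Regen.exists_adSStructure_collapsesTo hletters hz⟩
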